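/- **Setting.** Let $k\ge 1$ and $n\ge 2k-1$. A *model* is a pair $(\pi,\mathbf m)\in\Delta^{k-1}\times[0,1]^{n\times k}$. Real random variables $X_1,\dots,X_n$ with values in $[-B,B]$ are generated by $(\pi,\mathbf m)$ if there is a latent variable $U\in\{1,\dots,k\}$ with $\Pr(U=j)=\pi_j$ such that, conditionally on $U=j$, the $X_i$ are independent with $\mathbb E(X_i\mid U=j)=\mathbf m_{ij}$ (for example, binary variables, with $B=1$). The observable $X_i$ is *$\zeta$-separated* if $|\mathbf m_{ij}-\mathbf m_{ij'}|\ge\zeta$ for all $j\ne j'$. Put $$d_{\mathrm{model}}\big((\pi,\mathbf m),(\pi',\mathbf m')\big)=\min_{\rho\in S_k}\max\Big\{\max_j|\pi_j-\pi'_{\rho(j)}|,\ \max_{i,j}|\mathbf m_{ij}-\mathbf m'_{i\rho(j)}|\Big\}.$$ From $N$ i.i.d. samples of $(X_1,\dots,X_n)$ one forms the empirical moments $\tilde\mu(S)$, the averages of $\prod_{i\in S}X_i$ over the samples, for $S\subseteq[n]$. A *post-sampling algorithm* is a fixed program for a random access machine with an integer memory and a real memory. Its input is $n,k,\zeta,\pi_{\min},\varepsilon$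 and, where indicated, a list of observables; it may look up $\tilde\mu(S)$ for a listed set $S$ at cost of order $|S|$ (the length of the list). Exact real arithmetic and comparisons, memory accesses, and additions and subtractions of indices have unit cost; products and quotients of indices are charged as repeated additions and subtractions; computing one real eigenvalue of a real $d\times d$ matrix costs $O(d^3)$. The *post-sampling runtime* is the total cost. **Corollary.** There are such programs $P_{\mathrm{known}}$ and $P_{\mathrm{unknown}}$ and an absolute constant $K$, and for every $B$ a constant $C$ depending only on $B$, with the following properties for all $k\ge1$ and $n\ge 2k-1$. 1. (Known subset.) Given a list of $2k-1$ distinct observables, $P_{\mathrm{known}}$ always stops within $n\cdot e^{Kk}$ steps. 2. (Unknown subset.) $P_{\mathrm{unknown}}$, which receives no such list, always stops within $n^{2k}\cdot e^{Kk}$ steps. 3. Let $0<\zeta\le 1$, $\pi_{\min}>0$, $0<\varepsilon\le1$, and let $(\pi,\mathbf m)$ be a model with $\pi_j\ge\pi_{\min}$ for all $j$ that generates $[-B,B]$-valued variables, of which some $2k-1$ are $\zeta$-separated. For every integer $c\ge 0$, if the number of samples satisfies $$N\ \ge\ (c+1)\cdot C\,\log(n+1)\,\Big(\frac1\zeta\Big)^{Ck}\Big(\frac1{\pi_{\min}}\Big)^{C}\Big(\frac1\varepsilon\Big)^{2},$$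 then with probability at least $1-(n+1)^{-c}$ the program $P_{\mathrm{unknown}}$ outputs a model $(\tilde\pi,\tilde{\mathbf m})$ with $d_{\mathrm{model}}((\pi,\mathbf m),(\tilde\pi,\tilde{\mathbf m}))<\varepsilon$. The same holds for $P_{\mathrm{known}}$ if it is given a list of $2k-1$ distinct $\zeta$-separated observables. -/

import Mathlib

open MeasureTheory

/-! ## The identification problem -/

/-- A model `(π, 𝐦) ∈ Δ^{k-1} × [0,1]^{n × k}`: the mixing weights of `k` sub-populations and the
conditional means `mean i j = 𝔼(X_i | U = j)`. -/
structure MixModel (n k : ℕ) where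
  weight : Fin k → ℝ
  mean : Fin n → Fin k → ℝ
  weight_mem : weight ∈ stdSimplex ℝ (Fin k)
  mean_mem : ∀ i j, mean i j ∈ Set.Icc (0 : ℝ) 1

namespace MixModel

variable {n k : ℕ}

/-- The `L_∞` distance up to relabelling the latent variable; `dist` on `Fin k → ℝ` and on
`Fin n → Fin k → ℝ` is the sup distance. -/
noncomputable def dModel (Q Q' : MixModel n k) : ℝ :=
  ⨅ ρ : Equiv.Perm (Fin k),
    max (dist Q.weight (fun j => Q'.weight (ρ j))) (dist Q.mean (fun i j => Q'.mean i (ρ j)))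

/-- The observable `X_i` is `ζ`-separated. -/
def Separated (Q : MixModel n k) (ζ : ℝ) (i : Fin n) : Prop :=
  ∀ j j' : Fin k, j ≠ j' → ζ ≤ |Q.mean i j - Q.mean i j'|

/-- `ν j i` can be the law of `X_i` conditional on `U = j`: a probability distribution on the line,
supported in `[-B, B]`, with the mean that the model prescribes. -/
def IsConditional (Q : MixModel n k) (B : ℝ) (ν : Fin k → Fin n → Measure ℝ) : Prop :=
  ∀ j i, IsProbabilityMeasure (ν j i) ∧ (∀ᵐ x ∂(ν j i), x ∈ Set.Icc (-B) B) ∧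
    ∫ x, x ∂(ν j i) = Q.mean i j

/-- The law of `(X_1, …, X_n)`: the mixture, with the weights of the model, of the product
distributions `⨂_i ν j i`. -/
noncomputable def law (Q : MixModel n k) (ν : Fin k → Fin n → Measure ℝ) :
    Measure (Fin n → ℝ) :=
  ∑ j, ENNReal.ofReal (Q.weight j) • Measure.pi (ν j)

/-- The law of `N` independent samples of `(X_1, …, X_n)`. -/
noncomputable def sampleLaw (Q : MixModel n k) (ν : Fin k → Fin n → Measure ℝ) (N : ℕ) :
    Measure (Fin N → Fin n → ℝ) :=
  Measure.pi fun _ => Q.law ν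

end MixModel

/-- The empirical multilinear moment `𝔼~[∏_{i ∈ S} X_i]` of `N` samples. Observables are numbered
`0, …, n-1`; members of `S` outside this range are ignored. -/
noncomputable def empiricalMoment {N n : ℕ} (x : Fin N → Fin n → ℝ) (S : Finset ℕ) : ℝ :=
  (∑ t, ∏ i ∈ Finset.univ.filter (fun i : Fin n => (i : ℕ) ∈ S), x t i) / N

/-! ## Uniform programs over the reals, with a step count

A random access machine with an integer memory (for indices) and a real memory. Exact real
arithmetic and comparisons have unit cost; there is no rounding from reals to integers and there are
no real constants. The statistics are a read-only table: the entry for a set of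
observables is looked up by listing the set. Eigenvalues of a `d × d` matrix cost `d ^ 3`.
Loops run for a number of rounds fixed on entry, so that every program halts. -/

/-- The two memories. -/
structure RamState where
  int : ℕ → ℕ
  real : ℕ → ℝ

/-- Integer expressions; `get e` is the content of the integer memory at address `e`. -/
inductive IntExp where
  | lit (c : ℕ)
  | get (e : IntExp)
  | add (a b : IntExp)
  | sub (a b : IntExp)
  | mul (a b : IntExp)
  | div (a b : IntExp)
  | mod (a b : IntExp)

namespace IntExp

def eval (s : RamState) : IntExp → ℕ
  | lit c => c
  | get e => s.int (e.eval s)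
  | add a b => a.eval s + b.eval s
  | sub a b => a.eval s - b.eval s
  | mul a b => a.eval s * b.eval s
  | div a b => a.eval s / b.eval s
  | mod a b => a.eval s % b.eval s

/-- Additions, truncated subtractions and memory accesses have unit cost. Products and quotients are
charged as repeated additions and subtractions, which excludes the power of unit-cost products of
huge integers. -/
def cost (s : RamState) : IntExp → ℕ
  | lit _ => 1
  | get e => e.cost s + 1
  | add a b => a.cost s + b.cost s + 1
  | sub a b => a.cost s + b.cost s + 1
  | mul a b => a.cost s + b.cost s + b.eval s + 1
  | div a b => a.cost s + b.cost s + a.eval s / b.eval s + 1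
  | mod a b => a.cost s + b.cost s + a.eval s / b.eval s + 1

end IntExp

/-- The `i`-th largest real eigenvalue (counting from `0`, with algebraic multiplicity) of a real
matrix, and `0` if there are not that many. -/
noncomputable def realEigenvalue {d : ℕ} (A : Matrix (Fin d) (Fin d) ℝ) (i : ℕ) : ℝ :=
  (A.charpoly.roots.sort (· ≥ ·)).getD i 0

/-- Real expressions. `get e` is the content of the real memory at address `e`; `ofInt e` is an
integer as a real number; `stat base len` is the entry of the table of statistics for the set of
observables listed in the integer memory at the addresses `base, …, base + len - 1`;
`eig base dim i` is the `i`-th largest real eigenvalue of the matrix of size `dim × dim` stored row by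
row in the real memory from the address `base` on. -/
inductive RealExp where
  | ofInt (e : IntExp)
  | get (e : IntExp)
  | add (a b : RealExp)
  | sub (a b : RealExp)
  | mul (a b : RealExp)
  | div (a b : RealExp)
  | stat (base len : IntExp)
  | eig (base dim i : IntExp)

namespace RealExp

/-- The value of a real expression, for the table of statistics `M` (with `x / 0 = 0`). -/
noncomputable def eval (M : Finset ℕ → ℝ) (s : RamState) : RealExp → ℝ
  | ofInt e => (e.eval s : ℝ)
  | get e => s.real (e.eval s)
  | add a b => a.eval M s + b.eval M s
  | sub a b => a.eval M s - b.eval M s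
  | mul a b => a.eval M s * b.eval M s
  | div a b => a.eval M s / b.eval M s
  | stat base len => M ((Finset.range (len.eval s)).image fun t => s.int (base.eval s + t))
  | eig base dim i =>
      realEigenvalue (d := dim.eval s)
        (Matrix.of fun a b => s.real (base.eval s + a * dim.eval s + b)) (i.eval s)

/-- Unit cost for arithmetic and memory accesses, `len` for the look-up of a set that is given by
`len` entries, `dim ^ 3` for an eigenvalue. -/
def cost (s : RamState) : RealExp → ℕ
  | ofInt e => e.cost s + 1
  | get e => e.cost s + 1
  | add a b => a.cost s + b.cost s + 1
  | sub a b => a.cost s + b.cost s + 1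
  | mul a b => a.cost s + b.cost s + 1
  | div a b => a.cost s + b.cost s + 1
  | stat base len => base.cost s + len.cost s + len.eval s + 1
  | eig base dim i => base.cost s + dim.cost s + i.cost s + dim.eval s ^ 3 + 1

end RealExp

/-- Programs: assignments `int[a] := e` and `real[a] := e`, composition, branching on strict
comparisons of integers or of reals, and `e`-fold repetition. -/
inductive RamProg where
  | skip
  | setInt (a e : IntExp)
  | setReal (a : IntExp) (e : RealExp)
  | seq (p q : RamProg)
  | ifInt (a b : IntExp) (p q : RamProg)
  | ifReal (a b : RealExp) (p q : RamProg)
  | rep (e : IntExp) (p : RamProg)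

namespace RamProg

/-- The final state of a program that is started in the state `s` with the statistics `M`. -/
noncomputable def exec (M : Finset ℕ → ℝ) : RamProg → RamState → RamState
  | skip, s => s
  | setInt a e, s => { s with int := Function.update s.int (a.eval s) (e.eval s) }
  | setReal a e, s => { s with real := Function.update s.real (a.eval s) (e.eval M s) }
  | seq p q, s => q.exec M (p.exec M s)
  | ifInt a b p q, s => if a.eval s < b.eval s then p.exec M s else q.exec M s
  | ifReal a b p q, s => if a.eval M s < b.eval M s then p.exec M s else q.exec M s
  | rep e p, s => (p.exec M)^[e.eval s] s

/-- The number of steps of this run. -/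
noncomputable def time (M : Finset ℕ → ℝ) : RamProg → RamState → ℕ
  | skip, _ => 1
  | setInt a e, s => a.cost s + e.cost s + 1
  | setReal a e, s => a.cost s + e.cost s + 1
  | seq p q, s => p.time M s + q.time M (p.exec M s) + 1
  | ifInt a b p q, s =>
      a.cost s + b.cost s + 1 + if a.eval s < b.eval s then p.time M s else q.time M s
  | ifReal a b p q, s =>
      a.cost s + b.cost s + 1 + if a.eval M s < b.eval M s then p.time M s else q.time M s
  | rep e p, s =>
      e.cost s + 1 + ∑ r ∈ Finset.range (e.eval s), (p.time M ((p.exec M)^[r] s) + 1)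

end RamProg

/-! ## Input, output and resources -/

/-- The real memory at the start holds `ζ`, the lower bound `p` for the weights, and the target
accuracy `ε`. -/
def inputReal (ζ p ε : ℝ) : ℕ → ℝ
  | 0 => ζ
  | 1 => p
  | 2 => ε
  | _ => 0

/-- The input when no separated observables are known: `n`, `k`, `ζ`, `p`, `ε`. -/
def inputUnknown (n k : ℕ) (ζ p ε : ℝ) : RamState where
  int
    | 0 => n
    | 1 => k
    | _ => 0
  real := inputReal ζ p ε

/-- The input when the observables `A 0, …, A (2k-2)` are known to be separated: in addition, their
indices, from the address `2` on. -/
def inputKnown (n k : ℕ) (ζ p ε : ℝ) (A : Fin (2 * k - 1) → Fin n) : RamState where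
  int
    | 0 => n
    | 1 => k
    | t + 2 => if h : t < 2 * k - 1 then A ⟨t, h⟩ else 0
  real := inputReal ζ p ε

/-- The real memory of `s` starts with the `k` weights of `Q`, followed by its `n × k` matrix of
conditional means, row by row. -/
def Outputs {n k : ℕ} (s : RamState) (Q : MixModel n k) : Prop :=
  (∀ j : Fin k, s.real j = Q.weight j) ∧
    ∀ (i : Fin n) (j : Fin k), s.real (k + i * k + j) = Q.mean i j

/-- The program `P`, started in `s` with the empirical moments of the samples `x`, outputs a model
within distance less than `ε` of `Q`. -/
def Identifies {n k N : ℕ} (P : RamProg) (s : RamState) (x : Fin N → Fin n → ℝ)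
    (Q : MixModel n k) (ε : ℝ) : Prop :=
  ∃ Q' : MixModel n k, Outputs (P.exec (empiricalMoment x) s) Q' ∧ Q.dModel Q' < ε

/-- `log n · (1/ζ)^{O(k)} · (1/p)^{O(1)} · (1/ε)^2`, with `C` for the implied constants, and with
`log (n + 1)` for `log n` so that it does not vanish at `n = 1`. -/
noncomputable def sampleBound (C n k : ℕ) (ζ p ε : ℝ) : ℝ :=
  C * Real.log (n + 1) * (1 / ζ) ^ (C * k) * (1 / p) ^ C * (1 / ε) ^ 2

/-! Take distinct observables numbered 1, …, 2k-1. Index rows by subsets a of the first k-1 of them,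
columns by subsets b of the next k-1, and let C be the matrix of the moments of a ∪ b. Conditional
independence gives C = H diag(π) Gᵀ, where the columns of H and G consist of products of means of
one class; including a further observable x replaces π by π·m_x and gives a matrix C_x.

Elimination with complete pivoting, applied for k steps to the empirical C bordered by identity
matrices, produces row vectors x_s and column vectors y_u of ℓ¹ norm at most 2^k such that x_s C y_u
is the pivot d_u for s = u and 0 otherwise (`IsElimination.sum_sum`). Put F = (x_s H) and P = (π Gᵀ
y_u / d_u). Then F P ≈ 1, and with x the last observable the k × k matrix A = (x_s C_x y_u / d_u) is
close to F diag(m_x) P. Hence A is conjugate to a perturbed diagonal matrix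
(`Matrix.exists_conjugation`), and its eigenvalues are close to the means of the last observable.
The Lagrange polynomials of the eigenvalues, evaluated at A, approximate the spectral projections,
so no eigenvectors are needed. Paired with the vectors that belong to the empty set, they yield π_j
and π_j m_ij for every i (`Matrix.coefficient_error`), and a quotient yields the mean.

All errors are controlled by a lower bound τ for the pivots. If the observables are separated, H and
G have left inverses of ℓ¹ norm at most (2/ζ)^(k-1), by interpolation with one linear factor per
observable (`exists_hadamard_left_inverse`). Fewer than k elimination steps cannot destroy this rank
k structure, so the pivots are large (`IsElimination.le_of_left_inverse`).

If no separated observables are known, all n^(2k-1) tuples are tried. A tuple is accepted if its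
members are distinct, the pivots are at least τ = p (ζ/16)^(2k) in absolute value, and consecutive
eigenvalues are ζ/2 apart. With moments accurate up to ε τ^8, every separated tuple is accepted, and
every accepted tuple, separated or not, yields a model within ε
(`MixModel.IsApprox.exists_model_and_passes`). This is deterministic; randomness enters only through
Hoeffding's inequality and a union bound over the sets of at most 2k-1 observables.

The algorithm is written in a language with named arrays and compiled to the random access machine.
The compilation is a simulation (`MP.toSt_exec_comp`) that does not underestimate the time. Every
part that does not loop over observables or tuples costs a fixed power of W = 100000·8^k, that is,
e^(O(k)). -/

/-! ## Programs with named arrays -/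

/-- Names of arrays of integers; scalars are kept in the entry `0`. -/
inductive IVar where
  | tup | dim | ext | code | cur | bit | extra | piv | step | row | col | idx | i | j | l
  | left | right | ok | found | carry | count

/-- Names of arrays of reals; scalars are kept in the entry `0`. -/
inductive RVar where
  | mom | big | xs | ys | piv | acc | mat | eig | vec | vec' | coef | rem | wt | val | gap | tau

def IVar.num : IVar → ℕ
  | tup => 0 | dim => 1 | ext => 2 | code => 4 | cur => 5 | bit => 6 | extra => 7
  | piv => 8 | step => 9 | row => 10 | col => 11 | idx => 12 | i => 13 | j => 14 | l => 15
  | left => 16 | right => 17 | ok => 18 | found => 19 | carry => 20 | count => 21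

def RVar.num : RVar → ℕ
  | mom => 0 | big => 1 | xs => 2 | ys => 3 | piv => 4 | acc => 5 | mat => 6 | eig => 7 | vec => 8
  | vec' => 9 | coef => 10 | rem => 11 | wt => 12 | val => 13 | gap => 14 | tau => 16

theorem IVar.num_lt (a : IVar) : a.num < 32 := by cases a <;> simp [num]

theorem RVar.num_lt (a : RVar) : a.num < 32 := by cases a <;> simp [num]

theorem IVar.num_inj {a b : IVar} : a.num = b.num ↔ a = b := by
  refine ⟨fun h => ?_, fun h => h ▸ rfl⟩
  cases a <;> cases b <;> first | rfl | (simp [num] at h)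

theorem RVar.num_inj {a b : RVar} : a.num = b.num ↔ a = b := by
  refine ⟨fun h => ?_, fun h => h ▸ rfl⟩
  cases a <;> cases b <;> first | rfl | (simp [num] at h)

instance : DecidableEq IVar := fun _ _ => decidable_of_iff _ IVar.num_inj

instance : DecidableEq RVar := fun _ _ => decidable_of_iff _ RVar.num_inj

/-- Memory organised into named arrays, with the regions that hold the input tuple, the list for
look-ups of statistics, and the output. -/
@[ext]
structure St where
  n : ℕ
  k : ℕ
  I : IVar → ℕ → ℕ
  R : RVar → ℕ → ℝ
  inp : ℕ → ℕ
  buf : ℕ → ℕ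
  low : ℕ → ℝ

namespace St

def setI (s : St) (a : IVar) (i v : ℕ) : St :=
  { s with I := fun b j => if b = a ∧ j = i then v else s.I b j }

def setR (s : St) (a : RVar) (i : ℕ) (v : ℝ) : St :=
  { s with R := fun b j => if b = a ∧ j = i then v else s.R b j }

/-- Writes beyond the region are ignored, so that no address, however large, can damage the named
arrays behind it. The compiled program makes this comparison explicitly. The same holds for
`setLow`. -/
def setBuf (s : St) (i v : ℕ) : St :=
  { s with buf := fun j => if j = i ∧ j ≤ 2 * s.k then v else s.buf j }

/-- The size of the region of the real memory reserved for the output and for eigenvalue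
computations. -/
def lowSize (s : St) : ℕ := s.k + s.n * s.k + s.k * s.k + 3

def setLow (s : St) (i : ℕ) (v : ℝ) : St :=
  { s with low := fun j => if j = i ∧ j < s.lowSize then v else s.low j }

section simps
variable (s : St) (a : IVar) (a' : RVar) (i v : ℕ) (w : ℝ)

@[simp] theorem setI_n : (s.setI a i v).n = s.n := rfl
@[simp] theorem setI_k : (s.setI a i v).k = s.k := rfl
@[simp] theorem setI_R : (s.setI a i v).R = s.R := rfl
@[simp] theorem setI_inp : (s.setI a i v).inp = s.inp := rfl
@[simp] theorem setI_buf : (s.setI a i v).buf = s.buf := rfl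
@[simp] theorem setI_low : (s.setI a i v).low = s.low := rfl
@[simp] theorem setI_I (b : IVar) (j : ℕ) :
    (s.setI a i v).I b j = if b = a ∧ j = i then v else s.I b j := rfl
@[simp] theorem setR_n : (s.setR a' i w).n = s.n := rfl
@[simp] theorem setR_k : (s.setR a' i w).k = s.k := rfl
@[simp] theorem setR_I : (s.setR a' i w).I = s.I := rfl
@[simp] theorem setR_inp : (s.setR a' i w).inp = s.inp := rfl
@[simp] theorem setR_buf : (s.setR a' i w).buf = s.buf := rfl
@[simp] theorem setR_low : (s.setR a' i w).low = s.low := rfl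
@[simp] theorem setR_R (b : RVar) (j : ℕ) :
    (s.setR a' i w).R b j = if b = a' ∧ j = i then w else s.R b j := rfl
@[simp] theorem setBuf_n : (s.setBuf i v).n = s.n := rfl
@[simp] theorem setBuf_k : (s.setBuf i v).k = s.k := rfl
@[simp] theorem setBuf_I : (s.setBuf i v).I = s.I := rfl
@[simp] theorem setBuf_R : (s.setBuf i v).R = s.R := rfl
@[simp] theorem setBuf_inp : (s.setBuf i v).inp = s.inp := rfl
@[simp] theorem setBuf_low : (s.setBuf i v).low = s.low := rfl
@[simp] theorem setBuf_buf (j : ℕ) :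
    (s.setBuf i v).buf j = if j = i ∧ j ≤ 2 * s.k then v else s.buf j := rfl
@[simp] theorem setLow_n : (s.setLow i w).n = s.n := rfl
@[simp] theorem setLow_k : (s.setLow i w).k = s.k := rfl
@[simp] theorem setLow_I : (s.setLow i w).I = s.I := rfl
@[simp] theorem setLow_R : (s.setLow i w).R = s.R := rfl
@[simp] theorem setLow_inp : (s.setLow i w).inp = s.inp := rfl
@[simp] theorem setLow_buf : (s.setLow i w).buf = s.buf := rfl
@[simp] theorem setLow_low (j : ℕ) :
    (s.setLow i w).low j = if j = i ∧ j < s.lowSize then w else s.low j := rfl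

end simps

end St

namespace RamState

/-- The cells 0 and 1 hold n and k, the cells 2, …, 2k+2 the input tuple, and 2k+3, …, 4k+3 the list
for look-ups. -/
def intBase (k : ℕ) : ℕ := 4 * k + 4

/-- Large enough for the output, for a k × k matrix and for the three input numbers. All of them
start at the address 0 and overwrite one another. -/
def realBase (n k : ℕ) : ℕ := k + n * k + k * k + 3

/-- The named arrays in the memory of a random access machine: interleaved, after the regions with
the input, the list for look-ups and the output. -/
def toSt (σ : RamState) : St where
  n := σ.int 0
  k := σ.int 1
  I a i := σ.int (intBase (σ.int 1) + (a.num + i * 32))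
  R a i := σ.real (realBase (σ.int 0) (σ.int 1) + (a.num + i * 32))
  inp j := if j ≤ 2 * σ.int 1 then σ.int (2 + j) else 0
  buf j := if j ≤ 2 * σ.int 1 then σ.int (2 * σ.int 1 + 3 + j) else 0
  low i := if i < realBase (σ.int 0) (σ.int 1) then σ.real i else 0

end RamState

/-- Integer expressions with named arrays. -/
inductive IE where
  | lit (c : ℕ)
  | n
  | k
  | var (a : IVar) (e : IE)
  | inp (e : IE)
  | add (a b : IE)
  | sub (a b : IE)
  | mul (a b : IE)
  | div (a b : IE)
  | mod (a b : IE)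

namespace IE

@[simp] def eval (s : St) : IE → ℕ
  | lit c => c
  | n => s.n
  | k => s.k
  | var a e => s.I a (e.eval s)
  | inp e => s.inp (min (e.eval s) (2 * s.k))
  | add a b => a.eval s + b.eval s
  | sub a b => a.eval s - b.eval s
  | mul a b => a.eval s * b.eval s
  | div a b => a.eval s / b.eval s
  | mod a b => a.eval s % b.eval s

-- The constants cover the address computations of the compiled expressions. They do not depend on
-- n, k or the index.
@[simp] def cost (s : St) : IE → ℕ
  | lit _ => 1
  | n => 2
  | k => 2
  | var _ e => e.cost s + 60
  | inp e => 2 * e.cost s + 20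
  | add a b => a.cost s + b.cost s + 1
  | sub a b => a.cost s + b.cost s + 1
  | mul a b => a.cost s + b.cost s + b.eval s + 1
  | div a b => a.cost s + b.cost s + a.eval s / b.eval s + 1
  | mod a b => a.cost s + b.cost s + a.eval s / b.eval s + 1

def ramK : IntExp := .get (.lit 1)

/-- A product costs its second factor. So the literal 32 stands on the right, and 4k is formed by
additions; this makes the cost of an access independent of the index and of k. -/
def ramAddr (a : IVar) (e : IntExp) : IntExp :=
  .add (.add (.lit 4) (.add (.add ramK ramK) (.add ramK ramK))) (.add (.lit a.num) (.mul e (.lit 32)))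

def comp : IE → IntExp
  | lit c => .lit c
  | n => .get (.lit 0)
  | k => ramK
  | var a e => .get (ramAddr a e.comp)
  -- With truncated subtraction, e - (e - 2k) is the minimum of e and 2k.
  | inp e => .get (.add (.lit 2) (.sub e.comp (.sub e.comp (.add ramK ramK))))
  | add a b => .add a.comp b.comp
  | sub a b => .sub a.comp b.comp
  | mul a b => .mul a.comp b.comp
  | div a b => .div a.comp b.comp
  | mod a b => .mod a.comp b.comp

theorem eval_ramAddr (a : IVar) (e : IntExp) (σ : RamState) :
    (ramAddr a e).eval σ = RamState.intBase (σ.int 1) + (a.num + e.eval σ * 32) := by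
  simp [ramAddr, ramK, IntExp.eval, RamState.intBase]; omega

theorem cost_ramAddr (a : IVar) (e : IntExp) (σ : RamState) :
    (ramAddr a e).cost σ = e.cost σ + 50 := by
  simp [ramAddr, ramK, IntExp.cost, IntExp.eval]; omega

theorem eval_comp (e : IE) (σ : RamState) : e.comp.eval σ = e.eval σ.toSt := by
  induction e with
  | lit c => rfl
  | n => rfl
  | k => rfl
  | var a e ih => simp only [comp, IntExp.eval, eval_ramAddr, ih, eval]; rfl
  | inp e ih =>
    have h : min (e.eval σ.toSt) (2 * σ.int 1) ≤ 2 * σ.int 1 := min_le_right _ _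
    have h2 : e.eval σ.toSt - (e.eval σ.toSt - (σ.int 1 + σ.int 1)) =
      min (e.eval σ.toSt) (2 * σ.int 1) := by omega
    simp only [comp, IntExp.eval, ih, ramK, h2]
    simp [RamState.toSt]
  | add a b iha ihb => simp only [comp, IntExp.eval, iha, ihb, eval]
  | sub a b iha ihb => simp only [comp, IntExp.eval, iha, ihb, eval]
  | mul a b iha ihb => simp only [comp, IntExp.eval, iha, ihb, eval]
  | div a b iha ihb => simp only [comp, IntExp.eval, iha, ihb, eval]
  | mod a b iha ihb => simp only [comp, IntExp.eval, iha, ihb, eval]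

theorem cost_comp_le (e : IE) (σ : RamState) : e.comp.cost σ ≤ e.cost σ.toSt := by
  induction e with
  | lit c => simp [comp, IntExp.cost]
  | n => simp [comp, IntExp.cost]
  | k => simp [comp, ramK, IntExp.cost]
  | var a e ih => simp only [comp, IntExp.cost, cost_ramAddr, cost]; omega
  | inp e ih => simp only [comp, IntExp.cost, cost, ramK]; omega
  | add a b iha ihb => simp only [comp, IntExp.cost, cost]; omega
  | sub a b iha ihb => simp only [comp, IntExp.cost, cost]; omega
  | mul a b iha ihb => simp only [comp, IntExp.cost, cost, eval_comp]; omega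
  | div a b iha ihb => simp only [comp, IntExp.cost, cost, eval_comp]; omega
  | mod a b iha ihb => simp only [comp, IntExp.cost, cost, eval_comp]; omega

end IE

/-- Real expressions with named arrays. -/
inductive RE where
  | ofInt (e : IE)
  | var (a : RVar) (e : IE)
  | inp (c : Fin 3)
  | add (a b : RE)
  | sub (a b : RE)
  | mul (a b : RE)
  | div (a b : RE)
  | stat
  | eig (e : IE)

namespace RE

@[simp] noncomputable def eval (M : Finset ℕ → ℝ) (s : St) : RE → ℝ
  | ofInt e => (e.eval s : ℝ)
  | var a e => s.R a (e.eval s)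
  | inp c => s.low c
  | add a b => a.eval M s + b.eval M s
  | sub a b => a.eval M s - b.eval M s
  | mul a b => a.eval M s * b.eval M s
  | div a b => a.eval M s / b.eval M s
  | stat => M ((Finset.range (2 * s.k - 1)).image s.buf)
  | eig e => realEigenvalue (d := s.k) (Matrix.of fun a b => s.low (a * s.k + b)) (e.eval s)

@[simp] def cost (s : St) : RE → ℕ
  | ofInt e => e.cost s + 1
  | var _ e => e.cost s + 2 * s.k + 100
  | inp _ => 2
  | add a b => a.cost s + b.cost s + 1
  | sub a b => a.cost s + b.cost s + 1
  | mul a b => a.cost s + b.cost s + 1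
  | div a b => a.cost s + b.cost s + 1
  | stat => 2 * s.k + 50
  | eig e => e.cost s + s.k ^ 3 + 10

/-- In n * k the factor k stands on the right, so that the cost is of order k and not n. Otherwise
each access to the real memory would contribute a factor n to the running time. -/
def ramBase : IntExp :=
  .add (.add IE.ramK (.mul (.get (.lit 0)) IE.ramK)) (.add (.mul IE.ramK IE.ramK) (.lit 3))

def ramAddr (a : RVar) (e : IntExp) : IntExp :=
  .add ramBase (.add (.lit a.num) (.mul e (.lit 32)))

theorem eval_ramBase (σ : RamState) :
    ramBase.eval σ = RamState.realBase (σ.int 0) (σ.int 1) := by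
  simp [ramBase, IE.ramK, IntExp.eval, RamState.realBase]; omega

theorem cost_ramBase (σ : RamState) : ramBase.cost σ = 2 * σ.int 1 + 16 := by
  simp [ramBase, IE.ramK, IntExp.cost, IntExp.eval]; omega

theorem eval_ramAddr (a : RVar) (e : IntExp) (σ : RamState) :
    (ramAddr a e).eval σ = RamState.realBase (σ.int 0) (σ.int 1) + (a.num + e.eval σ * 32) := by
  simp [ramAddr, eval_ramBase, IntExp.eval]

theorem cost_ramAddr (a : RVar) (e : IntExp) (σ : RamState) :
    (ramAddr a e).cost σ = e.cost σ + 2 * σ.int 1 + 53 := by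
  simp [ramAddr, IntExp.cost, IntExp.eval, cost_ramBase]; omega

def comp : RE → RealExp
  | ofInt e => .ofInt e.comp
  | var a e => .get (ramAddr a e.comp)
  | inp c => .get (.lit c)
  | add a b => .add a.comp b.comp
  | sub a b => .sub a.comp b.comp
  | mul a b => .mul a.comp b.comp
  | div a b => .div a.comp b.comp
  | stat => .stat (.add (.add IE.ramK IE.ramK) (.lit 3)) (.sub (.add IE.ramK IE.ramK) (.lit 1))
  | eig e => .eig (.lit 0) IE.ramK e.comp

theorem eval_comp (M : Finset ℕ → ℝ) (e : RE) (σ : RamState) :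
    e.comp.eval M σ = e.eval M σ.toSt := by
  induction e with
  | ofInt e => simp only [comp, RealExp.eval, IE.eval_comp, eval]
  | var a e => simp only [comp, RealExp.eval, eval_ramAddr, IE.eval_comp, eval]; rfl
  | inp c =>
    have : (c : ℕ) < RamState.realBase (σ.int 0) (σ.int 1) := by
      unfold RamState.realBase; omega
    simp [comp, RealExp.eval, eval, IntExp.eval, RamState.toSt, this]
  | add a b iha ihb => simp only [comp, RealExp.eval, iha, ihb, eval]
  | sub a b iha ihb => simp only [comp, RealExp.eval, iha, ihb, eval]
  | mul a b iha ihb => simp only [comp, RealExp.eval, iha, ihb, eval]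
  | div a b iha ihb => simp only [comp, RealExp.eval, iha, ihb, eval]
  | stat =>
    simp only [comp, RealExp.eval, IntExp.eval, IE.ramK, eval, RamState.toSt, ← two_mul]
    congr 1
    refine Finset.image_congr fun t ht => ?_
    have : t ≤ 2 * σ.int 1 := by simp at ht; omega
    simp [this]
  | eig e =>
    simp only [comp, RealExp.eval, IntExp.eval, IE.ramK, eval, IE.eval_comp]
    have : ∀ a b : Fin (σ.int 1), (a : ℕ) * σ.int 1 + b < RamState.realBase (σ.int 0) (σ.int 1) := by
      intro a b
      have h1 : (a : ℕ) * σ.int 1 + b < σ.int 1 * σ.int 1 := by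
        have := a.2; have := b.2
        calc (a : ℕ) * σ.int 1 + b < a * σ.int 1 + σ.int 1 := by omega
          _ = (a + 1) * σ.int 1 := by ring
          _ ≤ _ := Nat.mul_le_mul_right _ (by omega)
      unfold RamState.realBase; omega
    simp [RamState.toSt, this]
    rfl

theorem cost_comp_le (e : RE) (σ : RamState) : e.comp.cost σ ≤ e.cost σ.toSt := by
  induction e with
  | ofInt e =>
    have := e.cost_comp_le σ
    simp only [comp, RealExp.cost, cost]; omega
  | var a e =>
    have := e.cost_comp_le σ
    have h : σ.toSt.k = σ.int 1 := rfl
    simp only [comp, RealExp.cost, cost_ramAddr, cost, h]; omega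
  | inp c => simp [comp, RealExp.cost, cost, IntExp.cost]
  | add a b iha ihb => simp only [comp, RealExp.cost, cost]; omega
  | sub a b iha ihb => simp only [comp, RealExp.cost, cost]; omega
  | mul a b iha ihb => simp only [comp, RealExp.cost, cost]; omega
  | div a b iha ihb => simp only [comp, RealExp.cost, cost]; omega
  | stat =>
    have h : σ.toSt.k = σ.int 1 := rfl
    simp only [comp, RealExp.cost, IntExp.cost, IntExp.eval, IE.ramK, cost, h]; omega
  | eig e =>
    have := e.cost_comp_le σ
    have h : σ.toSt.k = σ.int 1 := rfl
    simp only [comp, RealExp.cost, IntExp.cost, IntExp.eval, IE.ramK, cost, h]; omega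

end RE

/-- Programs with named arrays. -/
inductive MP where
  | skip
  | setI (a : IVar) (i v : IE)
  | setR (a : RVar) (i : IE) (v : RE)
  | setBuf (i v : IE)
  | setLow (i : IE) (v : RE)
  | seq (p q : MP)
  | ifI (a b : IE) (p q : MP)
  | ifR (a b : RE) (p q : MP)
  | rep (e : IE) (p : MP)

namespace MP

noncomputable def exec (M : Finset ℕ → ℝ) : MP → St → St
  | skip, s => s
  | setI a i v, s => s.setI a (i.eval s) (v.eval s)
  | setR a i v, s => s.setR a (i.eval s) (v.eval M s)
  | setBuf i v, s => s.setBuf (i.eval s) (v.eval s)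
  | setLow i v, s => s.setLow (i.eval s) (v.eval M s)
  | seq p q, s => q.exec M (p.exec M s)
  | ifI a b p q, s => if a.eval s < b.eval s then p.exec M s else q.exec M s
  | ifR a b p q, s => if a.eval M s < b.eval M s then p.exec M s else q.exec M s
  | rep e p, s => (p.exec M)^[e.eval s] s

/-- An upper bound for the running time after compilation. -/
noncomputable def time (M : Finset ℕ → ℝ) : MP → St → ℕ
  | skip, _ => 1
  | setI _ i v, s => i.cost s + v.cost s + 70
  | setR _ i v, s => i.cost s + v.cost s + 2 * s.k + 100
  | setBuf i v, s => 2 * i.cost s + v.cost s + 60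
  | setLow i v, s => 2 * i.cost s + v.cost s + 2 * s.k + 100
  | seq p q, s => p.time M s + q.time M (p.exec M s) + 1
  | ifI a b p q, s =>
      a.cost s + b.cost s + 1 + if a.eval s < b.eval s then p.time M s else q.time M s
  | ifR a b p q, s =>
      a.cost s + b.cost s + 1 + if a.eval M s < b.eval M s then p.time M s else q.time M s
  | rep e p, s =>
      e.cost s + 1 + ∑ r ∈ Finset.range (e.eval s), (p.time M ((p.exec M)^[r] s) + 1)

def comp : MP → RamProg
  | skip => .skip
  | setI a i v => .setInt (IE.ramAddr a i.comp) v.comp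
  | setR a i v => .setReal (RE.ramAddr a i.comp) v.comp
  | setBuf i v => .ifInt i.comp (.add (.add IE.ramK IE.ramK) (.lit 1))
      (.setInt (.add (.add (.add IE.ramK IE.ramK) (.lit 3)) i.comp) v.comp) .skip
  | setLow i v => .ifInt i.comp RE.ramBase (.setReal i.comp v.comp) .skip
  | seq p q => .seq p.comp q.comp
  | ifI a b p q => .ifInt a.comp b.comp p.comp q.comp
  | ifR a b p q => .ifReal a.comp b.comp p.comp q.comp
  | rep e p => .rep e.comp p.comp

/-- `toSt` semiconjugates each compiled command to the command itself. For assignments this holds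
because the regions are disjoint and because an address num + 32 i with num < 32 determines the
array and the index. -/
theorem toSt_exec_comp (M : Finset ℕ → ℝ) (p : MP) (σ : RamState) :
    (p.comp.exec M σ).toSt = p.exec M σ.toSt := by
  induction p generalizing σ with
  | skip => rfl
  | setI a i v =>
    simp only [comp, RamProg.exec, exec, IE.eval_ramAddr, IE.eval_comp]
    generalize i.eval σ.toSt = x
    generalize v.eval σ.toSt = y
    have h (m : ℕ) (hm : m < RamState.intBase (σ.int 1)) :
        Function.update σ.int (RamState.intBase (σ.int 1) + (a.num + x * 32)) y m = σ.int m :=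
      Function.update_of_ne (by omega) _ _
    have h0 := h 0 (by simp [RamState.intBase])
    have h1 := h 1 (by simp [RamState.intBase])
    have hb := fun (j : ℕ) (hj : j ≤ 2 * σ.int 1) =>
      h (2 + j) (by simp only [RamState.intBase]; omega)
    have hc := fun (j : ℕ) (hj : j ≤ 2 * σ.int 1) =>
      h (2 * σ.int 1 + 3 + j) (by simp only [RamState.intBase]; omega)
    ext b j
    · simp [RamState.toSt, h0]
    · simp [RamState.toSt, h1]
    · have e1 := a.num_lt
      have e2 := b.num_lt
      simp only [RamState.toSt, h1, St.setI_I, Function.update_apply]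
      refine if_congr ?_ rfl rfl
      rw [← IVar.num_inj]
      omega
    · simp [RamState.toSt, h0, h1]
    · simp only [RamState.toSt, h1, St.setI_inp]
      split_ifs with hj
      · exact hb _ hj
      · rfl
    · simp only [RamState.toSt, h1, St.setI_buf]
      split_ifs with hj
      · exact hc _ hj
      · rfl
    · simp [RamState.toSt, h0, h1]
  | setR a i v =>
    simp only [comp, RamProg.exec, exec, RE.eval_ramAddr, RE.eval_comp, IE.eval_comp]
    generalize i.eval σ.toSt = x
    generalize v.eval M σ.toSt = y
    ext b j
    · rfl
    · rfl
    · rfl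
    · have e1 := a.num_lt
      have e2 := b.num_lt
      simp only [RamState.toSt, St.setR_R, Function.update_apply]
      refine if_congr ?_ rfl rfl
      rw [← RVar.num_inj]
      omega
    · rfl
    · rfl
    · simp only [RamState.toSt, St.setR_low, Function.update_apply]
      split_ifs with h1 h2 <;> first | rfl | omega
  | setBuf i v =>
    have hk : ((IntExp.add (IntExp.add IE.ramK IE.ramK) (.lit 1)).eval σ) = 2 * σ.int 1 + 1 := by
      simp [IntExp.eval, IE.ramK]; omega
    have hk' : ((IntExp.add (IntExp.add IE.ramK IE.ramK) (.lit 3)).eval σ) = 2 * σ.int 1 + 3 := by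
      simp [IntExp.eval, IE.ramK]; omega
    simp only [comp, RamProg.exec, exec, IE.eval_comp, hk]
    rw [IntExp.eval, hk', IE.eval_comp]
    generalize i.eval σ.toSt = x
    generalize v.eval σ.toSt = y
    split_ifs with hx
    · have h (m : ℕ) (hm : m ≠ 2 * σ.int 1 + 3 + x) :
          Function.update σ.int (2 * σ.int 1 + 3 + x) y m = σ.int m :=
        Function.update_of_ne (by omega) _ _
      have h0 := h 0 (by omega)
      have h1 := h 1 (by omega)
      ext b j
      · simp [RamState.toSt, h0]
      · simp [RamState.toSt, h1]
      · simp only [RamState.toSt, h1, St.setBuf_I]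
        exact h _ (by simp only [RamState.intBase]; omega)
      · simp [RamState.toSt, h0, h1]
      · simp only [RamState.toSt, h1, St.setBuf_inp]
        split_ifs with hj
        · exact h _ (by omega)
        · rfl
      · simp only [RamState.toSt, h1, St.setBuf_buf, Function.update_apply]
        split_ifs <;> first | rfl | omega
      · simp [RamState.toSt, h0, h1]
    · ext b j
      · rfl
      · rfl
      · rfl
      · rfl
      · rfl
      · have : ¬ (b = x ∧ b ≤ 2 * σ.toSt.k) := by
          have : σ.toSt.k = σ.int 1 := rfl
          omega
        rw [St.setBuf_buf, if_neg this]
      · rfl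
  | setLow i v =>
    simp only [comp, RamProg.exec, exec, IE.eval_comp, RE.eval_ramBase, RE.eval_comp]
    generalize i.eval σ.toSt = x
    generalize v.eval M σ.toSt = y
    have hl : σ.toSt.lowSize = RamState.realBase (σ.int 0) (σ.int 1) := rfl
    split_ifs with hx
    · ext b j
      · rfl
      · rfl
      · rfl
      · simp only [RamState.toSt, St.setLow_R, Function.update_apply]
        rw [if_neg (by omega)]
      · rfl
      · rfl
      · simp only [St.setLow_low, hl]
        simp only [RamState.toSt, Function.update_apply]
        split_ifs <;> first | rfl | omega
    · ext b j
      · rfl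
      · rfl
      · rfl
      · rfl
      · rfl
      · rfl
      · simp only [St.setLow_low, hl]
        rw [if_neg (by omega)]
  | seq p q ihp ihq => simp only [comp, RamProg.exec, exec, ihp, ihq]
  | ifI a b p q ihp ihq =>
    simp only [comp, RamProg.exec, exec, IE.eval_comp]
    split_ifs
    · exact ihp σ
    · exact ihq σ
  | ifR a b p q ihp ihq =>
    simp only [comp, RamProg.exec, exec, RE.eval_comp]
    split_ifs
    · exact ihp σ
    · exact ihq σ
  | rep e p ih =>
    simp only [comp, RamProg.exec, exec, IE.eval_comp]
    exact Function.Semiconj.iterate_right (f := RamState.toSt) ih _ σ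

theorem time_comp_le (M : Finset ℕ → ℝ) (p : MP) (σ : RamState) :
    p.comp.time M σ ≤ p.time M σ.toSt := by
  have hk : σ.toSt.k = σ.int 1 := rfl
  induction p generalizing σ with
  | skip => rfl
  | setI a i v =>
    have := i.cost_comp_le σ; have := v.cost_comp_le σ
    simp only [comp, RamProg.time, time, IE.cost_ramAddr]; omega
  | setR a i v =>
    have := i.cost_comp_le σ; have := v.cost_comp_le σ
    simp only [comp, RamProg.time, time, RE.cost_ramAddr]; omega
  | setBuf i v =>
    have := i.cost_comp_le σ; have := v.cost_comp_le σ
    simp only [comp, RamProg.time, time, IntExp.cost, IE.ramK]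
    split_ifs <;> omega
  | setLow i v =>
    have := i.cost_comp_le σ; have := v.cost_comp_le σ
    simp only [comp, RamProg.time, time, RE.cost_ramBase]
    split_ifs <;> omega
  | seq p q ihp ihq =>
    have h1 := ihp σ hk
    have h2 := ihq (p.comp.exec M σ) rfl
    simp only [comp, RamProg.time, time, toSt_exec_comp] at h2 ⊢
    omega
  | ifI a b p q ihp ihq =>
    have := a.cost_comp_le σ; have := b.cost_comp_le σ
    have h1 := ihp σ hk; have h2 := ihq σ hk
    simp only [comp, RamProg.time, time, IE.eval_comp]
    split_ifs <;> omega
  | ifR a b p q ihp ihq =>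
    have := a.cost_comp_le σ; have := b.cost_comp_le σ
    have h1 := ihp σ hk; have h2 := ihq σ hk
    simp only [comp, RamProg.time, time, RE.eval_comp]
    split_ifs <;> omega
  | rep e p ih =>
    have := e.cost_comp_le σ
    simp only [comp, RamProg.time, time, IE.eval_comp]
    refine add_le_add (by omega) (Finset.sum_le_sum fun r _ => ?_)
    have h := ih ((p.comp.exec M)^[r] σ) rfl
    rw [Function.Semiconj.iterate_right (f := RamState.toSt) (toSt_exec_comp M p) r σ] at h
    omega

end MP

/-! ## Rules for reasoning about programs -/

/-- `t` differs from `s` only in the integer arrays `wi`, the real arrays `wr` and the list for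
look-ups. -/
structure St.Agree (wi : List IVar) (wr : List RVar) (s t : St) : Prop where
  n : t.n = s.n
  k : t.k = s.k
  inp : t.inp = s.inp
  low : t.low = s.low
  I : ∀ a, a ∉ wi → t.I a = s.I a
  R : ∀ a, a ∉ wr → t.R a = s.R a

namespace St.Agree

variable {wi wi' : List IVar} {wr wr' : List RVar} {s t u : St}

theorem refl (s : St) : Agree wi wr s s := ⟨rfl, rfl, rfl, rfl, fun _ _ => rfl, fun _ _ => rfl⟩

theorem trans (h : Agree wi wr s t) (h' : Agree wi wr t u) : Agree wi wr s u :=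
  ⟨h'.n.trans h.n, h'.k.trans h.k, h'.inp.trans h.inp, h'.low.trans h.low,
    fun a ha => (h'.I a ha).trans (h.I a ha), fun a ha => (h'.R a ha).trans (h.R a ha)⟩

theorem mono (h : Agree wi wr s t) (hi : wi ⊆ wi') (hr : wr ⊆ wr') : Agree wi' wr' s t :=
  ⟨h.n, h.k, h.inp, h.low, fun a ha => h.I a fun h => ha (hi h), fun a ha => h.R a fun h => ha (hr h)⟩

theorem setI (h : Agree wi wr s t) {a : IVar} (ha : a ∈ wi) (i v : ℕ) :
    Agree wi wr s (t.setI a i v) :=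
  ⟨h.n, h.k, h.inp, h.low, fun b hb => by
    have : b ≠ a := fun e => hb (e ▸ ha)
    rw [← h.I b hb]; ext j; simp [this], h.R⟩

theorem setR (h : Agree wi wr s t) {a : RVar} (ha : a ∈ wr) (i : ℕ) (v : ℝ) :
    Agree wi wr s (t.setR a i v) :=
  ⟨h.n, h.k, h.inp, h.low, h.I, fun b hb => by
    have : b ≠ a := fun e => hb (e ▸ ha)
    rw [← h.R b hb]; ext j; simp [this]⟩

theorem setBuf (h : Agree wi wr s t) (i v : ℕ) : Agree wi wr s (t.setBuf i v) :=
  ⟨h.n, h.k, h.inp, h.low, h.I, h.R⟩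

theorem andThen (h : Agree wi wr s t) (h' : Agree wi' wr' t u) (hi : wi' ⊆ wi) (hr : wr' ⊆ wr) :
    Agree wi wr s u :=
  h.trans (h'.mono hi hr)

end St.Agree

abbrev IE.sc (a : IVar) : IE := .var a (.lit 0)

abbrev RE.sc (a : RVar) : RE := .var a (.lit 0)

namespace MP

/-- The loop `for v = 0, …, e - 1 do p`. -/
def forI (v : IVar) (e : IE) (p : MP) : MP :=
  .seq (.setI v (.lit 0) (.lit 0)) (.rep e (.seq p (.setI v (.lit 0) (.add (.sc v) (.lit 1)))))

/-- Started in `s`, the program ends after at most `W ^ m` steps in a state with `Φ`. -/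
def Tri (M : Finset ℕ → ℝ) (W : ℕ) (p : MP) (m : ℕ) (s : St) (Φ : St → Prop) : Prop :=
  1000 ≤ W → Φ (p.exec M s) ∧ p.time M s ≤ W ^ m

variable {M : Finset ℕ → ℝ} {W m : ℕ} {s : St} {Φ Ψ : St → Prop} {p q : MP}

theorem Tri.weaken (h : Tri M W p m s Ψ) (hΦ : ∀ t, Ψ t → Φ t) : Tri M W p m s Φ :=
  fun hW => ⟨hΦ _ (h hW).1, (h hW).2⟩

theorem Tri.mono {m' : ℕ} (h : Tri M W p m s Φ) (hm : m ≤ m') : Tri M W p m' s Φ :=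
  fun hW => ⟨(h hW).1, (h hW).2.trans (Nat.pow_le_pow_right (by omega) hm)⟩

theorem Tri.skip (h : Φ s) : Tri M W .skip m s Φ :=
  fun hW => ⟨h, Nat.one_le_pow _ _ (by omega)⟩

theorem Tri.setI {a : IVar} {i v : IE} (hc : i.cost s + v.cost s + 70 ≤ W)
    (h : Φ (s.setI a (i.eval s) (v.eval s))) : Tri M W (.setI a i v) (m + 1) s Φ :=
  fun hW => ⟨h, hc.trans (Nat.le_self_pow (by omega) _)⟩

theorem Tri.setR {a : RVar} {i : IE} {v : RE} (hc : i.cost s + v.cost s + 2 * s.k + 100 ≤ W)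
    (h : Φ (s.setR a (i.eval s) (v.eval M s))) : Tri M W (.setR a i v) (m + 1) s Φ :=
  fun hW => ⟨h, hc.trans (Nat.le_self_pow (by omega) _)⟩

theorem Tri.setBuf {i v : IE} (hc : 2 * i.cost s + v.cost s + 60 ≤ W)
    (h : Φ (s.setBuf (i.eval s) (v.eval s))) : Tri M W (.setBuf i v) (m + 1) s Φ :=
  fun hW => ⟨h, hc.trans (Nat.le_self_pow (by omega) _)⟩

theorem Tri.setLow {i : IE} {v : RE} (hc : 2 * i.cost s + v.cost s + 2 * s.k + 100 ≤ W)
    (h : Φ (s.setLow (i.eval s) (v.eval M s))) : Tri M W (.setLow i v) (m + 1) s Φ :=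
  fun hW => ⟨h, hc.trans (Nat.le_self_pow (by omega) _)⟩

/-- Each syntactic layer raises the exponent by one: 2 W^(m+1) + 1 ≤ W^(m+2). The exponents are
wasteful, but only their being absolute constants matters. -/
theorem Tri.seq (h : Tri M W p (m + 1) s (fun t => Tri M W q (m + 1) t Φ)) :
    Tri M W (.seq p q) (m + 2) s Φ := by
  intro hW
  obtain ⟨h1, h2⟩ := h hW
  obtain ⟨h3, h4⟩ := h1 hW
  refine ⟨h3, ?_⟩
  have h5 : 1 ≤ W ^ (m + 1) := Nat.one_le_pow _ _ (by omega)
  have h6 : W ^ (m + 2) = W ^ (m + 1) * W := pow_succ _ _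
  simp only [time]
  nlinarith

theorem Tri.ifI {a b : IE} (hc : a.cost s + b.cost s + 1 ≤ W)
    (hp : a.eval s < b.eval s → Tri M W p (m + 1) s Φ)
    (hq : ¬ a.eval s < b.eval s → Tri M W q (m + 1) s Φ) :
    Tri M W (.ifI a b p q) (m + 2) s Φ := by
  intro hW
  have h5 : 1 ≤ W ^ m := Nat.one_le_pow _ _ (by omega)
  have h6 : W ^ (m + 2) = W ^ (m + 1) * W := pow_succ _ _
  have h7 : W ^ (m + 1) = W ^ m * W := pow_succ _ _
  simp only [exec, time]
  split_ifs with h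
  · obtain ⟨h1, h2⟩ := hp h hW
    exact ⟨h1, by nlinarith⟩
  · obtain ⟨h1, h2⟩ := hq h hW
    exact ⟨h1, by nlinarith⟩

theorem Tri.ifR {a b : RE} (hc : a.cost s + b.cost s + 1 ≤ W)
    (hp : a.eval M s < b.eval M s → Tri M W p (m + 1) s Φ)
    (hq : ¬ a.eval M s < b.eval M s → Tri M W q (m + 1) s Φ) :
    Tri M W (.ifR a b p q) (m + 2) s Φ := by
  intro hW
  have h5 : 1 ≤ W ^ m := Nat.one_le_pow _ _ (by omega)
  have h6 : W ^ (m + 2) = W ^ (m + 1) * W := pow_succ _ _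
  have h7 : W ^ (m + 1) = W ^ m * W := pow_succ _ _
  simp only [exec, time]
  split_ifs with h
  · obtain ⟨h1, h2⟩ := hp h hW
    exact ⟨h1, by nlinarith⟩
  · obtain ⟨h1, h2⟩ := hq h hW
    exact ⟨h1, by nlinarith⟩

/-- This rule keeps the number of rounds as an explicit factor. It is needed for the loops whose
bounds or costs involve n, which W does not dominate. The body has to leave the loop variable
unchanged. -/
theorem exec_forI_and_time_le (v : IVar) (e : IE) (p : MP) (N T : ℕ) (Inv : ℕ → St → Prop)
    (hN : e.eval (s.setI v 0 0) = N) (h0 : Inv 0 (s.setI v 0 0))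
    (step : ∀ r < N, ∀ t, Inv r t → t.I v 0 = r →
      ((p.exec M t).I v 0 = r ∧ Inv (r + 1) ((p.exec M t).setI v 0 (r + 1))) ∧ p.time M t ≤ T) :
    Inv N ((forI v e p).exec M s) ∧
      (forI v e p).time M s ≤ e.cost (s.setI v 0 0) + N * (T + 200) + 100 := by
  set b : MP := .seq p (.setI v (.lit 0) (.add (.sc v) (.lit 1))) with hb
  have hexec : ∀ t, b.exec M t = (p.exec M t).setI v 0 ((p.exec M t).I v 0 + 1) := fun t => rfl
  have htime : ∀ t, b.time M t ≤ p.time M t + 140 := fun t => by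
    simp only [b, time, IE.cost]; omega
  have htot : (forI v e p).time M s = (72 + (e.cost (s.setI v 0 0) + 1 +
      ∑ r ∈ Finset.range N, (b.time M ((b.exec M)^[r] (s.setI v 0 0)) + 1)) + 1) := by
    rw [← hN]; rfl
  have hfin : (forI v e p).exec M s = (b.exec M)^[N] (s.setI v 0 0) := by rw [← hN]; rfl
  clear_value b
  have key : ∀ r ≤ N, Inv r ((b.exec M)^[r] (s.setI v 0 0)) ∧
      ((b.exec M)^[r] (s.setI v 0 0)).I v 0 = r := by
    intro r
    induction r with
    | zero => exact fun _ => ⟨h0, by simp⟩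
    | succ r ih =>
      intro hr
      obtain ⟨h1, h2⟩ := ih (by omega)
      obtain ⟨⟨h3, h4⟩, -⟩ := step r (by omega) _ h1 h2
      rw [Function.iterate_succ_apply']
      rw [hexec, h3]
      exact ⟨h4, by simp⟩
  rw [htot, hfin]
  refine ⟨(key N le_rfl).1, ?_⟩
  have : ∀ r ∈ Finset.range N, b.time M ((b.exec M)^[r] (s.setI v 0 0)) + 1 ≤ T + 200 := by
    intro r hr
    obtain ⟨h1, h2⟩ := key r (by simp at hr; omega)
    obtain ⟨-, h5⟩ := step r (by simpa using hr) _ h1 h2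
    have := htime ((b.exec M)^[r] (s.setI v 0 0))
    omega
  have := Finset.sum_le_card_nsmul _ _ _ this
  simp only [Finset.card_range, smul_eq_mul] at this
  omega

theorem Tri.forI {v : IVar} {e : IE} (N : ℕ) (Inv : ℕ → St → Prop)
    (hc : e.cost (s.setI v 0 0) ≤ W) (hNW : N ≤ W)
    (hN : e.eval (s.setI v 0 0) = N) (h0 : Inv 0 (s.setI v 0 0))
    (step : ∀ r < N, ∀ t, Inv r t → t.I v 0 = r →
      Tri M W p (m + 1) t fun u => u.I v 0 = r ∧ Inv (r + 1) (u.setI v 0 (r + 1)))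
    (h : ∀ t, Inv N t → Φ t) :
    Tri M W (forI v e p) (m + 3) s Φ := by
  intro hW
  obtain ⟨h1, h2⟩ := exec_forI_and_time_le (M := M) v e p N (W ^ (m + 1)) Inv hN h0
    (fun r hr t ht hv => step r hr t ht hv hW)
  refine ⟨h _ h1, h2.trans ?_⟩
  have h5 : 1 ≤ W ^ m := Nat.one_le_pow _ _ (by omega)
  have h6 : W ^ (m + 3) = W ^ (m + 1) * W * W := by ring
  have h7 : W ^ (m + 1) = W ^ m * W := pow_succ _ _
  have h8 : N * (W ^ (m + 1) + 200) ≤ W * (W ^ (m + 1) + 200) := Nat.mul_le_mul_right _ hNW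
  have h9 : W ≤ W ^ (m + 1) := by nlinarith
  nlinarith [Nat.mul_le_mul_right W hW, Nat.mul_le_mul h9 hW]

end MP

/-! ### Looking up a moment -/

/-- Bounds for the sizes that occur in the programs. -/
structure Dims (k D E W : ℕ) : Prop where
  ext : E = D + D
  pos : 1 ≤ D
  kpos : 1 ≤ k
  b0 : 100000 ≤ W
  b1 : 1000 * k ≤ W
  b2 : 1000 * (k * k) ≤ W
  b3 : 1000 * (k * k * k) ≤ W
  b4 : 1000 * E ≤ W
  b5 : 1000 * (D * D) ≤ W
  b6 : 1000 * (E * E) ≤ W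

/-- The observables selected by the binary digits of `c` among the first `2k - 2` members of the
tuple, and in addition `x`. The number `n` is not an observable and stands for none. -/
def momentSet (n k : ℕ) (tup : ℕ → ℕ) (c x : ℕ) : Finset ℕ :=
  (Finset.range (2 * k - 1)).image fun t =>
    if t = 2 * k - 2 then x else if c / 2 ^ t % 2 = 1 then tup t else n

namespace MP

variable {M : Finset ℕ → ℝ} {W k D E : ℕ}

/-- The binary digits of the code are read off by repeated halving. A position whose digit is 0
receives n, which the empirical moments ignore. -/
def moment : MP :=
  .seq (.setI .cur (.lit 0) (.sc .code)) <|
  .seq (forI .bit (.sub (.add .k .k) (.lit 2)) <|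
    .seq (.ifI (.mod (.sc .cur) (.lit 2)) (.lit 1)
      (.setBuf (.sc .bit) .n) (.setBuf (.sc .bit) (.var .tup (.sc .bit))))
      (.setI .cur (.lit 0) (.div (.sc .cur) (.lit 2)))) <|
  .seq (.setBuf (.sub (.add .k .k) (.lit 2)) (.sc .extra))
    (.setR .mom (.lit 0) .stat)

theorem moment_spec (hd : Dims k D E W) (s : St) (hk : s.k = k) (hc : s.I .code 0 < D * D) :
    Tri M W moment 8 s fun t => St.Agree [.cur, .bit] [.mom] s t ∧
      t.R .mom 0 = M (momentSet s.n k (s.I .tup) (s.I .code 0) (s.I .extra 0)) := by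
  have := hd.b0; have := hd.b1; have := hd.b5; have := hd.kpos
  refine .seq (.setI (by simp; omega) ?_)
  refine .seq (.forI (m := 3) (2 * k - 2) (fun r t => St.Agree [.cur, .bit] [.mom] s t ∧
    t.I .cur 0 = s.I .code 0 / 2 ^ r ∧
    ∀ j < r, t.buf j = if s.I .code 0 / 2 ^ j % 2 = 1 then s.I .tup j else s.n)
    (by simp; omega) (by omega) (by simp; omega) ?_ ?_ ?_)
  · refine ⟨((St.Agree.refl s).setI (by decide) _ _).setI (by decide) _ _, by simp, by simp⟩
  · rintro r hr t ⟨ha, hcur, hbuf⟩ hv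
    have hle : s.I .code 0 / 2 ^ r ≤ s.I .code 0 := Nat.div_le_self _ _
    have hcost : s.I .code 0 / 2 ^ r / 2 ≤ s.I .code 0 := (Nat.div_le_self _ _).trans hle
    refine .seq (.ifI (by simp [hcur]; omega) (fun h => .setBuf (by simp; omega) ?_)
      (fun h => .setBuf (by simp; omega) ?_)) <;>
    refine .setI (by simp [hcur]; omega) ?_ <;> refine ⟨by simpa using hv, ?_, ?_, ?_⟩
    · exact ((ha.setBuf _ _).setI (by decide) _ _).setI (by decide) _ _
    · simp [hcur, Nat.div_div_eq_div_mul, pow_succ]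
    · simp only [IE.eval, hcur] at h
      intro j hj
      simp only [IE.eval, hv, St.setI_buf, St.setBuf_buf, ha.k, ha.n, hk]
      split_ifs <;> first | omega | skip
      · rename_i h1 h2; rw [h1.1] at h2; omega
      all_goals (rw [hbuf j (by omega)]; simp [*])
    · exact ((ha.setBuf _ _).setI (by decide) _ _).setI (by decide) _ _
    · simp [hcur, Nat.div_div_eq_div_mul, pow_succ]
    · simp only [IE.eval, hcur] at h
      intro j hj
      simp only [IE.eval, hv, St.setI_buf, St.setBuf_buf, ha.k, ha.I .tup (by decide), hk]
      split_ifs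
      · rename_i h1 h2; rw [h1.1]
      · rename_i h1 h2; rw [h1.1] at h2; omega
      all_goals (rw [hbuf j (by omega)]; simp [*])
  · rintro t ⟨ha, hcur, hbuf⟩
    have htk : t.k = k := ha.k.trans hk
    refine .seq (.setBuf (by simp; omega) (.setR (by simp [htk]; omega) ⟨(ha.setBuf _ _).setR (by decide) _ _, ?_⟩))
    simp only [St.setR_R, and_self, if_true, RE.eval, momentSet, St.setBuf_k, htk, IE.eval]
    congr 1
    refine Finset.image_congr fun j hj => ?_
    have hj : j < 2 * k - 1 := by simpa using hj
    simp only [St.setBuf_buf, htk, ha.I .extra (by decide)]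
    split_ifs <;> first | omega | rfl | skip
    all_goals (rw [hbuf j (by omega)]; simp [*])

end MP

@[simp] theorem St.setI_I_of_ne (s : St) {a b : IVar} (h : b ≠ a) (i v : ℕ) :
    (s.setI a i v).I b = s.I b := by ext j; simp [h]

@[simp] theorem St.setR_R_of_ne (s : St) {a b : RVar} (h : b ≠ a) (i : ℕ) (v : ℝ) :
    (s.setR a i v).R b = s.R b := by ext j; simp [h]

/-! ## Gaussian elimination with complete pivoting in a bordered matrix -/

/-- The matrix of moments, bordered by identity matrices. -/
noncomputable def bordered (M : Finset ℕ → ℝ) (n k D : ℕ) (tup : ℕ → ℕ) (r c : ℕ) : ℝ :=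
  if r < D ∧ c < D then M (momentSet n k tup (r + D * c) n)
  else if c = r + D ∨ r = c + D then 1 else 0

/-- The first position, among those numbered less than the given number, of an entry of largest
absolute value in the top left block. -/
noncomputable def argmaxSq (f : ℕ → ℕ → ℝ) (D : ℕ) : ℕ → ℕ
  | 0 => 0
  | e + 1 =>
    if e / (D + D) < D ∧ e % (D + D) < D ∧
      f (argmaxSq f D e / (D + D)) (argmaxSq f D e % (D + D)) *
        f (argmaxSq f D e / (D + D)) (argmaxSq f D e % (D + D)) <
        f (e / (D + D)) (e % (D + D)) * f (e / (D + D)) (e % (D + D)) then e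
    else argmaxSq f D e

noncomputable def pivotRow (f : ℕ → ℕ → ℝ) (D : ℕ) : ℕ :=
  argmaxSq f D ((D + D) * (D + D)) / (D + D)

noncomputable def pivotCol (f : ℕ → ℕ → ℝ) (D : ℕ) : ℕ :=
  argmaxSq f D ((D + D) * (D + D)) % (D + D)

/-- The pivot row and column are updated too and vanish when the pivot is nonzero, so used rows and
columns need no bookkeeping. The right and lower borders record the row and column combinations that
lead to the current entries. -/
noncomputable def eliminate (f : ℕ → ℕ → ℝ) (D : ℕ) : ℕ → ℕ → ℕ → ℝ
  | 0 => f
  | t + 1 => fun r c => eliminate f D t r c -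
      eliminate f D t r (pivotCol (eliminate f D t) D) *
        eliminate f D t (pivotRow (eliminate f D t) D) c /
      eliminate f D t (pivotRow (eliminate f D t) D) (pivotCol (eliminate f D t) D)

namespace MP

variable {M : Finset ℕ → ℝ} {W k D E : ℕ}

theorem index_div {E r c : ℕ} (hc : c < E) : (r * E + c) / E = r := by
  rw [mul_comm, Nat.mul_add_div (by omega), Nat.div_eq_of_lt hc, add_zero]

theorem index_mod {E r c : ℕ} (hc : c < E) : (r * E + c) % E = c := by
  rw [mul_comm, Nat.mul_add_mod, Nat.mod_eq_of_lt hc]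

theorem index_lt {E r c m : ℕ} (hr : r < m) (hc : c < E) : r * E + c < m * E := by
  calc r * E + c < r * E + E := by omega
    _ = (r + 1) * E := by ring
    _ ≤ _ := Nat.mul_le_mul_right _ (by omega)

abbrev rowIdx : IE := .div (.sc .idx) (.sc .ext)
abbrev colIdx : IE := .mod (.sc .idx) (.sc .ext)

/-- Conditions are coded by truncated subtraction: (r - (D-1)) + (c - (D-1)) < 1 says that both
indices are below D, and 1 - ((x - y) + (y - x)) is 1 if x = y and 0 otherwise. -/
def fill : MP :=
  forI .idx (.mul (.sc .ext) (.sc .ext)) <|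
    .ifI (.add (.sub rowIdx (.sub (.sc .dim) (.lit 1))) (.sub colIdx (.sub (.sc .dim) (.lit 1)))) (.lit 1)
      (.seq (.setI .code (.lit 0) (.add rowIdx (.mul (.sc .dim) colIdx))) <|
        .seq (.setI .extra (.lit 0) .n) <| .seq moment (.setR .big (.sc .idx) (.sc .mom)))
      (.setR .big (.sc .idx) (.ofInt (.add
        (.sub (.lit 1) (.add (.sub colIdx (.add rowIdx (.sc .dim))) (.sub (.add rowIdx (.sc .dim)) colIdx)))
        (.sub (.lit 1) (.add (.sub rowIdx (.add colIdx (.sc .dim))) (.sub (.add colIdx (.sc .dim)) rowIdx))))))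

theorem fill_spec (hd : Dims k D E W) (s : St) (hk : s.k = k) (hD : s.I .dim 0 = D)
    (hE : s.I .ext 0 = E) :
    Tri M W fill 15 s fun t => St.Agree [.cur, .bit, .idx, .code, .extra] [.mom, .big] s t ∧
      ∀ r < E, ∀ c < E, t.R .big (r * E + c) = bordered M s.n k D (s.I .tup) r c := by
  have := hd.b0; have := hd.b1; have := hd.b4; have := hd.b6; have := hd.kpos; have := hd.pos
  have := hd.ext
  refine .forI (m := 12) (E * E) (fun e t =>
      St.Agree [.cur, .bit, .idx, .code, .extra] [.mom, .big] s t ∧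
      ∀ x < e, t.R .big x = bordered M s.n k D (s.I .tup) (x / E) (x % E))
    (by simp [hE]; omega) (by omega) (by simp [hE])
    ⟨(St.Agree.refl s).setI (by decide) _ _, by simp⟩ ?_ ?_
  · rintro e he t ⟨ha, hbig⟩ hv
    have hdiv : e / E ≤ e := Nat.div_le_self _ _
    have hdivlt : e / E < E := Nat.div_lt_of_lt_mul he
    have hmod : e % E < E := Nat.mod_lt _ (by omega)
    have hE' : t.I .ext 0 = E := by rw [ha.I .ext (by decide), hE]
    have hD' : t.I .dim 0 = D := by rw [ha.I .dim (by decide), hD]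
    have hk' : t.k = k := ha.k.trans hk
    refine .ifI (by simp [hE', hv]; omega) (fun h => ?_) (fun h => ?_)
    · simp only [IE.eval, hv, hE', hD'] at h
      have h1 : e / E < D := by omega
      have h2 : e % E < D := by omega
      have hcode : e / E + D * (e % E) < D * D := by
        rw [add_comm, mul_comm D]; exact index_lt h2 h1
      refine .seq (.setI (by simp [hE', hv]; omega) ?_)
      refine .seq (.setI (by simp; omega) ?_)
      refine .seq (((moment_spec hd _ (by simpa using hk')
        (by simpa [hE', hD', hv] using hcode)).mono (by omega)).weaken ?_)
      rintro u ⟨hu, hmom⟩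
      refine .setR (by simp [hu.k, hk']; omega) ⟨?_, ?_, ?_⟩
      · simp [hu.I .idx (by decide), hv]
      · exact (((((ha.setI (by decide) _ _).setI (by decide) _ _).andThen hu (by decide)
          (by decide)).setR (by decide) _ _).setI (by decide) _ _)
      · intro x hx
        have h3 := congrFun (hu.I .idx (by decide)) 0
        have h4 := hu.R .big (by decide)
        simp only [RE.eval, IE.eval, St.setI_R, St.setR_R, true_and, h3, St.setI_I, h4]
        simp only [reduceCtorEq, false_and, if_false, hv]
        split_ifs with hxe
        · subst hxe
          rw [hmom]
          simp [bordered, h1, h2, hE', hD', hv, ha.n, ha.I .tup (by decide)]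
        · exact hbig x (by omega)
    · simp only [IE.eval, hv, hE', hD'] at h
      refine .setR (by simp [hE', hv, hk']; omega) ⟨?_, ?_, ?_⟩
      · simp [hv]
      · exact ((ha.setR (by decide) _ _).setI (by decide) _ _)
      · intro x hx
        simp only [RE.eval, IE.eval, St.setI_R, St.setR_R, true_and, hv, hE', hD']
        split_ifs with hxe
        · subst hxe
          rw [bordered, if_neg (by omega)]
          split_ifs with h3
          · rw [Nat.cast_eq_one]; omega
          · rw [Nat.cast_eq_zero]; omega
        · exact hbig x (by omega)
  · rintro t ⟨ha, hbig⟩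
    refine ⟨ha, fun r hr c hc => ?_⟩
    rw [hbig _ (index_lt hr hc), index_div hc, index_mod hc]

abbrev pivRowIdx : IE := .div (.sc .piv) (.sc .ext)
abbrev pivColIdx : IE := .mod (.sc .piv) (.sc .ext)

/-- Squares replace absolute values, which are not an operation of the machine. The search starts
from position 0, which lies in the top left block. -/
def findPivot : MP :=
  .seq (.setI .piv (.lit 0) (.lit 0)) <|
  forI .idx (.mul (.sc .ext) (.sc .ext)) <|
    .ifI (.add (.sub rowIdx (.sub (.sc .dim) (.lit 1))) (.sub colIdx (.sub (.sc .dim) (.lit 1)))) (.lit 1)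
      (.ifR (.mul (.var .big (.sc .piv)) (.var .big (.sc .piv)))
        (.mul (.var .big (.sc .idx)) (.var .big (.sc .idx)))
        (.setI .piv (.lit 0) (.sc .idx)) .skip) .skip

theorem argmaxSq_lt (f : ℕ → ℕ → ℝ) (hD : 1 ≤ D) (e : ℕ) :
    argmaxSq f D e / (D + D) < D ∧ argmaxSq f D e % (D + D) < D ∧
      argmaxSq f D e < (D + D) * (D + D) := by
  induction e with
  | zero => simp [argmaxSq]; omega
  | succ e ih =>
    rw [argmaxSq]
    split_ifs with h
    · refine ⟨h.1, h.2.1, ?_⟩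
      have := Nat.div_add_mod e (D + D)
      nlinarith
    · exact ih

theorem findPivot_spec (hd : Dims k D E W) (f : ℕ → ℕ → ℝ) (s : St) (hk : s.k = k)
    (hD : s.I .dim 0 = D) (hE : s.I .ext 0 = E)
    (hf : ∀ r < E, ∀ c < E, s.R .big (r * E + c) = f r c) :
    Tri M W findPivot 8 s fun t => St.Agree [.idx, .piv] [] s t ∧
      t.I .piv 0 = pivotRow f D * E + pivotCol f D := by
  have := hd.b0; have := hd.b1; have := hd.b4; have := hd.b6; have := hd.kpos; have := hd.pos
  have hDE := hd.ext
  refine .seq (.setI (by simp; omega) ?_)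
  refine .forI (m := 4) (E * E) (fun e t => St.Agree [.idx, .piv] [] s t ∧
      t.I .piv 0 = argmaxSq f D e)
    (by simp [hE]; omega) (by omega) (by simp [hE])
    ⟨((St.Agree.refl s).setI (by decide) _ _).setI (by decide) _ _, by simp [argmaxSq]⟩ ?_ ?_
  · rintro e he t ⟨ha, hpiv⟩ hv
    have hdiv : e / E ≤ e := Nat.div_le_self _ _
    have hdivlt : e / E < E := Nat.div_lt_of_lt_mul he
    have hmod : e % E < E := Nat.mod_lt _ (by omega)
    have hE' : t.I .ext 0 = E := by rw [ha.I .ext (by decide), hE]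
    have hD' : t.I .dim 0 = D := by rw [ha.I .dim (by decide), hD]
    have hk' : t.k = k := ha.k.trans hk
    obtain ⟨p1, p2, p3⟩ := argmaxSq_lt f hd.pos e
    rw [← hDE] at p1 p2 p3
    have hb1 : t.R .big (argmaxSq f D e) = f (argmaxSq f D e / E) (argmaxSq f D e % E) := by
      rw [ha.R .big (by decide), ← hf _ (by omega) _ (by omega), Nat.div_add_mod']
    have hb2 : t.R .big e = f (e / E) (e % E) := by
      rw [ha.R .big (by decide), ← hf _ (by omega) _ (by omega), Nat.div_add_mod']
    refine .ifI (by simp [hE', hv]; omega) (fun h => ?_) (fun h => ?_)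
    · simp only [IE.eval, hv, hE', hD'] at h
      refine .ifR (by simp [hk']; omega) (fun h' => .setI (by simp; omega) ?_) (fun h' => .skip ?_)
      · simp only [RE.eval, IE.eval, hv, hpiv, hb1, hb2] at h'
        refine ⟨by simpa using hv, (ha.setI (by decide) _ _).setI (by decide) _ _, ?_⟩
        rw [argmaxSq, ← hDE, if_pos ⟨by omega, by omega, h'⟩]
        simp [hv]
      · simp only [RE.eval, IE.eval, hv, hpiv, hb1, hb2] at h'
        refine ⟨hv, ha.setI (by decide) _ _, ?_⟩
        rw [argmaxSq, ← hDE, if_neg (fun h => h' h.2.2)]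
        simpa using hpiv
    · simp only [IE.eval, hv, hE', hD'] at h
      refine .skip ⟨hv, ha.setI (by decide) _ _, ?_⟩
      rw [argmaxSq, ← hDE, if_neg (fun h => by omega)]
      simpa using hpiv
  · rintro t ⟨ha, hpiv⟩
    refine ⟨ha, ?_⟩
    rw [hpiv, pivotRow, pivotCol, ← hDE, Nat.div_add_mod']

/-- The pivot and its row and column are saved before the matrix is overwritten. The saved copies
also contain the border, that is, the vectors `rowVec` and `colVec` at offset D. -/
def eliminationStep : MP :=
  .seq findPivot <|
  .seq (.setR .piv (.sc .step) (.var .big (.sc .piv))) <|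
  .seq (forI .l (.sc .ext) <|
    .seq (.setR .xs (.add (.mul (.sc .step) (.sc .ext)) (.sc .l))
      (.var .big (.add (.mul pivRowIdx (.sc .ext)) (.sc .l))))
    (.setR .ys (.add (.mul (.sc .step) (.sc .ext)) (.sc .l))
      (.var .big (.add (.mul (.sc .l) (.sc .ext)) pivColIdx)))) <|
  forI .idx (.mul (.sc .ext) (.sc .ext)) <|
    .setR .big (.sc .idx) (.sub (.var .big (.sc .idx)) (.div (.mul
      (.var .ys (.add (.mul (.sc .step) (.sc .ext)) rowIdx))
      (.var .xs (.add (.mul (.sc .step) (.sc .ext)) colIdx))) (.var .piv (.sc .step))))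

theorem eliminationStep_spec (hd : Dims k D E W) (f : ℕ → ℕ → ℝ) (s : St) (hk : s.k = k)
    (hD : s.I .dim 0 = D) (hE : s.I .ext 0 = E)
    (hf : ∀ r < E, ∀ c < E, s.R .big (r * E + c) = f r c) :
    Tri M W eliminationStep 12 s fun t =>
      St.Agree [.idx, .piv, .l] [.big, .xs, .ys, .piv] s t ∧
      (∀ r < E, ∀ c < E, t.R .big (r * E + c) =
        f r c - f r (pivotCol f D) * f (pivotRow f D) c / f (pivotRow f D) (pivotCol f D)) ∧
      (∀ i < s.I .step 0, t.R .piv i = s.R .piv i) ∧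
      (∀ i < s.I .step 0 * E, t.R .xs i = s.R .xs i ∧ t.R .ys i = s.R .ys i) ∧
      t.R .piv (s.I .step 0) = f (pivotRow f D) (pivotCol f D) ∧
      ∀ l < E, t.R .xs (s.I .step 0 * E + l) = f (pivotRow f D) l ∧
        t.R .ys (s.I .step 0 * E + l) = f l (pivotCol f D) := by
  have := hd.b0; have := hd.b1; have := hd.b4; have := hd.b6; have := hd.kpos; have := hd.pos
  have hDE := hd.ext
  obtain ⟨hp1, hp2, -⟩ := argmaxSq_lt f hd.pos (E * E)
  rw [← hDE] at hp1 hp2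
  replace hp1 : pivotRow f D < D := by rw [pivotRow, ← hDE]; exact hp1
  replace hp2 : pivotCol f D < D := by rw [pivotCol, ← hDE]; exact hp2
  refine .seq (((findPivot_spec hd f s hk hD hE hf).mono (by omega)).weaken ?_)
  generalize pivotRow f D = p at *
  generalize pivotCol f D = q at *
  have hpiv : p * E + q < E * E := index_lt (by omega) (by omega)
  have hpE : p < E := by omega
  have hqE : q < E := by omega
  rintro s1 ⟨ha1, hs1⟩
  have hk1 : s1.k = k := ha1.k.trans hk
  have hbig1 : s1.R .big = s.R .big := ha1.R .big (by decide)
  have hstep1 : s1.I .step 0 = s.I .step 0 := by rw [ha1.I .step (by decide)]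
  generalize hσ : s.I .step 0 = σ at *
  have hσp : ∀ i < σ * E, ∀ l, i ≠ σ * E + l := by omega
  refine .seq (.setR (by simp [hk1]; omega) ?_)
  refine .seq (.forI (m := 6) E (fun l t => St.Agree [.idx, .piv, .l] [.xs, .ys, .piv] s t ∧
      t.I .piv 0 = p * E + q ∧ t.R .piv σ = f p q ∧
      (∀ i < σ, t.R .piv i = s.R .piv i) ∧
      (∀ i < σ * E, t.R .xs i = s.R .xs i ∧ t.R .ys i = s.R .ys i) ∧
      ∀ x < l, t.R .xs (σ * E + x) = f p x ∧ t.R .ys (σ * E + x) = f x q)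
    (by simp; omega) (by omega) (by simp [ha1.I .ext (by decide), hE]) ?_ ?_ ?_)
  · refine ⟨((ha1.mono (by decide) (by decide)).setR (by decide) _ _).setI (by decide) _ _,
      by simpa using hs1, ?_, fun i hi => ?_, fun i hi => ?_, by simp⟩
    · simp [hstep1, hs1, hbig1, hf p hpE q hqE]
    · simp [hstep1, ha1.R .piv (by decide), hi.ne]
    · simp [ha1.R .xs (by decide), ha1.R .ys (by decide)]
  · rintro l hl t ⟨ha, hpv, hpv1, hpv2, hold, hnew⟩ hv
    have hE' : t.I .ext 0 = E := by rw [ha.I .ext (by decide), hE]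
    have hk' : t.k = k := ha.k.trans hk
    have hst : t.I .step 0 = σ := by rw [ha.I .step (by decide), hσ]
    have hbig : t.R .big = s.R .big := ha.R .big (by decide)
    have hc1 : (p * E + q) / E = p := index_div hqE
    have hc2 : (p * E + q) % E = q := index_mod hqE
    have hc3 : l / E = 0 := Nat.div_eq_of_lt hl
    refine .seq (.setR (by simp [hE', hpv, hk', hc1]; omega)
      (.setR (by simp [hE', hpv, hk', hc1]; omega) ⟨by simpa using hv,
        ((ha.setR (by decide) _ _).setR (by decide) _ _).setI (by decide) _ _, ?_, ?_, ?_, ?_, ?_⟩))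
    · simpa using hpv
    · simpa using hpv1
    · simpa using hpv2
    · intro i hi
      have := hσp i hi l
      simpa [hst, hE', hv, this] using hold i hi
    · intro x hx
      simp only [RE.eval, IE.eval, St.setI_R, St.setR_R, St.setR_I, hst, hE', hv, hpv, hc1, hc2,
        hbig, reduceCtorEq, false_and, if_false, true_and, hf p hpE l hl, hf l hl q hqE,
        Nat.add_left_cancel_iff]
      split_ifs with hxl
      · subst hxl; exact ⟨rfl, rfl⟩
      · exact hnew x (by omega)
  · rintro s2 ⟨ha2, -, hpv2, hpo2, hold2, hnew2⟩
    refine .forI (m := 6) (E * E) (fun e t => St.Agree [.idx, .piv, .l] [.big, .xs, .ys, .piv] s t ∧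
        St.Agree [.idx] [.big] s2 t ∧
        (∀ x < e, t.R .big x = f (x / E) (x % E) - f (x / E) q * f p (x % E) / f p q) ∧
        ∀ x, e ≤ x → t.R .big x = s.R .big x)
      (by simp [ha2.I .ext (by decide), hE]; omega) (by omega)
      (by simp [ha2.I .ext (by decide), hE]) ?_ ?_ ?_
    · exact ⟨(ha2.mono (by decide) (by decide)).setI (by decide) _ _,
        (St.Agree.refl s2).setI (by decide) _ _, by simp, fun x _ => by simp [ha2.R .big (by decide)]⟩
    · rintro e he t ⟨ha, hb, hlo, hhi⟩ hv
      have hE' : t.I .ext 0 = E := by rw [ha.I .ext (by decide), hE]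
      have hk' : t.k = k := ha.k.trans hk
      have hst : t.I .step 0 = σ := by rw [ha.I .step (by decide), hσ]
      have hdiv : e / E ≤ e := Nat.div_le_self _ _
      have hdivlt : e / E < E := Nat.div_lt_of_lt_mul he
      have hmod : e % E < E := Nat.mod_lt _ (by omega)
      refine .setR (by simp [hE', hv, hk']; omega) ⟨by simpa using hv,
        (ha.setR (by decide) _ _).setI (by decide) _ _,
        (hb.setR (by decide) _ _).setI (by decide) _ _, ?_, ?_⟩
      · intro x hx
        simp only [RE.eval, IE.eval, St.setI_R, St.setR_R, hst, hE', hv, true_and,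
          hb.R .xs (by decide), hb.R .ys (by decide), hb.R .piv (by decide), hpv2,
          (hnew2 _ hmod).1, (hnew2 _ hdivlt).2]
        split_ifs with hxe
        · subst hxe
          rw [hhi x le_rfl, ← hf _ hdivlt _ hmod, Nat.div_add_mod']
        · exact hlo x (by omega)
      · intro x hx
        have : x ≠ e := by omega
        simpa [hv, this] using hhi x (by omega)
    · rintro t ⟨ha, hb, hlo, -⟩
      refine ⟨ha, fun r hr c hc => ?_, ?_, ?_, ?_, ?_⟩
      · rw [hlo _ (index_lt hr hc), index_div hc, index_mod hc]
      · rw [hb.R .piv (by decide)]; exact hpo2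
      · rw [hb.R .xs (by decide), hb.R .ys (by decide)]; exact hold2
      · rw [hb.R .piv (by decide)]; exact hpv2
      · rw [hb.R .xs (by decide), hb.R .ys (by decide)]; exact hnew2

end MP

/-! ### The computed quantities as functions of the table of moments -/

section pure

variable (M : Finset ℕ → ℝ) (n k D : ℕ) (tup : ℕ → ℕ)

/-- The bordered matrix of moments after `t` steps of elimination. -/
noncomputable def stage (t : ℕ) : ℕ → ℕ → ℝ := eliminate (bordered M n k D tup) D t

noncomputable def pivotVal (t : ℕ) : ℝ :=
  stage M n k D tup t (pivotRow (stage M n k D tup t) D) (pivotCol (stage M n k D tup t) D)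

/-- The combination of rows that yields the `t`-th pivot row; the first unit vector for `t = k`. -/
noncomputable def rowVec (t a : ℕ) : ℝ :=
  if t < k then stage M n k D tup t (pivotRow (stage M n k D tup t) D) (D + a)
  else if a = 0 then 1 else 0

/-- The combination of columns that yields the `t`-th pivot column; the first unit vector for
`t = k`. -/
noncomputable def colVec (t a : ℕ) : ℝ :=
  if t < k then stage M n k D tup t (D + a) (pivotCol (stage M n k D tup t) D)
  else if a = 0 then 1 else 0

/-- The bilinear form of moments, multiplied by the observable `x`, at two of these vectors. -/
noncomputable def bil (s u x : ℕ) : ℝ :=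
  ∑ c ∈ Finset.range (D * D), rowVec M n k D tup s (c % D) * M (momentSet n k tup c x) *
    colVec M n k D tup u (c / D)

/-- After division by the pivots the same matrix without the last observable would be the identity,
by biorthogonality. With it, the matrix is approximately similar to the diagonal matrix of the means
of that observable. -/
noncomputable def matEntry (s u : ℕ) : ℝ :=
  bil M n k D tup s u (tup (2 * k - 2)) / pivotVal M n k D tup u

noncomputable def eigVal (j : ℕ) : ℝ :=
  realEigenvalue (Matrix.of fun a b : Fin k => matEntry M n k D tup a b) j

/-- The result of applying the Lagrange polynomial of the `j`-th eigenvalue, up to the `l`-th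
factor, to the vector of moments with the observable `x`. -/
noncomputable def lagrangeVec (j x : ℕ) : ℕ → ℕ → ℝ
  | 0, s => bil M n k D tup s k x
  | l + 1, s =>
    if l = j then lagrangeVec j x l s
    else (∑ u ∈ Finset.range k, matEntry M n k D tup s u * lagrangeVec j x l u -
      eigVal M n k D tup l * lagrangeVec j x l s) / (eigVal M n k D tup j - eigVal M n k D tup l)

/-- This is g L_j(A) v for the Lagrange polynomial L_j of the j-th eigenvalue. For exact moments it
is the weight of one class times its means of `xw` and `xv`, where the value n of an index stands
for the constant 1. The index `xw` is put on the side of the columns of the moment matrix and `xv`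
on the side of the rows. -/
noncomputable def coefficient (j xw xv : ℕ) : ℝ :=
  ∑ u ∈ Finset.range k, bil M n k D tup k u xw / pivotVal M n k D tup u *
    lagrangeVec M n k D tup j xv k u

end pure

/-- The state contains the results of the elimination. -/
structure Prepared (M : Finset ℕ → ℝ) (n k D E : ℕ) (tup : ℕ → ℕ) (s : St) : Prop where
  n_eq : s.n = n
  k_eq : s.k = k
  dim_eq : s.I .dim 0 = D
  ext_eq : s.I .ext 0 = E
  tup_eq : s.I .tup = tup
  piv : ∀ u < k, s.R .piv u = pivotVal M n k D tup u
  xs : ∀ u ≤ k, ∀ a < D, s.R .xs (u * E + (D + a)) = rowVec M n k D tup u a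
  ys : ∀ u ≤ k, ∀ a < D, s.R .ys (u * E + (D + a)) = colVec M n k D tup u a

/-- The state contains, in addition, the matrix and its eigenvalues. -/
structure Analysed (M : Finset ℕ → ℝ) (n k D E : ℕ) (tup : ℕ → ℕ) (s : St) : Prop
    extends Prepared M n k D E tup s where
  mat : ∀ a < k, ∀ b < k, s.R .mat (a * k + b) = matEntry M n k D tup a b
  eig : ∀ j < k, s.R .eig j = eigVal M n k D tup j

/-- `Agree` asks for equal output regions. Comparing t with `s.withLow t.low` drops this requirement
for programs that write there. -/
def St.withLow (s : St) (f : ℕ → ℝ) : St := { s with low := f }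

theorem St.Agree.setLow {wi : List IVar} {wr : List RVar} {s t : St}
    (h : Agree wi wr (s.withLow t.low) t) (i : ℕ) (v : ℝ) :
    Agree wi wr (s.withLow (t.setLow i v).low) (t.setLow i v) :=
  ⟨h.n, h.k, h.inp, rfl, h.I, h.R⟩

theorem St.Agree.withLow {wi : List IVar} {wr : List RVar} {s t : St} (h : Agree wi wr s t) :
    Agree wi wr (s.withLow t.low) t :=
  ⟨h.n, h.k, h.inp, rfl, h.I, h.R⟩

theorem St.Agree.withLow_trans {wi wi' : List IVar} {wr wr' : List RVar} {s t u : St}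
    (h : Agree wi wr (s.withLow t.low) t) (h' : Agree wi' wr' (t.withLow u.low) u)
    (hi : wi' ⊆ wi) (hr : wr' ⊆ wr) : Agree wi wr (s.withLow u.low) u :=
  ⟨h'.n.trans h.n, h'.k.trans h.k, h'.inp.trans h.inp, rfl,
    fun a ha => (h'.I a fun e => ha (hi e)).trans (h.I a ha),
    fun a ha => (h'.R a fun e => ha (hr e)).trans (h.R a ha)⟩

theorem St.Agree.withLow_then {wi wi' : List IVar} {wr wr' : List RVar} {s t u : St}
    (h : Agree wi wr (s.withLow t.low) t) (h' : Agree wi' wr' t u)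
    (hi : wi' ⊆ wi) (hr : wr' ⊆ wr) : Agree wi wr (s.withLow u.low) u :=
  h.withLow_trans h'.withLow hi hr

theorem St.Agree.withLow_setI {wi : List IVar} {wr : List RVar} {s t : St}
    (h : Agree wi wr (s.withLow t.low) t) {a : IVar} (ha : a ∈ wi) (i v : ℕ) :
    Agree wi wr (s.withLow (t.setI a i v).low) (t.setI a i v) := h.setI ha i v

theorem St.Agree.withLow_setR {wi : List IVar} {wr : List RVar} {s t : St}
    (h : Agree wi wr (s.withLow t.low) t) {a : RVar} (ha : a ∈ wr) (i : ℕ) (v : ℝ) :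
    Agree wi wr (s.withLow (t.setR a i v).low) (t.setR a i v) := h.setR ha i v

section transport

variable {M : Finset ℕ → ℝ} {n k D E : ℕ} {tup : ℕ → ℕ} {s t : St} {wi : List IVar} {wr : List RVar}

/-- A frame rule. The side conditions concern concrete lists of names, so `decide` supplies them by
default. -/
theorem Prepared.congr (h : Prepared M n k D E tup s) (ha : St.Agree wi wr (s.withLow t.low) t)
    (hi : ∀ a ∈ [IVar.dim, .ext, .tup], a ∉ wi := by decide)
    (hr : ∀ a ∈ [RVar.piv, .xs, .ys], a ∉ wr := by decide) : Prepared M n k D E tup t where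
  n_eq := ha.n.trans h.n_eq
  k_eq := ha.k.trans h.k_eq
  dim_eq := (congrFun (ha.I .dim fun e => hi _ (by simp) e) 0).trans h.dim_eq
  ext_eq := (congrFun (ha.I .ext fun e => hi _ (by simp) e) 0).trans h.ext_eq
  tup_eq := (ha.I .tup fun e => hi _ (by simp) e).trans h.tup_eq
  piv u hu := (congrFun (ha.R .piv fun e => hr _ (by simp) e) _).trans (h.piv u hu)
  xs u hu a hla := (congrFun (ha.R .xs fun e => hr _ (by simp) e) _).trans (h.xs u hu a hla)
  ys u hu a hla := (congrFun (ha.R .ys fun e => hr _ (by simp) e) _).trans (h.ys u hu a hla)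

theorem Analysed.congr (h : Analysed M n k D E tup s) (ha : St.Agree wi wr (s.withLow t.low) t)
    (hi : ∀ a ∈ [IVar.dim, .ext, .tup], a ∉ wi := by decide)
    (hr : ∀ a ∈ [RVar.piv, .xs, .ys, .mat, .eig], a ∉ wr := by decide) :
    Analysed M n k D E tup t where
  toPrepared := h.toPrepared.congr ha hi (fun a h1 h2 => hr a (by simp at h1; simp; tauto) h2)
  mat a hla b hb := (congrFun (ha.R .mat fun e => hr _ (by simp) e) _).trans (h.mat a hla b hb)
  eig j hj := (congrFun (ha.R .eig fun e => hr _ (by simp) e) _).trans (h.eig j hj)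

end transport

/-! ### Programs for the elimination and the bilinear forms -/

namespace MP

variable {M : Finset ℕ → ℝ} {W n k D E : ℕ} {tup : ℕ → ℕ}

/-- The second loop stores the unit vector of the empty set as row and column number k. It is 1 at
the offset D, where the border starts. -/
def elimination : MP :=
  .seq (forI .step .k eliminationStep) <|
  forI .l (.sc .ext) <|
    .seq (.setR .xs (.add (.mul .k (.sc .ext)) (.sc .l)) (.ofInt
      (.sub (.lit 1) (.add (.sub (.sc .l) (.sc .dim)) (.sub (.sc .dim) (.sc .l))))))
    (.setR .ys (.add (.mul .k (.sc .ext)) (.sc .l)) (.ofInt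
      (.sub (.lit 1) (.add (.sub (.sc .l) (.sc .dim)) (.sub (.sc .dim) (.sc .l))))))

theorem elimination_spec (hd : Dims k D E W) (s : St) (hk : s.k = k) (hD : s.I .dim 0 = D)
    (hE : s.I .ext 0 = E)
    (hf : ∀ r < E, ∀ c < E, s.R .big (r * E + c) = bordered M s.n k D (s.I .tup) r c) :
    Tri M W elimination 20 s fun t =>
      St.Agree [.idx, .piv, .l, .step] [.big, .xs, .ys, .piv] s t ∧
      Prepared M s.n k D E (s.I .tup) t := by
  have := hd.b0; have := hd.b1; have := hd.b4; have := hd.b6; have := hd.kpos; have := hd.pos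
  have hDE := hd.ext
  refine .seq (.forI (m := 16) k (fun c t =>
      St.Agree [.idx, .piv, .l, .step] [.big, .xs, .ys, .piv] s t ∧
      (∀ r < E, ∀ j < E, t.R .big (r * E + j) = stage M s.n k D (s.I .tup) c r j) ∧
      (∀ u < c, t.R .piv u = pivotVal M s.n k D (s.I .tup) u) ∧
      (∀ u < c, ∀ l < E, t.R .xs (u * E + l) = stage M s.n k D (s.I .tup) u
          (pivotRow (stage M s.n k D (s.I .tup) u) D) l ∧
        t.R .ys (u * E + l) = stage M s.n k D (s.I .tup) u l
          (pivotCol (stage M s.n k D (s.I .tup) u) D)))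
    (by simp; omega) (by omega) (by simp [hk]) ?_ ?_ ?_)
  · exact ⟨(St.Agree.refl s).setI (by decide) _ _, by simpa [stage, eliminate] using hf, by simp,
      by simp⟩
  · rintro c hc t ⟨ha, hbig, hpiv, hxy⟩ hv
    refine ((eliminationStep_spec hd (stage M s.n k D (s.I .tup) c) t (ha.k.trans hk)
      (by rw [ha.I .dim (by decide), hD]) (by rw [ha.I .ext (by decide), hE]) hbig).mono
      (by omega)).weaken ?_
    rintro u ⟨hu, h1, h2, h3, h4, h5⟩
    simp only [hv] at h2 h3 h4 h5
    refine ⟨by rw [hu.I .step (by decide), hv], (ha.andThen hu (by decide) (by decide)).setI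
      (by decide) _ _, h1, ?_, ?_⟩
    · intro x hx
      rcases Nat.lt_succ_iff_lt_or_eq.1 hx with h | rfl
      · exact (h2 x h).trans (hpiv x h)
      · exact h4
    · intro x hx l hl
      rcases Nat.lt_succ_iff_lt_or_eq.1 hx with h | rfl
      · have h6 : x * E + l < c * E := index_lt h hl
        exact ⟨(h3 _ h6).1.trans (hxy x h l hl).1, (h3 _ h6).2.trans (hxy x h l hl).2⟩
      · exact h5 l hl
  · rintro s1 ⟨ha1, -, hpiv, hxy⟩
    refine .forI (m := 16) E (fun e t => St.Agree [.idx, .piv, .l, .step] [.big, .xs, .ys, .piv] s t ∧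
      St.Agree [.l] [.xs, .ys] s1 t ∧
      (∀ u < k, ∀ l < E, t.R .xs (u * E + l) = s1.R .xs (u * E + l) ∧
        t.R .ys (u * E + l) = s1.R .ys (u * E + l)) ∧
      ∀ l < e, t.R .xs (k * E + l) = (if l = D then 1 else 0) ∧
        t.R .ys (k * E + l) = (if l = D then 1 else 0)) (by simp; omega) (by omega)
      (by simp [ha1.I .ext (by decide), hE]) ?_ ?_ ?_
    · exact ⟨ha1.setI (by decide) _ _, (St.Agree.refl s1).setI (by decide) _ _, by simp, by simp⟩
    · rintro e he t ⟨ha, hb, h1, h2⟩ hv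
      have hE' : t.I .ext 0 = E := by rw [ha.I .ext (by decide), hE]
      have hD' : t.I .dim 0 = D := by rw [ha.I .dim (by decide), hD]
      have hk' : t.k = k := ha.k.trans hk
      refine .seq (.setR (by simp [hE', hk']; omega) (.setR (by simp [hE', hk']; omega)
        ⟨by simpa using hv, ((ha.setR (by decide) _ _).setR (by decide) _ _).setI (by decide) _ _,
          ((hb.setR (by decide) _ _).setR (by decide) _ _).setI (by decide) _ _, ?_, ?_⟩))
      · intro u hu l hl
        have h3 : u * E + l < k * E := index_lt hu hl
        have h4 : u * E + l ≠ k * E + e := by omega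
        simpa [hk', hE', hv, h4] using h1 u hu l hl
      · intro l hl
        have h5 : ((1 - (e - D + (D - e)) : ℕ) : ℝ) = if e = D then 1 else 0 := by
          split_ifs with h3
          · rw [Nat.cast_eq_one]; omega
          · rw [Nat.cast_eq_zero]; omega
        simp only [RE.eval, IE.eval, St.setI_R, St.setR_R, St.setR_I, St.setR_k, hk', hE', hv, hD',
          reduceCtorEq, false_and, if_false, true_and, Nat.add_left_cancel_iff, h5]
        split_ifs with h3 h4 <;> first | exact absurd h3 (by omega) | skip
        all_goals first
          | exact ⟨rfl, rfl⟩
          | (have := h2 l (by omega); simp_all)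
    · rintro t ⟨ha, hb, h1, h2⟩
      refine ⟨ha, ha.n, ha.k.trans hk, by rw [ha.I .dim (by decide), hD],
        by rw [ha.I .ext (by decide), hE], ha.I .tup (by decide), ?_, ?_, ?_⟩
      · intro u hu
        rw [hb.R .piv (by decide), hpiv u hu]
      · intro u hu a hla
        rw [rowVec]
        split_ifs with h3 h4
        · rw [(h1 u h3 _ (by omega)).1, (hxy u h3 _ (by omega)).1]
        · rw [show u = k by omega, (h2 _ (by omega)).1, if_pos (by omega)]
        · rw [show u = k by omega, (h2 _ (by omega)).1, if_neg (by omega)]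
      · intro u hu a hla
        rw [colVec]
        split_ifs with h3 h4
        · rw [(h1 u h3 _ (by omega)).2, (hxy u h3 _ (by omega)).2]
        · rw [show u = k by omega, (h2 _ (by omega)).2, if_pos (by omega)]
        · rw [show u = k by omega, (h2 _ (by omega)).2, if_neg (by omega)]

def bilinear : MP :=
  .seq (.setR .acc (.lit 0) (.ofInt (.lit 0))) <|
  forI .idx (.mul (.sc .dim) (.sc .dim)) <|
    .seq (.setI .code (.lit 0) (.sc .idx)) <|
    .seq moment <|
    .setR .acc (.lit 0) (.add (.sc .acc) (.mul (.mul
      (.var .xs (.add (.mul (.sc .row) (.sc .ext)) (.add (.sc .dim) (.mod (.sc .idx) (.sc .dim)))))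
      (.sc .mom))
      (.var .ys (.add (.mul (.sc .col) (.sc .ext)) (.add (.sc .dim) (.div (.sc .idx) (.sc .dim)))))))

theorem bilinear_spec (hd : Dims k D E W) (s : St) (hs : Prepared M n k D E tup s)
    (hrow : s.I .row 0 ≤ k) (hcol : s.I .col 0 ≤ k) :
    Tri M W bilinear 15 s fun t => St.Agree [.cur, .bit, .idx, .code] [.mom, .acc] s t ∧
      t.R .acc 0 = bil M n k D tup (s.I .row 0) (s.I .col 0) (s.I .extra 0) := by
  have := hd.b0; have := hd.b1; have := hd.b4; have := hd.b5; have := hd.kpos; have := hd.pos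
  have hDE := hd.ext
  refine .seq (.setR (by simp [hs.k_eq]; omega) ?_)
  refine .forI (m := 11) (D * D) (fun c t =>
    St.Agree [.cur, .bit, .idx, .code] [.mom, .acc] s t ∧
    t.R .acc 0 = ∑ c ∈ Finset.range c, rowVec M n k D tup (s.I .row 0) (c % D) *
      M (momentSet n k tup c (s.I .extra 0)) * colVec M n k D tup (s.I .col 0) (c / D))
    (by simp [hs.dim_eq]; omega) (by omega) (by simp [hs.dim_eq])
    ⟨((St.Agree.refl s).setR (by decide) _ _).setI (by decide) _ _, by simp⟩ ?_ (fun t ht => ht)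
  rintro c hc t ⟨ha, hacc⟩ hv
  have hp := hs.congr ha.withLow
  have hdiv : c / D ≤ c := Nat.div_le_self _ _
  have hdivlt : c / D < D := Nat.div_lt_of_lt_mul hc
  have hmod : c % D < D := Nat.mod_lt _ (by omega)
  refine .seq (.setI (by simp; omega) (.seq (((moment_spec hd _ (by simpa using hp.k_eq)
    (by simpa [hv] using hc)).mono (by omega)).weaken ?_)))
  rintro u ⟨hu, hmom⟩
  have ha' := (ha.setI (a := .code) (by decide) 0 (IE.eval t (.sc .idx))).andThen hu (by decide)
    (by decide)
  have hp' := hs.congr ha'.withLow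
  have hidx : u.I .idx 0 = c := by rw [hu.I .idx (by decide)]; simpa using hv
  refine .setR (by simp [hp'.k_eq, hp'.ext_eq, hp'.dim_eq, hidx]; omega) ⟨by simpa using hidx,
    (ha'.setR (by decide) _ _).setI (by decide) _ _, ?_⟩
  have hacc' : u.R .acc 0 = t.R .acc 0 := by rw [hu.R .acc (by decide)]; simp
  simp only [RE.eval, IE.eval, St.setI_R, St.setR_R, true_and, if_true, hidx, hp'.ext_eq, hp'.dim_eq,
    ha'.I .row (by decide), ha'.I .col (by decide)]
  rw [hp'.xs _ hrow _ hmod, hp'.ys _ hcol _ hdivlt, Finset.sum_range_succ, ← hacc, hacc', hmom]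
  simp [hv, hp.n_eq, hp.tup_eq, ha.I .extra (by decide)]

end MP

/-! ### Programs for the matrix, its eigenvalues and the coefficients -/

namespace MP

variable {M : Finset ℕ → ℝ} {W n k D E : ℕ} {tup : ℕ → ℕ}

/-- The matrix is stored twice. The copy at the bottom of the memory is for the eigenvalue
instruction and is later overwritten by the output; the copy in a named array serves the Lagrange
polynomials. -/
def fillMatrix : MP :=
  forI .row .k <| forI .col .k <|
    .seq (.setI .extra (.lit 0) (.var .tup (.sub (.add .k .k) (.lit 2)))) <|
    .seq bilinear <|
    .seq (.setR .mat (.add (.mul (.sc .row) .k) (.sc .col)) (.div (.sc .acc) (.var .piv (.sc .col))))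
      (.setLow (.add (.mul (.sc .row) .k) (.sc .col)) (.div (.sc .acc) (.var .piv (.sc .col))))

theorem fillMatrix_spec (hd : Dims k D E W) (s : St) (hs : Prepared M n k D E tup s) :
    Tri M W fillMatrix 24 s fun t =>
      St.Agree [.cur, .bit, .idx, .code, .extra, .row, .col] [.mom, .acc, .mat]
        (s.withLow t.low) t ∧
      ∀ a < k, ∀ b < k, t.R .mat (a * k + b) = matEntry M n k D tup a b ∧
        t.low (a * k + b) = matEntry M n k D tup a b := by
  have := hd.b0; have := hd.b1; have := hd.b2; have := hd.kpos
  refine .forI (m := 21) k (fun a t =>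
    St.Agree [.cur, .bit, .idx, .code, .extra, .row, .col] [.mom, .acc, .mat]
        (s.withLow t.low) t ∧
      ∀ x < a * k, t.R .mat x = matEntry M n k D tup (x / k) (x % k) ∧
        t.low x = matEntry M n k D tup (x / k) (x % k)) (by simp; omega) (by omega)
    (by simp [hs.k_eq]) ⟨(St.Agree.refl s).withLow.withLow_setI (by decide) _ _, by simp⟩ ?_ ?_
  · rintro a hla t ⟨ha, hx⟩ hv
    refine .forI (m := 19) k (fun b t =>
      St.Agree [.cur, .bit, .idx, .code, .extra, .row, .col] [.mom, .acc, .mat]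
          (s.withLow t.low) t ∧ t.I .row 0 = a ∧
        ∀ x < a * k + b, t.R .mat x = matEntry M n k D tup (x / k) (x % k) ∧
          t.low x = matEntry M n k D tup (x / k) (x % k)) (by simp; omega) (by omega)
      (by simp [ha.k]; exact hs.k_eq) ⟨ha.withLow_setI (by decide) _ _, by simpa using hv, by simpa using hx⟩ ?_ ?_
    · rintro b hb t ⟨ha, hrow, hx⟩ hv
      have hp := hs.congr ha
      refine .seq (.setI (by simp; omega) ?_)
      have ha1 := ha.withLow_setI (a := .extra) (by decide) 0
        (IE.eval t (.var .tup (.sub (.add .k .k) (.lit 2))))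
      refine .seq (((bilinear_spec hd _ (hs.congr ha1) (by simp [hrow]; omega)
        (by simp [hv]; omega)).mono (by omega)).weaken ?_)
      rintro u ⟨hu, hacc⟩
      have ha2 := ha1.withLow_then hu (by decide) (by decide)
      have hp2 := hs.congr ha2
      have hrow2 : u.I .row 0 = a := by rw [hu.I .row (by decide)]; simpa using hrow
      have hcol2 : u.I .col 0 = b := by rw [hu.I .col (by decide)]; simpa using hv
      have hacc2 : u.R .acc 0 = bil M n k D tup a b (tup (2 * k - 2)) := by
        rw [hacc]; simp [hrow, hv, hp.tup_eq, hp.k_eq, two_mul]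
      have hval : u.R .acc 0 / u.R .piv b = matEntry M n k D tup a b := by
        rw [hacc2, hp2.piv b hb, matEntry]
      have hlt : a * k + b < k * k := index_lt hla hb
      refine .seq (.setR (by simp [hp2.k_eq]; omega) (.setLow (by simp [hp2.k_eq]; omega)
        ⟨by simpa using hcol2, ((ha2.withLow_setR (by decide) _ _).setLow _ _).withLow_setI
          (by decide) _ _, by simpa using hrow2, fun x hxlt => ?_⟩))
      have hx' := hx x
      rw [show t.R .mat x = u.R .mat x by rw [hu.R .mat (by decide)]; rfl,
        show t.low x = u.low x by rw [hu.low]; rfl] at hx'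
      simp only [RE.eval, IE.eval, St.setI_R, St.setLow_R, St.setR_R, hrow2, hcol2, hp2.k_eq,
        true_and, St.setI_low, St.setLow_low, St.setR_I, St.setR_low, St.setR_k, reduceCtorEq,
        false_and, if_false, hval]
      have hsz : x < u.lowSize ∨ x ≠ a * k + b := by
        simp only [St.lowSize, hp2.k_eq]; omega
      have hsz' : (u.setR .mat (a * k + b) (matEntry M n k D tup a b)).lowSize = u.lowSize := rfl
      rw [hsz']
      by_cases hxe : x = a * k + b
      · rw [if_pos hxe, if_pos ⟨hxe, by omega⟩, hxe, index_div hb, index_mod hb]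
        exact ⟨rfl, rfl⟩
      · rw [if_neg hxe, if_neg (by tauto)]
        exact hx' (by omega)
    · rintro t ⟨ha, hrow, hx⟩
      exact ⟨hrow, ha.withLow_setI (by decide) _ _, fun x hxlt => hx x (by linarith)⟩
  · rintro t ⟨ha, hx⟩
    refine ⟨ha, fun a hla b hb => ?_⟩
    have := hx _ (index_lt hla hb)
    rwa [index_div hb, index_mod hb] at this

/-- The dimension read from the state equals k only propositionally, and the type of the matrix
depends on it. -/
theorem realEigenvalue_congr {d k : ℕ} (h : d = k) (f : ℕ → ℝ) (g : ℕ → ℕ → ℝ)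
    (hfg : ∀ a < k, ∀ b < k, f (a * k + b) = g a b) (j : ℕ) :
    realEigenvalue (d := d) (Matrix.of fun a b => f (a * d + b)) j =
      realEigenvalue (Matrix.of fun a b : Fin k => g a b) j := by
  subst h
  congr 1
  ext a b
  exact hfg a a.2 b b.2

def eigenvalues : MP := forI .j .k (.setR .eig (.sc .j) (.eig (.sc .j)))

theorem eigenvalues_spec (hd : Dims k D E W) (s : St) (hs : Prepared M n k D E tup s)
    (hm : ∀ a < k, ∀ b < k, s.R .mat (a * k + b) = matEntry M n k D tup a b ∧
        s.low (a * k + b) = matEntry M n k D tup a b) :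
    Tri M W eigenvalues 4 s fun t =>
      St.Agree [.j] [.eig] s t ∧ Analysed M n k D E tup t := by
  have := hd.b0; have := hd.b1; have := hd.b2; have := hd.b3; have := hd.kpos
  refine .forI (m := 1) k (fun j t => St.Agree [.j] [.eig] s t ∧
    ∀ i < j, t.R .eig i = eigVal M n k D tup i) (by simp; omega) (by omega)
    (by simp [hs.k_eq]) ⟨(St.Agree.refl s).setI (by decide) _ _, by simp⟩ ?_ ?_
  · rintro j hj t ⟨ha, he⟩ hv
    have hp := hs.congr ha.withLow
    have hk3 : k ^ 3 = k * k * k := by ring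
    refine .setR (by simp [hp.k_eq, hk3]; omega) ⟨by simpa using hv,
      (ha.setR (by decide) _ _).setI (by decide) _ _, fun i hi => ?_⟩
    simp only [RE.eval, IE.eval, St.setI_R, St.setR_R, hv, true_and]
    split_ifs with h
    · rw [h, realEigenvalue_congr hp.k_eq t.low (matEntry M n k D tup)
        (fun a hla b hb => by rw [ha.low]; exact (hm a hla b hb).2)]
      rfl
    · exact he i (by omega)
  · rintro t ⟨ha, he⟩
    refine ⟨ha, hs.congr ha.withLow, fun a hla b hb => ?_, he⟩
    rw [ha.R .mat (by decide)]; exact (hm a hla b hb).1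

/-- The elimination and the eigenvalues for the tuple in the memory. -/
def analyse : MP := .seq fill <| .seq elimination <| .seq fillMatrix eigenvalues

theorem analyse_spec (hd : Dims k D E W) (s : St) (hk : s.k = k) (hD : s.I .dim 0 = D)
    (hE : s.I .ext 0 = E) :
    Tri M W analyse 27 s fun t =>
      St.Agree [.cur, .bit, .idx, .code, .extra, .row, .col, .piv, .l, .step, .j]
        [.mom, .big, .xs, .ys, .piv, .acc, .mat, .eig] (s.withLow t.low) t ∧
      Analysed M s.n k D E (s.I .tup) t := by
  refine .seq (((fill_spec hd s hk hD hE).mono (by omega)).weaken ?_)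
  rintro t1 ⟨h1, hbig⟩
  refine .seq (((elimination_spec hd t1 (h1.k.trans hk) (by rw [h1.I .dim (by decide), hD])
    (by rw [h1.I .ext (by decide), hE]) (by rw [h1.n, h1.I .tup (by decide)]; exact hbig)).mono
      (by omega)).weaken ?_)
  rintro t2 ⟨h2, hp2⟩
  rw [h1.n, h1.I .tup (by decide)] at hp2
  refine .seq (((fillMatrix_spec hd t2 hp2).mono (by omega)).weaken ?_)
  rintro t3 ⟨h3, hm3⟩
  refine ((eigenvalues_spec hd t3 (hp2.congr h3) hm3).mono (by omega)).weaken ?_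
  rintro t4 ⟨h4, ha4⟩
  refine ⟨?_, ha4⟩
  have h5 := (h1.withLow.mono (wi' := [.cur, .bit, .idx, .code, .extra, .row, .col, .piv, .l, .step, .j])
    (wr' := [.mom, .big, .xs, .ys, .piv, .acc, .mat, .eig]) (by decide) (by decide))
  exact ((h5.withLow_then h2 (by decide) (by decide)).withLow_trans h3 (by decide)
    (by decide)).withLow_then h4 (by decide) (by decide)

/-- One factor (A - μ_l) / (μ_j - μ_l) is applied. The result goes to a second vector first, since
every entry depends on all the old ones. -/
def lagrangeFactor : MP :=
  .seq (forI .row .k <|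
    .seq (.setR .acc (.lit 0) (.ofInt (.lit 0))) <|
    .seq (forI .col .k <| .setR .acc (.lit 0) (.add (.sc .acc)
      (.mul (.var .mat (.add (.mul (.sc .row) .k) (.sc .col))) (.var .vec (.sc .col))))) <|
    .setR .vec' (.sc .row) (.div
      (.sub (.sc .acc) (.mul (.var .eig (.sc .l)) (.var .vec (.sc .row))))
      (.sub (.var .eig (.sc .j)) (.var .eig (.sc .l))))) <|
  forI .row .k <| .setR .vec (.sc .row) (.var .vec' (.sc .row))

theorem lagrangeFactor_spec (hd : Dims k D E W) (s : St) (hs : Analysed M n k D E tup s)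
    (v : ℕ → ℝ) (hv : ∀ i < k, s.R .vec i = v i) (hj : s.I .j 0 < k) (hl : s.I .l 0 < k) :
    Tri M W lagrangeFactor 9 s fun t =>
      St.Agree [.row, .col] [.acc, .vec, .vec'] s t ∧
      ∀ i < k, t.R .vec i = (∑ u ∈ Finset.range k, matEntry M n k D tup i u * v u -
        eigVal M n k D tup (s.I .l 0) * v i) /
          (eigVal M n k D tup (s.I .j 0) - eigVal M n k D tup (s.I .l 0)) := by
  have := hd.b0; have := hd.b1; have := hd.kpos
  refine .seq (.forI (m := 5) k (fun i t => St.Agree [.row, .col] [.acc, .vec'] s t ∧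
    ∀ x < i, t.R .vec' x = (∑ u ∈ Finset.range k, matEntry M n k D tup x u * v u -
        eigVal M n k D tup (s.I .l 0) * v x) /
          (eigVal M n k D tup (s.I .j 0) - eigVal M n k D tup (s.I .l 0)))
    (by simp; omega) (by omega) (by simp [hs.k_eq])
    ⟨(St.Agree.refl s).setI (by decide) _ _, by simp⟩ ?_ ?_)
  · rintro i hi t ⟨ha, hx⟩ hrow
    refine .seq (.setR (by simp [ha.k, hs.k_eq]; omega) ?_)
    refine .seq (.forI (m := 1) k (fun c t => St.Agree [.row, .col] [.acc, .vec'] s t ∧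
      t.I .row 0 = i ∧ (∀ x < i, t.R .vec' x = (∑ u ∈ Finset.range k, matEntry M n k D tup x u * v u -
        eigVal M n k D tup (s.I .l 0) * v x) /
          (eigVal M n k D tup (s.I .j 0) - eigVal M n k D tup (s.I .l 0))) ∧
      t.R .acc 0 = ∑ u ∈ Finset.range c, matEntry M n k D tup i u * v u)
      (by simp; omega) (by omega) (by simp [ha.k, hs.k_eq])
      ⟨(ha.setR (by decide) _ _).setI (by decide) _ _, by simpa using hrow, by simpa using hx,
        by simp⟩ ?_ ?_)
    · rintro c hc t ⟨ha, hrow, hx, hacc⟩ hcol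
      have hp := hs.congr ha.withLow
      refine .setR (by simp [hp.k_eq]; omega) ⟨by simpa using hcol,
        (ha.setR (by decide) _ _).setI (by decide) _ _, by simpa using hrow, by simpa using hx, ?_⟩
      simp only [RE.eval, IE.eval, St.setI_R, St.setR_R, true_and, if_true, hrow, hcol, hp.k_eq]
      rw [hp.mat i hi c hc, ha.R .vec (by decide), hv c hc, hacc, Finset.sum_range_succ]
    · rintro t ⟨ha, hrow, hx, hacc⟩
      have hp := hs.congr ha.withLow
      refine .setR (by simp [hp.k_eq]; omega) ⟨by simpa using hrow,
        (ha.setR (by decide) _ _).setI (by decide) _ _, fun x hxi => ?_⟩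
      simp only [RE.eval, IE.eval, St.setI_R, St.setR_R, true_and, hrow,
        ha.I .l (by decide), ha.I .j (by decide), hp.eig _ hj, hp.eig _ hl, hacc,
        ha.R .vec (by decide), hv i hi]
      split_ifs with h
      · rw [h]
      · exact hx x (by omega)
  · rintro s1 ⟨ha1, hx1⟩
    refine .forI (m := 5) k (fun i t => St.Agree [.row, .col] [.acc, .vec, .vec'] s t ∧
      t.R .vec' = s1.R .vec' ∧ ∀ x < i, t.R .vec x = s1.R .vec' x) (by simp; omega) (by omega)
      (by simp [ha1.k, hs.k_eq]) ⟨(ha1.mono (by decide) (by decide)).setI (by decide) _ _, rfl,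
        by simp⟩ ?_ ?_
    · rintro i hi t ⟨ha, h1, h2⟩ hrow
      refine .setR (by simp [ha.k, hs.k_eq]; omega) ⟨by simpa using hrow,
        (ha.setR (by decide) _ _).setI (by decide) _ _, by simpa using h1, fun x hxi => ?_⟩
      simp only [RE.eval, IE.eval, St.setI_R, St.setR_R, true_and, hrow, h1]
      split_ifs with h
      · rw [h]
      · exact h2 x (by omega)
    · rintro t ⟨ha, h1, h2⟩
      exact ⟨ha, fun i hi => (h2 i hi).trans (hx1 i hi)⟩

def coefficientProg : MP :=
  .seq (.setI .col (.lit 0) .k) <|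
  .seq (.setI .extra (.lit 0) (.sc .right)) <|
  .seq (forI .row .k <| .seq bilinear (.setR .vec (.sc .row) (.sc .acc))) <|
  .seq (forI .l .k <|
    .ifI (.add (.sub (.sc .l) (.sc .j)) (.sub (.sc .j) (.sc .l))) (.lit 1) .skip lagrangeFactor) <|
  .seq (.setR .coef (.lit 0) (.ofInt (.lit 0))) <|
  .seq (.setI .row (.lit 0) .k) <|
  .seq (.setI .extra (.lit 0) (.sc .left)) <|
  forI .col .k <| .seq bilinear <| .setR .coef (.lit 0) (.add (.sc .coef)
    (.mul (.div (.sc .acc) (.var .piv (.sc .col))) (.var .vec (.sc .col))))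

theorem coefficientProg_spec (hd : Dims k D E W) (s : St) (hs : Analysed M n k D E tup s)
    (hj : s.I .j 0 < k) :
    Tri M W coefficientProg 27 s fun t =>
      St.Agree [.cur, .bit, .idx, .code, .extra, .row, .col, .l] [.mom, .acc, .vec, .vec', .coef]
        s t ∧
      t.R .coef 0 = coefficient M n k D tup (s.I .j 0) (s.I .left 0) (s.I .right 0) := by
  have := hd.b0; have := hd.b1; have := hd.kpos
  set wi : List IVar := [.cur, .bit, .idx, .code, .extra, .row, .col, .l] with hwi
  set wr : List RVar := [.mom, .acc, .vec, .vec', .coef] with hwr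
  refine .seq (.setI (by simp; omega) (.seq (.setI (by simp; omega) ?_)))
  refine .seq (.forI (m := 21) k (fun i t => St.Agree wi wr s t ∧ t.I .col 0 = k ∧
    t.I .extra 0 = s.I .right 0 ∧
    ∀ x < i, t.R .vec x = lagrangeVec M n k D tup (s.I .j 0) (s.I .right 0) 0 x)
    (by simp; omega) (by omega) (by simp [hs.k_eq])
    ⟨(((St.Agree.refl s).setI (by decide) _ _).setI (by decide) _ _).setI (by decide) _ _,
      by simp [hs.k_eq], by simp, by simp⟩ ?_ ?_)
  · rintro i hi t ⟨ha, hcol, hext, hx⟩ hrow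
    refine .seq (((bilinear_spec hd t (hs.toPrepared.congr ha.withLow) (by omega) (by omega)).mono
      (by omega)).weaken ?_)
    rintro u ⟨hu, hacc⟩
    have hrow' : u.I .row 0 = i := by rw [hu.I .row (by decide), hrow]
    refine .setR (by simp [hu.k, ha.k, hs.k_eq]; omega) ⟨by simpa using hrow',
      ((ha.andThen hu (by decide) (by decide)).setR (by decide) _ _).setI (by decide) _ _,
      by simpa [hu.I .col (by decide)] using hcol, by simpa [hu.I .extra (by decide)] using hext,
      fun x hxi => ?_⟩
    simp only [RE.eval, IE.eval, St.setI_R, St.setR_R, true_and, hrow', hacc, hu.R .vec (by decide),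
      hrow, hcol, hext]
    split_ifs with h
    · rw [h]; rfl
    · exact hx x (by omega)
  rintro s1 ⟨ha1, -, -, hx1⟩
  refine .seq (.forI (m := 20) k (fun l t => St.Agree wi wr s t ∧
    ∀ x < k, t.R .vec x = lagrangeVec M n k D tup (s.I .j 0) (s.I .right 0) l x)
    (by simp; omega) (by omega) (by simp [ha1.k, hs.k_eq])
    ⟨ha1.setI (by decide) _ _, by simpa using hx1⟩ ?_ ?_)
  · rintro l hl t ⟨ha, hx⟩ hv
    have hj' : t.I .j 0 = s.I .j 0 := by rw [ha.I .j (by decide)]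
    refine .ifI (by simp; omega) (fun h => .skip ⟨hv, ha.setI (by decide) _ _, fun x hxk => ?_⟩)
      (fun h => ((lagrangeFactor_spec hd t (hs.congr ha.withLow) _ hx (by omega) (by omega)).mono
        (by omega)).weaken ?_)
    · simp only [IE.eval, hv, hj'] at h
      rw [lagrangeVec, if_pos (by omega)]
      exact hx x hxk
    · simp only [IE.eval, hv, hj'] at h
      rintro u ⟨hu, hux⟩
      refine ⟨by rw [hu.I .l (by decide), hv],
        (ha.andThen hu (by decide) (by decide)).setI (by decide) _ _, fun x hxk => ?_⟩
      rw [lagrangeVec, if_neg (by omega), St.setI_R, hux x hxk, hv, hj']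
  rintro s2 ⟨ha2, hx2⟩
  refine .seq (.setR (by simp [ha2.k, hs.k_eq]; omega) (.seq (.setI (by simp; omega)
    (.seq (.setI (by simp; omega) ?_)))))
  refine .forI (m := 17) k (fun c t => St.Agree wi wr s t ∧ t.I .row 0 = k ∧
    t.I .extra 0 = s.I .left 0 ∧ t.R .vec = s2.R .vec ∧
    t.R .coef 0 = ∑ u ∈ Finset.range c, bil M n k D tup k u (s.I .left 0) / pivotVal M n k D tup u *
      lagrangeVec M n k D tup (s.I .j 0) (s.I .right 0) k u) (by simp; omega) (by omega)
    (by simp [ha2.k, hs.k_eq])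
    ⟨(((ha2.setR (by decide) _ _).setI (by decide) _ _).setI (by decide) _ _).setI (by decide) _ _,
      by simp [ha2.k, hs.k_eq], by simp [ha2.I .left (by decide)], by simp, by simp⟩ ?_
    (fun t ht => ⟨ht.1, ht.2.2.2.2⟩)
  rintro c hc t ⟨ha, hrow, hext, hvec, hcoef⟩ hcol
  refine .seq (((bilinear_spec hd t (hs.toPrepared.congr ha.withLow) (by omega) (by omega)).mono
      (by omega)).weaken ?_)
  rintro u ⟨hu, hacc⟩
  have hcol' : u.I .col 0 = c := by rw [hu.I .col (by decide), hcol]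
  have ha' := ha.andThen hu (by decide) (by decide)
  have hp' := hs.toPrepared.congr ha'.withLow
  refine .setR (by simp [hp'.k_eq]; omega) ⟨by simpa using hcol',
    (ha'.setR (by decide) _ _).setI (by decide) _ _, by simpa [hu.I .row (by decide)] using hrow,
    by simpa [hu.I .extra (by decide)] using hext, by simpa [hu.R .vec (by decide)] using hvec, ?_⟩
  simp only [RE.eval, IE.eval, St.setI_R, St.setR_R, true_and, if_true, hcol', hacc, hrow, hcol, hext,
    hu.R .vec (by decide), hvec, hu.R .coef (by decide), hcoef, hp'.piv c hc, hx2 c hc,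
    Finset.sum_range_succ]

end MP

/-! ### The output model and the acceptance test -/

section pure

variable (M : Finset ℕ → ℝ) (n k D : ℕ) (tup : ℕ → ℕ)

/-- The last weight absorbs the defect, so that the weights sum to 1 exactly. -/
noncomputable def weightOut (j : ℕ) : ℝ :=
  coefficient M n k D tup j n n +
    if j = k - 1 then 1 - ∑ i ∈ Finset.range k, coefficient M n k D tup i n n else 0

-- A moment must not contain an observable twice, because sets do not record multiplicity. An
-- observable from the second half of the tuple already occurs in the column products, so it is
-- attached to the vector in which the column is the empty set; every other observable is attached
-- to the vector in which the row is the empty set.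
open Classical in
noncomputable def meanOut (i j : ℕ) : ℝ :=
  max 0 (min 1 ((if ∃ l < k - 1, tup (k - 1 + l) = i then coefficient M n k D tup j n i
    else coefficient M n k D tup j i n) / weightOut M n k D tup j))

noncomputable def lowOut (x : ℕ) : ℝ :=
  if x < k then weightOut M n k D tup x else meanOut M n k D tup ((x - k) / k) ((x - k) % k)

/-- The test that a tuple has to pass before it is used. -/
def Passes (ζ τ : ℝ) : Prop :=
  (∀ a < 2 * k - 1, ∀ b < a, tup a ≠ tup b) ∧
    (∀ u < k, ¬ pivotVal M n k D tup u * pivotVal M n k D tup u < τ * τ) ∧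
    ∀ j < k - 1, ¬ eigVal M n k D tup j < eigVal M n k D tup (j + 1) + ζ / 2

end pure

namespace MP

variable {M : Finset ℕ → ℝ} {W n k D E : ℕ} {tup : ℕ → ℕ}

def writeWeights : MP :=
  .seq (.setR .rem (.lit 0) (.ofInt (.lit 1))) <|
  .seq (forI .j .k <|
    .seq (.setI .left (.lit 0) .n) <|
    .seq (.setI .right (.lit 0) .n) <|
    .seq coefficientProg <|
    .seq (.setR .wt (.sc .j) (.sc .coef)) <|
    .setR .rem (.lit 0) (.sub (.sc .rem) (.sc .coef))) <|
  .seq (.setR .wt (.sub .k (.lit 1)) (.add (.var .wt (.sub .k (.lit 1))) (.sc .rem))) <|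
  forI .j .k <| .setLow (.sc .j) (.var .wt (.sc .j))

theorem writeWeights_spec (hd : Dims k D E W) (s : St) (hs : Analysed M n k D E tup s) :
    Tri M W writeWeights 36 s fun t =>
      St.Agree [.cur, .bit, .idx, .code, .extra, .row, .col, .l, .left, .right, .j]
        [.mom, .acc, .vec, .vec', .coef, .wt, .rem] (s.withLow t.low) t ∧
      ∀ j < k, t.R .wt j = weightOut M n k D tup j ∧ t.low j = weightOut M n k D tup j := by
  have := hd.b0; have := hd.b1; have := hd.kpos
  refine .seq (.setR (by simp [hs.k_eq]; omega) ?_)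
  refine .seq (.forI (m := 31) k (fun j t =>
    St.Agree [.cur, .bit, .idx, .code, .extra, .row, .col, .l, .left, .right, .j]
        [.mom, .acc, .vec, .vec', .coef, .wt, .rem] s t ∧
    (∀ i < j, t.R .wt i = coefficient M n k D tup i n n) ∧
    t.R .rem 0 = 1 - ∑ i ∈ Finset.range j, coefficient M n k D tup i n n)
    (by simp; omega) (by omega) (by simp [hs.k_eq])
    ⟨((St.Agree.refl s).setR (by decide) _ _).setI (by decide) _ _, by simp, by simp⟩ ?_ ?_)
  · rintro j hj t ⟨ha, hw, hr⟩ hv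
    refine .seq (.setI (by simp; omega) (.seq (.setI (by simp; omega) ?_)))
    have ha1 := (ha.setI (a := .left) (by decide) 0 t.n).setI (a := .right) (by decide) 0 t.n
    refine .seq (((coefficientProg_spec hd _ (hs.congr ha1.withLow) (by simpa [hv] using hj)).mono
      (by omega)).weaken ?_)
    rintro u ⟨hu, hco⟩
    have ha2 := ha1.andThen hu (by decide) (by decide)
    have hs2 := hs.congr ha2.withLow
    have hj2 : u.I .j 0 = j := by rw [hu.I .j (by decide)]; simpa using hv
    have hco2 : u.R .coef 0 = coefficient M n k D tup j n n := by
      rw [hco]; simp [hv, ha.n, hs.n_eq]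
    refine .seq (.setR (by simp [hs2.k_eq]; omega) (.setR (by simp [hs2.k_eq]; omega)
      ⟨by simpa using hj2, ((ha2.setR (by decide) _ _).setR (by decide) _ _).setI (by decide) _ _,
        fun i hi => ?_, ?_⟩))
    · have := hw i
      rw [show t.R .wt i = u.R .wt i by rw [hu.R .wt (by decide)]; rfl] at this
      simp only [RE.eval, IE.eval, St.setI_R, St.setR_R, hj2, hco2, reduceCtorEq, false_and,
        if_false, true_and]
      split_ifs with h
      · rw [h]
      · exact this (by omega)
    · rw [show t.R .rem 0 = u.R .rem 0 by rw [hu.R .rem (by decide)]; rfl] at hr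
      simp only [RE.eval, IE.eval, St.setI_R, St.setR_R, hco2, reduceCtorEq, false_and,
        if_false, true_and, if_true, hr, Finset.sum_range_succ]
      ring
  · rintro s1 ⟨ha1, hw1, hr1⟩
    refine .seq (.setR (by simp [ha1.k, hs.k_eq]; omega) ?_)
    refine .forI (m := 30) k (fun j t =>
      St.Agree [.cur, .bit, .idx, .code, .extra, .row, .col, .l, .left, .right, .j]
        [.mom, .acc, .vec, .vec', .coef, .wt, .rem] (s.withLow t.low) t ∧
      (∀ i < k, t.R .wt i = weightOut M n k D tup i) ∧
      ∀ i < j, t.low i = weightOut M n k D tup i) (by simp; omega) (by omega)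
      (by simp [ha1.k, hs.k_eq])
      ⟨(ha1.withLow.withLow_setR (by decide) _ _).withLow_setI (by decide) _ _,
        fun i hi => ?_, by simp⟩ ?_ (fun t ⟨h1, h2, h3⟩ => ⟨h1, fun j hj => ⟨h2 j hj, h3 j hj⟩⟩)
    · simp only [RE.eval, IE.eval, St.setI_R, St.setR_R, true_and, ha1.k, hs.k_eq, hr1, weightOut]
      split_ifs with h
      · rw [hw1 _ (by omega), h]
      · rw [hw1 i hi, add_zero]
    · rintro j hj t ⟨ha, h1, h2⟩ hv
      have hk := (hs.congr ha).k_eq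
      refine .setLow (by simp [hk]; omega) ⟨by simpa using hv,
        (ha.setLow _ _).withLow_setI (by decide) _ _, by simpa using h1, fun i hi => ?_⟩
      simp only [RE.eval, IE.eval, St.setI_low, St.setLow_low, hv, h1 j hj]
      have : i < t.lowSize := by simp only [St.lowSize, hk]; omega
      split_ifs with h
      · rw [h.1]
      · exact h2 i (by omega)

def writeRow : MP :=
  .seq (.setI .left (.lit 0) (.sc .i)) <|
  .seq (.setI .right (.lit 0) .n) <|
  .seq (forI .l (.sub .k (.lit 1)) <|
    .ifI (.add (.sub (.var .tup (.add (.sub .k (.lit 1)) (.sc .l))) (.sc .i))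
        (.sub (.sc .i) (.var .tup (.add (.sub .k (.lit 1)) (.sc .l))))) (.lit 1)
      (.seq (.setI .left (.lit 0) .n) (.setI .right (.lit 0) (.sc .i))) .skip) <|
  forI .j .k <|
    .seq coefficientProg <|
    .seq (.setR .val (.lit 0) (.div (.sc .coef) (.var .wt (.sc .j)))) <|
    .seq (.ifR (.sc .val) (.ofInt (.lit 0)) (.setR .val (.lit 0) (.ofInt (.lit 0)))
      (.ifR (.ofInt (.lit 1)) (.sc .val) (.setR .val (.lit 0) (.ofInt (.lit 1))) .skip)) <|
    .setLow (.add .k (.add (.mul (.sc .i) .k) (.sc .j))) (.sc .val)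

theorem writeRow_spec (hd : Dims k D E W) (s : St) (hs : Analysed M n k D E tup s)
    (hw : ∀ j < k, s.R .wt j = weightOut M n k D tup j) (hi : s.I .i 0 < n)
    (hl : ∀ x < k + s.I .i 0 * k, s.low x = lowOut M n k D tup x) :
    Tri M W writeRow 36 s fun t =>
      St.Agree [.cur, .bit, .idx, .code, .extra, .row, .col, .l, .left, .right, .j]
        [.mom, .acc, .vec, .vec', .coef, .val] (s.withLow t.low) t ∧
      ∀ x < k + (s.I .i 0 + 1) * k, t.low x = lowOut M n k D tup x := by
  classical
  have := hd.b0; have := hd.b1; have := hd.kpos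
  generalize hi0 : s.I .i 0 = i at *
  -- `L` and `R` are the two index variables after l comparisons of i with the second half of the
  -- tuple; a match exchanges i and n.
  set L : ℕ → ℕ := fun l => if ∃ x < l, tup (k - 1 + x) = i then n else i with hL
  set R : ℕ → ℕ := fun l => if ∃ x < l, tup (k - 1 + x) = i then i else n with hR
  refine .seq (.setI (by simp; omega) (.seq (.setI (by simp; omega) ?_)))
  refine .seq (.forI (m := 30) (k - 1) (fun l t =>
    St.Agree [.cur, .bit, .idx, .code, .extra, .row, .col, .l, .left, .right, .j]
        [.mom, .acc, .vec, .vec', .coef, .val] s t ∧ t.I .left 0 = L l ∧ t.I .right 0 = R l)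
    (by simp; omega) (by omega) (by simp [hs.k_eq])
    ⟨(((St.Agree.refl s).setI (by decide) _ _).setI (by decide) _ _).setI (by decide) _ _,
      by simp [hi0, hL], by simp [hs.n_eq, hR]⟩ ?_ ?_)
  · rintro l hl t ⟨ha, h1, h2⟩ hv
    have hp := hs.congr ha.withLow
    have hi1 : t.I .i 0 = i := by rw [ha.I .i (by decide), hi0]
    have hstep : (∃ x < l + 1, tup (k - 1 + x) = i) ↔
        (∃ x < l, tup (k - 1 + x) = i) ∨ tup (k - 1 + l) = i := by
      constructor
      · rintro ⟨x, hx, hxi⟩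
        rcases Nat.lt_succ_iff_lt_or_eq.1 hx with h | rfl
        · exact Or.inl ⟨x, h, hxi⟩
        · exact Or.inr hxi
      · rintro (⟨x, hx, hxi⟩ | h)
        · exact ⟨x, by omega, hxi⟩
        · exact ⟨l, by omega, h⟩
    refine .ifI (by simp; omega) (fun h => .seq (.setI (by simp; omega) (.setI (by simp; omega)
      ⟨by simpa using hv, ((ha.setI (by decide) _ _).setI (by decide) _ _).setI (by decide) _ _,
        ?_, ?_⟩))) (fun h => .skip ⟨hv, ha.setI (by decide) _ _, ?_, ?_⟩)
    all_goals simp only [IE.eval, hp.k_eq, hp.tup_eq, hi1, hv] at h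
    · simp only [hL, hstep, show tup (k - 1 + l) = i by omega]
      simp [hp.n_eq]
    · simp only [hR, hstep, show tup (k - 1 + l) = i by omega]
      simp [hi1]
    · simp only [hL, hstep, show tup (k - 1 + l) ≠ i by omega, or_false]
      simpa using h1
    · simp only [hR, hstep, show tup (k - 1 + l) ≠ i by omega, or_false]
      simpa using h2
  · rintro s1 ⟨ha1, hleft, hright⟩
    refine .forI (m := 30) k (fun j t =>
      St.Agree [.cur, .bit, .idx, .code, .extra, .row, .col, .l, .left, .right, .j]
          [.mom, .acc, .vec, .vec', .coef, .val] (s.withLow t.low) t ∧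
        t.I .left 0 = L (k - 1) ∧ t.I .right 0 = R (k - 1) ∧
        ∀ x < k + (i * k + j), t.low x = lowOut M n k D tup x)
      (by simp; omega) (by omega) (by simp [ha1.k, hs.k_eq])
      ⟨(ha1.setI (by decide) _ _).withLow, by simpa using hleft, by simpa using hright,
        by simpa [ha1.low] using hl⟩ ?_ ?_
    · rintro j hj t ⟨ha, hleft, hright, hlow⟩ hv
      refine .seq (((coefficientProg_spec hd t (hs.congr ha) (by omega)).mono (by omega)).weaken ?_)
      rintro u ⟨hu, hco⟩
      have ha2 := ha.withLow_then hu (by decide) (by decide)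
      have hs2 := hs.congr ha2
      have hi2 : u.I .i 0 = i := by rw [ha2.I .i (by decide)]; exact hi0
      have hj2 : u.I .j 0 = j := by rw [hu.I .j (by decide), hv]
      have hwt : u.R .wt j = weightOut M n k D tup j := by rw [ha2.R .wt (by decide)]; exact hw j hj
      set v : ℝ := coefficient M n k D tup j (L (k - 1)) (R (k - 1)) / weightOut M n k D tup j with hvdef
      have hmean : meanOut M n k D tup i j = max 0 (min 1 v) := by
        rw [meanOut, hvdef]
        simp only [hL, hR]
        split_ifs <;> rfl
      refine .seq (.setR (by simp [hs2.k_eq]; omega) ?_)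
      set w := u.setR .val ((IE.lit 0).eval u) ((RE.div (.sc .coef) (.var .wt (.sc .j))).eval M u) with hw'
      have hwv : w.R .val 0 = v := by
        simp [hw', hco, hleft, hright, hv, hj2, hwt, hvdef]
      have haw : St.Agree [.cur, .bit, .idx, .code, .extra, .row, .col, .l, .left, .right, .j]
          [.mom, .acc, .vec, .vec', .coef, .val] (s.withLow w.low) w :=
        ha2.withLow_setR (by decide) _ _
      have hwk : w.k = k := hs2.k_eq
      -- The three branches of the clamping end with the same write, which is verified once for all
      -- of them.
      have hfin : ∀ y, w.low = y.low → y.I = w.I → y.n = n → y.k = k →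
          St.Agree [.cur, .bit, .idx, .code, .extra, .row, .col, .l, .left, .right, .j]
          [.mom, .acc, .vec, .vec', .coef, .val] (s.withLow y.low) y →
          y.R .val 0 = max 0 (min 1 v) →
          Tri M W (.setLow (.add .k (.add (.mul (.sc .i) .k) (.sc .j))) (.sc .val)) 28 y fun u =>
            u.I .j 0 = j ∧ (St.Agree [.cur, .bit, .idx, .code, .extra, .row, .col, .l, .left, .right, .j]
          [.mom, .acc, .vec, .vec', .coef, .val] (s.withLow (u.setI .j 0 (j + 1)).low) (u.setI .j 0 (j + 1)) ∧
        (u.setI .j 0 (j + 1)).I .left 0 = L (k - 1) ∧ (u.setI .j 0 (j + 1)).I .right 0 = R (k - 1) ∧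
        ∀ x < k + (i * k + (j + 1)), (u.setI .j 0 (j + 1)).low x = lowOut M n k D tup x) := by
        intro y hy1 hy2 hyn hyk hya hyv
        have hyi : y.I .i 0 = i := by rw [hy2]; exact hi2
        have hyj : y.I .j 0 = j := by rw [hy2]; exact hj2
        refine .setLow (by simp [hyk]; omega) ⟨by simpa using hyj,
          (hya.setLow _ _).withLow_setI (by decide) _ _, ?_, ?_, fun x hx => ?_⟩
        · simp only [St.setI_I, St.setLow_I, hy2, reduceCtorEq, false_and, if_false]
          simp only [hw', St.setR_I]
          rw [hu.I .left (by decide)]; exact hleft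
        · simp only [St.setI_I, St.setLow_I, hy2, reduceCtorEq, false_and, if_false]
          simp only [hw', St.setR_I]
          rw [hu.I .right (by decide)]; exact hright
        · have hnk : (i + 1) * k ≤ n * k := Nat.mul_le_mul_right _ hi
          have hnk' : (i + 1) * k = i * k + k := by ring
          have hsz : k + (i * k + j) < y.lowSize := by
            simp only [St.lowSize, hyk, hyn]; omega
          simp only [RE.eval, IE.eval, St.setI_low, St.setLow_low, hyi, hyj, hyk, hyv]
          split_ifs with h
          · rw [h.1, lowOut, if_neg (by omega), Nat.add_sub_cancel_left, index_div hj, index_mod hj,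
              hmean]
          · rw [← hy1]
            have : w.low = t.low := hu.low
            rw [this]
            refine hlow x ?_
            by_contra hc
            have : x = k + (i * k + j) := by omega
            subst this
            exact h ⟨rfl, hsz⟩
      refine .seq (.ifR (by simp [hwk]; omega) (fun h => .setR (by simp [hwk]; omega) ?_)
        (fun h => .ifR (by simp [hwk]; omega) (fun h' => .setR (by simp [hwk]; omega) ?_)
        (fun h' => .skip ?_)))
      all_goals simp only [RE.eval, IE.eval, hwv, Nat.cast_zero] at h
      · refine (hfin (w.setR .val 0 ((RE.ofInt (.lit 0)).eval M w)) rfl rfl hs2.n_eq hwk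
          (haw.withLow_setR (by decide) _ _) ?_).mono (by omega)
        simp [min_eq_right (by linarith : v ≤ 1), max_eq_left h.le]
      · simp only [RE.eval, IE.eval, hwv, Nat.cast_one] at h'
        refine (hfin (w.setR .val 0 ((RE.ofInt (.lit 1)).eval M w)) rfl rfl hs2.n_eq hwk
          (haw.withLow_setR (by decide) _ _) ?_).mono (by omega)
        simp [min_eq_left h'.le]
      · simp only [RE.eval, IE.eval, hwv, Nat.cast_one] at h'
        refine (hfin _ rfl rfl hs2.n_eq hwk haw ?_).mono (by omega)
        rw [hwv, min_eq_right (not_lt.1 h'), max_eq_right (not_lt.1 h)]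
    · rintro t ⟨ha, -, -, hlow⟩
      exact ⟨ha, fun x hx => hlow x (by linarith)⟩

/-- The analysis of a tuple and the output of the resulting model. -/
def report : MP := .seq analyse <| .seq writeWeights <| forI .i .n writeRow

/-- The loop over all observables makes the bound n times a power of W, so it is not phrased with
`Tri`. -/
theorem report_spec (hd : Dims k D E W) (s : St) (hn : 1 ≤ s.n) (hk : s.k = k)
    (hD : s.I .dim 0 = D) (hE : s.I .ext 0 = E) :
    ((report.exec M s).n = s.n ∧ (report.exec M s).k = k ∧
      ∀ x < k + s.n * k, (report.exec M s).low x = lowOut M s.n k D (s.I .tup) x) ∧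
      report.time M s ≤ s.n * W ^ 40 := by
  have hb := hd.b0
  have hW : 1000 ≤ W := by omega
  obtain ⟨⟨h1, ha1⟩, ht1⟩ := analyse_spec (M := M) hd s hk hD hE hW
  obtain ⟨⟨h2, hw2⟩, ht2⟩ := writeWeights_spec hd _ ha1 hW
  set s1 := analyse.exec M s
  set s2 := writeWeights.exec M s1
  let Inv : ℕ → St → Prop := fun i t => Analysed M s.n k D E (s.I .tup) t ∧
    (∀ j < k, t.R .wt j = weightOut M s.n k D (s.I .tup) j) ∧
    ∀ x < k + i * k, t.low x = lowOut M s.n k D (s.I .tup) x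
  have hstep : ∀ i < s.n, ∀ t, Inv i t → t.I .i 0 = i →
      ((writeRow.exec M t).I .i 0 = i ∧ Inv (i + 1) ((writeRow.exec M t).setI .i 0 (i + 1))) ∧
        writeRow.time M t ≤ W ^ 36 := by
    rintro i hi t ⟨ha, hw, hl⟩ hv
    obtain ⟨⟨h4, h5⟩, ht4⟩ := writeRow_spec hd t ha hw (by omega) (by rwa [hv]) hW
    refine ⟨⟨by rw [h4.I .i (by decide)]; exact hv, (ha.congr h4).congr
      (((St.Agree.refl _).setI (wi := [.i]) (wr := []) (by decide) _ _).withLow), ?_, ?_⟩, ht4⟩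
    · intro j hj
      rw [St.setI_R, h4.R .wt (by decide)]
      exact hw j hj
    · rw [hv] at h5
      exact h5
  obtain ⟨h3, ht3⟩ := exec_forI_and_time_le (M := M) (s := s2) .i .n writeRow s.n (W ^ 36) Inv
    (by simp [h2.n, St.withLow]; exact ha1.n_eq)
    ⟨(ha1.congr h2).congr (((St.Agree.refl s2).setI (wi := [.i]) (wr := []) (by decide) _ _).withLow),
      by simpa using fun j hj => (hw2 j hj).1, by
        intro x hx
        rw [zero_mul, add_zero] at hx
        rw [lowOut, if_pos hx]
        exact (hw2 x hx).2⟩ hstep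
  refine ⟨⟨h3.1.n_eq, h3.1.k_eq, h3.2.2⟩, ?_⟩
  have ht : report.time M s = analyse.time M s + (writeWeights.time M s1 +
    (forI .i .n writeRow).time M s2 + 1) + 1 := rfl
  rw [ht]
  simp only [IE.cost] at ht3
  have e1 : W ^ 27 ≤ W ^ 36 := Nat.pow_le_pow_right (by omega) (by omega)
  have e2 : 1 ≤ W ^ 36 := Nat.one_le_pow _ _ (by omega)
  have e3 : W ^ 40 = W ^ 36 * W ^ 4 := by ring
  have e4 : 1000 ≤ W ^ 4 := hW.trans (Nat.le_self_pow (by omega) _)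
  have e5 : W ^ 36 * 1000 ≤ W ^ 40 := by rw [e3]; exact Nat.mul_le_mul_left _ e4
  have e6 : s.n * (W ^ 36 * 1000) ≤ s.n * W ^ 40 := Nat.mul_le_mul_left _ e5
  nlinarith

end MP

/-- The largest of the sizes are k³ ≤ 8^k, from the cost of an eigenvalue, and 4^k, the number of
entries of the bordered matrix. A fixed power of W is still e^(O(k)). -/
theorem dims_of_le (k : ℕ) (hk : 1 ≤ k) : Dims k (2 ^ (k - 1)) (2 ^ k) (100000 * 8 ^ k) := by
  have h1 : k < 2 ^ k := Nat.lt_two_pow_self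
  have h2 : 2 ^ (k - 1) ≤ 2 ^ k := Nat.pow_le_pow_right (by omega) (by omega)
  have h8 : 8 ^ k = 2 ^ k * 2 ^ k * 2 ^ k := by rw [← mul_pow, ← mul_pow]; norm_num
  have h4 : 1 ≤ 2 ^ k := Nat.one_le_two_pow
  have h5 : k * k ≤ 2 ^ k * 2 ^ k := Nat.mul_le_mul h1.le h1.le
  have h6 : k * k * k ≤ 2 ^ k * 2 ^ k * 2 ^ k := Nat.mul_le_mul h5 h1.le
  have h7 : 2 ^ (k - 1) * 2 ^ (k - 1) ≤ 2 ^ k * 2 ^ k := Nat.mul_le_mul h2 h2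
  have h9 : 2 ^ k * 1 ≤ 2 ^ k * 2 ^ k := Nat.mul_le_mul_left _ h4
  have h10 : 2 ^ k * 2 ^ k * 1 ≤ 2 ^ k * 2 ^ k * 2 ^ k := Nat.mul_le_mul_left _ h4
  rw [h8]
  generalize 2 ^ k * 2 ^ k * 2 ^ k = a at *
  refine ⟨?_, Nat.one_le_two_pow, hk, ?_, ?_, ?_, ?_, ?_, ?_, ?_⟩
  · obtain ⟨j, rfl⟩ : ∃ j, k = j + 1 := ⟨k - 1, by omega⟩
    rw [Nat.add_sub_cancel, pow_succ]; omega
  all_goals omega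

/-! ### The program for a known tuple; testing and enumerating tuples -/

namespace MP

variable {M : Finset ℕ → ℝ} {W n k D E : ℕ} {tup : ℕ → ℕ}

def initDims : MP :=
  .seq (.setI .dim (.lit 0) (.lit 1)) <|
  .seq (forI .l (.sub .k (.lit 1)) <| .setI .dim (.lit 0) (.add (.sc .dim) (.sc .dim))) <|
  .setI .ext (.lit 0) (.add (.sc .dim) (.sc .dim))

theorem initDims_spec (hd : Dims k (2 ^ (k - 1)) E W) (s : St) (hk : s.k = k) :
    Tri M W initDims 6 s fun t => St.Agree [.dim, .ext, .l] [] s t ∧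
      t.I .dim 0 = 2 ^ (k - 1) ∧ t.I .ext 0 = E := by
  have := hd.b0; have := hd.b1; have := hd.kpos
  refine .seq (.setI (by simp; omega) (.seq (.forI (m := 1) (k - 1) (fun l t =>
    St.Agree [.dim, .ext, .l] [] s t ∧ t.I .dim 0 = 2 ^ l) (by simp; omega) (by omega)
    (by simp [hk]) ⟨((St.Agree.refl s).setI (by decide) _ _).setI (by decide) _ _, by simp⟩ ?_ ?_)))
  · rintro l hl t ⟨ha, h⟩ hv
    exact .setI (by simp; omega) ⟨by simpa using hv, (ha.setI (by decide) _ _).setI (by decide) _ _,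
      by simp [h]; ring⟩
  · rintro t ⟨ha, h⟩
    exact .setI (by simp; omega) ⟨ha.setI (by decide) _ _, by simpa using h, by simp [h, hd.ext]⟩

def copyTuple : MP :=
  forI .l (.sub (.add .k .k) (.lit 1)) <| .setI .tup (.sc .l) (.inp (.sc .l))

theorem copyTuple_spec (hd : Dims k D E W) (s : St) (hk : s.k = k) :
    Tri M W copyTuple 4 s fun t => St.Agree [.tup, .l] [] s t ∧
      ∀ x < 2 * k - 1, t.I .tup x = s.inp x := by
  have := hd.b0; have := hd.b1; have := hd.kpos
  refine .forI (m := 1) (2 * k - 1) (fun l t => St.Agree [.tup, .l] [] s t ∧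
      ∀ x < l, t.I .tup x = s.inp x) (by simp; omega) (by omega)
    (by simp [hk]; omega) ⟨(St.Agree.refl s).setI (by decide) _ _, by simp⟩ ?_ (fun t h => h)
  rintro l hl t ⟨ha, h⟩ hv
  refine .setI (by simp; omega) ⟨by simpa using hv, (ha.setI (by decide) _ _).setI (by decide) _ _,
    fun x hx => ?_⟩
  simp only [IE.eval, St.setI_I, hv, reduceCtorEq, false_and, if_false, true_and, ha.inp, ha.k, hk]
  split_ifs with hxl
  · rw [hxl, min_eq_left (by omega)]
  · exact h x (by omega)

def known : MP := .seq initDims <| .seq copyTuple report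

theorem known_spec (hd : Dims k (2 ^ (k - 1)) E W) (s : St) (hk : s.k = k) (hn : 1 ≤ s.n) :
    ((known.exec M s).n = s.n ∧ (known.exec M s).k = k ∧
      ∃ tup : ℕ → ℕ, (∀ x < 2 * k - 1, tup x = s.inp x) ∧
      ∀ x < k + s.n * k, (known.exec M s).low x = lowOut M s.n k (2 ^ (k - 1)) tup x) ∧
      known.time M s ≤ s.n * W ^ 42 := by
  have hW : 1000 ≤ W := by have := hd.b0; omega
  have hexec : known.exec M s = report.exec M (copyTuple.exec M (initDims.exec M s)) := by
    rw [known, exec, exec]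
  have ht : known.time M s = initDims.time M s + (copyTuple.time M (initDims.exec M s) +
      report.time M (copyTuple.exec M (initDims.exec M s)) + 1) + 1 := by
    rw [known, time, time]
  obtain ⟨⟨h1, hD, hE⟩, ht1⟩ := initDims_spec (M := M) hd s hk hW
  generalize initDims.exec M s = s1 at *
  obtain ⟨⟨h2, htup⟩, ht2⟩ := copyTuple_spec (M := M) hd s1 (h1.k.trans hk) hW
  generalize copyTuple.exec M s1 = s2 at *
  have hn2 : s2.n = s.n := h2.n.trans h1.n
  obtain ⟨⟨h3, h4, h5⟩, ht3⟩ := report_spec (M := M) hd s2 (by omega) (h2.k.trans (h1.k.trans hk))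
    (by rw [h2.I .dim (by decide), hD]) (by rw [h2.I .ext (by decide), hE])
  rw [hn2] at h3 h5 ht3
  rw [hexec]
  refine ⟨⟨h3, h4, s2.I .tup, fun x hx => ?_, h5⟩, ?_⟩
  · rw [htup x hx, h1.inp]
  · rw [ht]
    have e1 : W ^ 6 ≤ W ^ 40 := Nat.pow_le_pow_right (by omega) (by omega)
    have e2 : W ^ 4 ≤ W ^ 40 := Nat.pow_le_pow_right (by omega) (by omega)
    have e3 : 1 ≤ W ^ 40 := Nat.one_le_pow _ _ (by omega)
    have e4 : 1000 ≤ W ^ 2 := hW.trans (Nat.le_self_pow (by omega) _)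
    have e5 : W ^ 42 = W ^ 40 * W ^ 2 := by ring
    have e6 : W ^ 40 * 1000 ≤ W ^ 42 := by rw [e5]; exact Nat.mul_le_mul_left _ e4
    have e7 : s.n * (W ^ 40 * 1000) ≤ s.n * W ^ 42 := Nat.mul_le_mul_left _ e6
    nlinarith

/-- The test of the tuple in the memory. -/
def test : MP :=
  .seq (.setI .ok (.lit 0) (.lit 1)) <|
  .seq (forI .row (.sub (.add .k .k) (.lit 1)) <| forI .col (.sc .row) <|
    .ifI (.add (.sub (.var .tup (.sc .row)) (.var .tup (.sc .col)))
      (.sub (.var .tup (.sc .col)) (.var .tup (.sc .row)))) (.lit 1)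
      (.setI .ok (.lit 0) (.lit 0)) .skip) <|
  .seq (forI .row .k <|
    .ifR (.mul (.var .piv (.sc .row)) (.var .piv (.sc .row))) (.mul (.sc .tau) (.sc .tau))
      (.setI .ok (.lit 0) (.lit 0)) .skip) <|
  forI .row (.sub .k (.lit 1)) <|
    .ifR (.var .eig (.sc .row)) (.add (.var .eig (.add (.sc .row) (.lit 1)))
      (.div (.sc .gap) (.ofInt (.lit 2)))) (.setI .ok (.lit 0) (.lit 0)) .skip

theorem test_spec (hd : Dims k D E W) (s : St) (hs : Analysed M n k D E tup s) :
    Tri M W test 13 s fun t => St.Agree [.ok, .row, .col] [] s t ∧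
      (0 < t.I .ok 0 ↔ Passes M n k D tup (s.R .gap 0) (s.R .tau 0)) := by
  have := hd.b0; have := hd.b1; have := hd.kpos
  have hsucc : ∀ (p : ℕ → Prop) (l : ℕ), (∀ x < l + 1, p x) ↔ (∀ x < l, p x) ∧ p l := by
    intro p l
    refine ⟨fun h => ⟨fun x hx => h x (by omega), h l (by omega)⟩, fun h x hx => ?_⟩
    rcases Nat.lt_succ_iff_lt_or_eq.1 hx with h' | rfl
    exacts [h.1 x h', h.2]
  refine .seq (.setI (by simp; omega) (.seq (.forI (m := 8) (2 * k - 1) (fun a t =>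
    St.Agree [.ok, .row, .col] [] s t ∧ (0 < t.I .ok 0 ↔ ∀ x < a, ∀ b < x, tup x ≠ tup b))
    (by simp; omega) (by omega) (by simp [hs.k_eq]; omega)
    ⟨((St.Agree.refl s).setI (by decide) _ _).setI (by decide) _ _, by simp⟩ ?_ ?_)))
  · rintro a hla t ⟨ha, h⟩ hv
    refine .forI (m := 6) a (fun b t => t.I .row 0 = a ∧ St.Agree [.ok, .row, .col] [] s t ∧
      (0 < t.I .ok 0 ↔ (∀ x < a, ∀ b < x, tup x ≠ tup b) ∧ ∀ x < b, tup a ≠ tup x))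
      (by simp; omega) (by omega) (by simpa using hv)
      ⟨by simpa using hv, ha.setI (by decide) _ _, by simpa using h⟩ ?_ ?_
    · rintro b hb t ⟨hrow, ha, h⟩ hv
      have hp := hs.congr ha.withLow
      refine .ifI (by simp; omega) (fun h' => .setI (by simp; omega) ⟨by simpa using hv,
        by simpa using hrow, (ha.setI (by decide) _ _).setI (by decide) _ _, ?_⟩)
        (fun h' => .skip ⟨hv, by simpa using hrow, ha.setI (by decide) _ _, ?_⟩) <;>
      simp only [IE.eval, hrow, hv, hp.tup_eq] at h' <;> rw [hsucc]
      · have : tup a = tup b := by omega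
        simp [this]
      · have : tup a ≠ tup b := by omega
        simpa [this] using h
    · rintro t ⟨hrow, ha, h⟩
      refine ⟨hrow, ha.setI (by decide) _ _, ?_⟩
      rw [hsucc]
      simpa using h
  rintro s1 ⟨ha1, h1⟩
  refine .seq (.forI (m := 7) k (fun a t => St.Agree [.ok, .row, .col] [] s t ∧
    (0 < t.I .ok 0 ↔ (∀ x < 2 * k - 1, ∀ b < x, tup x ≠ tup b) ∧
      ∀ u < a, ¬ pivotVal M n k D tup u * pivotVal M n k D tup u < s.R .tau 0 * s.R .tau 0))
    (by simp; omega) (by omega) (by simp [ha1.k, hs.k_eq])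
    ⟨ha1.setI (by decide) _ _, by simpa using h1⟩ ?_ ?_)
  · rintro a hla t ⟨ha, h⟩ hv
    have hp := hs.congr ha.withLow
    refine .ifR (by simp [hp.k_eq]; omega) (fun h' => .setI (by simp; omega) ⟨by simpa using hv,
      (ha.setI (by decide) _ _).setI (by decide) _ _, ?_⟩)
      (fun h' => .skip ⟨hv, ha.setI (by decide) _ _, ?_⟩) <;>
    simp only [RE.eval, IE.eval, hv, hp.piv a hla, ha.R .tau (by decide)] at h' <;> rw [hsucc]
    · simp [h']
    · simpa [h'] using h
  rintro s2 ⟨ha2, h2⟩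
  refine .forI (m := 7) (k - 1) (fun a t => St.Agree [.ok, .row, .col] [] s t ∧
    (0 < t.I .ok 0 ↔ ((∀ x < 2 * k - 1, ∀ b < x, tup x ≠ tup b) ∧
      ∀ u < k, ¬ pivotVal M n k D tup u * pivotVal M n k D tup u < s.R .tau 0 * s.R .tau 0) ∧
      ∀ j < a, ¬ eigVal M n k D tup j < eigVal M n k D tup (j + 1) + s.R .gap 0 / 2))
    (by simp; omega) (by omega) (by simp [ha2.k, hs.k_eq])
    ⟨ha2.setI (by decide) _ _, by simpa using h2⟩ ?_ (fun t ht => ⟨ht.1, by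
      rw [ht.2, Passes, and_assoc]⟩)
  rintro a hla t ⟨ha, h⟩ hv
  have hp := hs.congr ha.withLow
  refine .ifR (by simp [hp.k_eq]; omega) (fun h' => .setI (by simp; omega) ⟨by simpa using hv,
    (ha.setI (by decide) _ _).setI (by decide) _ _, ?_⟩)
    (fun h' => .skip ⟨hv, ha.setI (by decide) _ _, ?_⟩) <;>
  simp only [RE.eval, IE.eval, hv, hp.eig a (by omega), hp.eig (a + 1) (by omega),
    ha.R .gap (by decide), Nat.cast_ofNat] at h' <;> rw [hsucc]
  · simp only [St.setI_I, h', not_true, and_false]; simp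
  · simpa [h'] using h

/-- The next tuple in lexicographic order. -/
def nextTuple : MP :=
  .seq (.setI .carry (.lit 0) (.lit 1)) <|
  forI .l (.sub (.add .k .k) (.lit 1)) <|
    .ifI (.lit 0) (.sc .carry)
      (.ifI (.add (.var .tup (.sc .l)) (.lit 1)) .n
        (.seq (.setI .tup (.sc .l) (.add (.var .tup (.sc .l)) (.lit 1)))
          (.setI .carry (.lit 0) (.lit 0)))
        (.setI .tup (.sc .l) (.lit 0))) .skip

/-- In base n, adding 1 to r carries into digit l exactly if n^l divides r + 1. The carry goes on
exactly if that digit is n - 1. -/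
theorem digit_succ {n r l : ℕ} (hn : 1 ≤ n) (h : n ^ l ∣ r + 1) :
    (r + 1) / n ^ l % n = (r / n ^ l % n + 1) % n ∧
      (n ^ (l + 1) ∣ r + 1 ↔ ¬ r / n ^ l % n + 1 < n) := by
  have h1 : (r + 1) / n ^ l = r / n ^ l + 1 := by rw [Nat.succ_div, if_pos h]
  have h2 : (r / n ^ l + 1) % n = (r / n ^ l % n + 1) % n := by rw [Nat.mod_add_mod]
  refine ⟨by rw [h1, h2], ?_⟩
  have h3 : n ^ (l + 1) ∣ r + 1 ↔ n ∣ (r + 1) / n ^ l := by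
    rw [Nat.dvd_div_iff_mul_dvd h, pow_succ]
  rw [h3, h1, Nat.dvd_iff_mod_eq_zero, h2]
  have h4 : r / n ^ l % n < n := Nat.mod_lt _ (by omega)
  constructor
  · intro h5 h6
    rw [Nat.mod_eq_of_lt h6] at h5
    omega
  · intro h5
    rw [show r / n ^ l % n + 1 = n by omega, Nat.mod_self]

theorem nextTuple_spec (hd : Dims k D E W) (s : St) (hk : s.k = k) (hn : 1 ≤ s.n) (r : ℕ)
    (hr : ∀ t < 2 * k - 1, s.I .tup t = r / s.n ^ t % s.n) :
    Tri M W nextTuple 9 s fun t => St.Agree [.carry, .l, .tup] [] s t ∧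
      ∀ x < 2 * k - 1, t.I .tup x = (r + 1) / s.n ^ x % s.n := by
  have := hd.b0; have := hd.b1; have := hd.kpos
  refine .seq (.setI (by simp; omega) (.forI (m := 5) (2 * k - 1) (fun l t =>
    St.Agree [.carry, .l, .tup] [] s t ∧
    (∀ x < l, t.I .tup x = (r + 1) / s.n ^ x % s.n) ∧
    (∀ x < 2 * k - 1, l ≤ x → t.I .tup x = r / s.n ^ x % s.n) ∧
    (0 < t.I .carry 0 ↔ s.n ^ l ∣ r + 1))
    (by simp; omega) (by omega) (by simp [hk]; omega)
    ⟨((St.Agree.refl s).setI (by decide) _ _).setI (by decide) _ _, by simp,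
      by simpa using hr, by simp⟩ ?_ (fun t ht => ⟨ht.1, ht.2.1⟩)))
  rintro l hl t ⟨ha, h1, h2, h3⟩ hv
  have h2l := h2 l hl le_rfl
  refine .ifI (by simp; omega) (fun h => .ifI (by simp; omega)
    (fun h' => .seq (.setI (by simp; omega) (.setI (by simp; omega) ⟨by simpa using hv,
      ((ha.setI (by decide) _ _).setI (by decide) _ _).setI (by decide) _ _, ?_, ?_, ?_⟩)))
    (fun h' => .setI (by simp; omega) ⟨by simpa using hv,
      (ha.setI (by decide) _ _).setI (by decide) _ _, ?_, ?_, ?_⟩))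
    (fun h => .skip ⟨hv, ha.setI (by decide) _ _, ?_, ?_, ?_⟩)
  all_goals simp only [IE.eval, h3] at h
  on_goal 1 =>
    obtain ⟨d1, d2⟩ := digit_succ hn h
    simp only [IE.eval, hv, h2l, ha.n] at h'
    intro x hx
    simp only [IE.eval, St.setI_I, hv, reduceCtorEq, false_and, if_false, true_and, h2l]
    split_ifs with hxl
    · rw [hxl, d1, Nat.mod_eq_of_lt h']
    · exact h1 x (by omega)
  on_goal 3 =>
    obtain ⟨d1, d2⟩ := digit_succ hn h
    simp only [IE.eval, hv, h2l, ha.n] at h'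
    intro x hx
    simp only [IE.eval, St.setI_I, hv, reduceCtorEq, false_and, if_false, true_and]
    split_ifs with hxl
    · have : r / s.n ^ l % s.n < s.n := Nat.mod_lt _ (by omega)
      rw [hxl, d1, show r / s.n ^ l % s.n + 1 = s.n by omega, Nat.mod_self]
    · exact h1 x (by omega)
  on_goal 5 =>
    intro x hx
    simp only [St.setI_I, reduceCtorEq, false_and, if_false]
    rcases Nat.lt_succ_iff_lt_or_eq.1 hx with h' | rfl
    · exact h1 x h'
    · rw [h2l, Nat.succ_div, if_neg h, add_zero]
  · intro x hx hxl
    have : x ≠ l := by omega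
    simpa [hv, this] using h2 x hx (by omega)
  · obtain ⟨d1, d2⟩ := digit_succ hn h
    simp only [IE.eval, hv, h2l, ha.n] at h'
    simp [d2, h']
  · intro x hx hxl
    have : x ≠ l := by omega
    simpa [hv, this] using h2 x hx (by omega)
  · obtain ⟨d1, d2⟩ := digit_succ hn h
    simp only [IE.eval, hv, h2l, ha.n] at h'
    rw [d2]
    simp only [St.setI_I, reduceCtorEq, false_and, if_false, h3]
    exact ⟨fun _ => h', fun _ => h⟩
  · intro x hx hxl
    simpa using h2 x hx (by omega)
  · have : ¬ s.n ^ (l + 1) ∣ r + 1 := fun h' => h ((pow_dvd_pow _ (by omega)).trans h')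
    simp only [St.setI_I, reduceCtorEq, false_and, if_false, h3, h, this]

end MP

/-! ### Exhaustive search for a tuple that passes -/

namespace MP

variable {M : Finset ℕ → ℝ} {W n k D E : ℕ} {tup : ℕ → ℕ}

theorem exec_rep_and_time_le {M : Finset ℕ → ℝ} {s : St} (e : IE) (p : MP) (N T : ℕ)
    (Inv : ℕ → St → Prop) (hN : e.eval s = N) (h0 : Inv 0 s)
    (step : ∀ r < N, ∀ t, Inv r t → Inv (r + 1) (p.exec M t) ∧ p.time M t ≤ T) :
    Inv N ((rep e p).exec M s) ∧ (rep e p).time M s ≤ e.cost s + 1 + N * (T + 1) := by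
  have key : ∀ r ≤ N, Inv r ((p.exec M)^[r] s) := by
    intro r
    induction r with
    | zero => exact fun _ => h0
    | succ r ih =>
      intro hr
      rw [Function.iterate_succ_apply']
      exact (step r (by omega) _ (ih (by omega))).1
  rw [exec, time, hN]
  refine ⟨key N le_rfl, ?_⟩
  have : ∀ r ∈ Finset.range N, p.time M ((p.exec M)^[r] s) + 1 ≤ T + 1 := by
    intro r hr
    have := (step r (by simpa using hr) _ (key r (by simp at hr; omega))).2
    omega
  have := Finset.sum_le_card_nsmul _ _ _ this
  simp only [Finset.card_range, smul_eq_mul] at this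
  omega

/-- The numbers ζ and p are moved to named arrays, because each analysis overwrites the bottom of
the real memory. The threshold p (ζ/16)^(2k) arises from 2k multiplications. -/
def initSearch : MP :=
  .seq initDims <|
  .seq (.setR .gap (.lit 0) (.inp 0)) <|
  .seq (.setR .tau (.lit 0) (.inp 1)) <|
  .seq (forI .l (.add .k .k) <|
    .setR .tau (.lit 0) (.mul (.sc .tau) (.div (.sc .gap) (.ofInt (.lit 16))))) <|
  .seq (forI .l (.sub (.add .k .k) (.lit 1)) <| .setI .tup (.sc .l) (.lit 0)) <|
  .seq (.setI .found (.lit 0) (.lit 0)) <| .setI .count (.lit 0) (.lit 1)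

/-- The state of the search for a tuple that passes the test. -/
structure Ready (n k D E : ℕ) (ζ τ : ℝ) (t : St) : Prop where
  n_eq : t.n = n
  k_eq : t.k = k
  dim_eq : t.I .dim 0 = D
  ext_eq : t.I .ext 0 = E
  gap_eq : t.R .gap 0 = ζ
  tau_eq : t.R .tau 0 = τ

theorem Ready.congr {ζ τ : ℝ} {wi : List IVar} {wr : List RVar} {s t : St}
    (h : Ready n k D E ζ τ s) (ha : St.Agree wi wr (s.withLow t.low) t)
    (hi : ∀ a ∈ [IVar.dim, .ext], a ∉ wi := by decide)
    (hr : ∀ a ∈ [RVar.gap, .tau], a ∉ wr := by decide) : Ready n k D E ζ τ t where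
  n_eq := ha.n.trans h.n_eq
  k_eq := ha.k.trans h.k_eq
  dim_eq := (congrFun (ha.I .dim (hi _ (by simp))) 0).trans h.dim_eq
  ext_eq := (congrFun (ha.I .ext (hi _ (by simp))) 0).trans h.ext_eq
  gap_eq := (congrFun (ha.R .gap (hr _ (by simp))) 0).trans h.gap_eq
  tau_eq := (congrFun (ha.R .tau (hr _ (by simp))) 0).trans h.tau_eq

theorem initSearch_spec (hd : Dims k (2 ^ (k - 1)) E W) (s : St) (hk : s.k = k) :
    Tri M W initSearch 20 s fun t =>
      Ready s.n k (2 ^ (k - 1)) E (s.low 0) (s.low 1 * (s.low 0 / 16) ^ (2 * k)) t ∧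
      t.I .found 0 = 0 ∧ t.I .count 0 = 1 ∧ ∀ x < 2 * k - 1, t.I .tup x = 0 := by
  have := hd.b0; have := hd.b1; have := hd.kpos
  refine .seq (((initDims_spec hd s hk).mono (by omega)).weaken ?_)
  rintro s1 ⟨h1, hD, hE⟩
  have hk1 : s1.k = k := h1.k.trans hk
  refine .seq (.setR (by simp [hk1]; omega) (.seq (.setR (by simp [hk1]; omega) ?_)))
  refine .seq (.forI (m := 13) (2 * k) (fun l t => Ready s.n k (2 ^ (k - 1)) E (s.low 0)
    (s.low 1 * (s.low 0 / 16) ^ l) t) (by simp; omega) (by omega) (by simp [hk1]; omega)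
    ⟨h1.n, hk1, by simpa using hD, by simpa using hE, by simp [h1.low], by simp [h1.low]⟩ ?_ ?_)
  · rintro l hl t h hv
    refine .setR (by simp [h.k_eq]; omega) ⟨by simpa using hv, h.n_eq, h.k_eq, by simpa using h.dim_eq,
      by simpa using h.ext_eq, by simpa using h.gap_eq, ?_⟩
    simp only [RE.eval, IE.eval, St.setI_R, St.setR_R, true_and, if_true, h.tau_eq, h.gap_eq, pow_succ]
    push_cast
    ring
  intro s2 h2
  refine .seq (.forI (m := 12) (2 * k - 1) (fun l t => St.Agree [.l, .tup] [] s2 t ∧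
    ∀ x < l, t.I .tup x = 0) (by simp; omega) (by omega) (by simp [h2.k_eq]; omega)
    ⟨(St.Agree.refl s2).setI (by decide) _ _, by simp⟩ ?_ ?_)
  · rintro l hl t ⟨ha, h⟩ hv
    refine .setI (by simp; omega) ⟨by simpa using hv,
      (ha.setI (by decide) _ _).setI (by decide) _ _, fun x hx => ?_⟩
    simp only [IE.eval, St.setI_I, hv, reduceCtorEq, false_and, if_false, true_and]
    split_ifs with hxl
    · rfl
    · exact h x (by omega)
  rintro s3 ⟨h3, h4⟩
  exact .seq (.setI (by simp; omega) (.setI (by simp; omega)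
    ⟨h2.congr ((h3.mono (wi' := [.l, .tup, .found, .count]) (wr' := []) (by decide)
      (by decide)).setI (by decide) _ _ |>.setI (by decide) _ _).withLow, by simp, by simp, by simpa using h4⟩))

/-- Loops cannot be left early, so after a success the remaining rounds do nothing and the accepted
tuple stays in place. -/
def searchStep : MP :=
  .ifI (.sc .found) (.lit 1)
    (.seq analyse <| .seq test <|
      .ifI (.lit 0) (.sc .ok) (.setI .found (.lit 0) (.lit 1)) nextTuple) .skip

/-- After `r` rounds: either a tuple has passed the test, or the first `r` tuples have failed. -/
def SearchInv (M : Finset ℕ → ℝ) (n k D E : ℕ) (ζ τ : ℝ) (r : ℕ) (t : St) : Prop :=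
  Ready n k D E ζ τ t ∧
    ((0 < t.I .found 0 ∧ Passes M n k D (t.I .tup) ζ τ ∧ ∀ x < 2 * k - 1, t.I .tup x < n) ∨
      (t.I .found 0 = 0 ∧ (∀ x < 2 * k - 1, t.I .tup x = r / n ^ x % n) ∧
        ∀ r' < r, ∃ tup, (∀ x < 2 * k - 1, tup x = r' / n ^ x % n) ∧ ¬ Passes M n k D tup ζ τ))

theorem searchStep_spec (hd : Dims k D E W) {ζ τ : ℝ} (hn : 1 ≤ n) (r : ℕ) (s : St)
    (hs : SearchInv M n k D E ζ τ r s) :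
    Tri M W searchStep 31 s (SearchInv M n k D E ζ τ (r + 1)) := by
  have := hd.b0; have := hd.b1; have := hd.kpos
  obtain ⟨hr, hs⟩ := hs
  refine .ifI (by simp; omega) (fun h => ?_) (fun h => .skip ⟨hr, ?_⟩)
  · simp only [IE.eval] at h
    rcases hs with hs | ⟨h1, h2, h3⟩
    · omega
    refine .seq (((analyse_spec hd s hr.k_eq hr.dim_eq hr.ext_eq).mono (by omega)).weaken ?_)
    rintro s1 ⟨ha1, hs1⟩
    rw [hr.n_eq] at hs1
    have hr1 := hr.congr ha1
    refine .seq (((test_spec hd s1 hs1).mono (by omega)).weaken ?_)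
    rintro s2 ⟨ha2, hok⟩
    have hr2 := hr1.congr ha2.withLow
    rw [hr1.gap_eq, hr1.tau_eq] at hok
    have htup2 : s2.I .tup = s.I .tup := by rw [ha2.I .tup (by decide), hs1.tup_eq]
    refine .ifI (by simp; omega) (fun h => .setI (by simp; omega) ⟨hr2.congr
      (((St.Agree.refl s2).setI (wi := [.found]) (wr := []) (by decide) _ _).withLow),
      Or.inl ⟨by simp, ?_, ?_⟩⟩)
      (fun h => ((nextTuple_spec hd s2 hr2.k_eq (by rw [hr2.n_eq]; exact hn) r
        (by rw [htup2, hr2.n_eq]; exact h2)).mono (by omega)).weaken ?_)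
    · simp only [IE.eval, hok] at h
      rw [St.setI_I_of_ne _ (by decide), htup2]
      exact h
    · intro x hx
      rw [St.setI_I_of_ne _ (by decide), htup2, h2 x hx]
      exact Nat.mod_lt _ (by omega)
    · rintro s3 ⟨ha3, hd3⟩
      simp only [IE.eval, hok] at h
      refine ⟨hr2.congr ha3.withLow, Or.inr ⟨?_, by rw [← hr2.n_eq]; exact hd3, ?_⟩⟩
      · rw [ha3.I .found (by decide), ha2.I .found (by decide), ha1.I .found (by decide)]
        exact h1
      · intro r' hr'
        rcases Nat.lt_succ_iff_lt_or_eq.1 hr' with h' | rfl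
        · exact h3 r' h'
        · exact ⟨_, h2, h⟩
  · simp only [IE.eval] at h
    rcases hs with hs | ⟨h1, -, -⟩
    · exact Or.inl hs
    · omega

/-- The powers of n and W are replaced by variables, so that after a few explicit products the
inequality is linear. -/
theorem search_time_aux {t1 t2 t3 t4 W n k a b c c2 c3 w : ℕ} (hn : 1 ≤ n)
    (hkW : 2 * k ≤ W) (h1 : t1 ≤ c2) (h2 : t2 ≤ 200 + (2 * k - 1) * (n + 400))
    (h3 : t3 ≤ 200 + a * (c3 + 1)) (h4 : t4 ≤ n * c) (hW : 1000 ≤ W)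
    (e1 : n ≤ b) (e2 : a ≤ b) (e3 : c2 ≤ c) (e4 : c3 ≤ c) (e5 : W ≤ c) (e6 : c * 1000000 ≤ w) :
    t1 + (t2 + (t3 + t4 + 1) + 1) + 1 ≤ b * w := by
  have f1 : n * c ≤ b * c := Nat.mul_le_mul_right c e1
  have f2 : a * (c3 + 1) ≤ b * (2 * c) := Nat.mul_le_mul e2 (by omega)
  have f3 : (2 * k - 1) * (n + 400) ≤ c * (b * 401) := Nat.mul_le_mul (by omega) (by omega)
  have f5 : 1 * c ≤ b * c := Nat.mul_le_mul_right c (by omega)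
  have f6 : b * (c * 1000000) ≤ b * w := Nat.mul_le_mul_left b e6
  have f7 : b * (c * 1000000) = (b * c) * 1000000 := by ring
  have f8 : b * (2 * c) = (b * c) * 2 := by ring
  have f9 : c * (b * 401) = (b * c) * 401 := by ring
  omega

theorem search_time_le {t1 t2 t3 t4 W n k : ℕ} (hW : 1000 ≤ W) (hn : 1 ≤ n) (hk : 1 ≤ k)
    (hkW : 2 * k ≤ W) (h1 : t1 ≤ W ^ 20) (h2 : t2 ≤ 200 + (2 * k - 1) * (n + 400))
    (h3 : t3 ≤ 200 + n ^ (2 * k - 1) * (W ^ 31 + 1)) (h4 : t4 ≤ n * W ^ 40) :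
    t1 + (t2 + (t3 + t4 + 1) + 1) + 1 ≤ n ^ (2 * k) * W ^ 44 := by
  have hW0 : 0 < W := by omega
  refine search_time_aux hn hkW h1 h2 h3 h4 hW (Nat.le_self_pow (by omega) n)
    (Nat.pow_le_pow_right hn (by omega)) (Nat.pow_le_pow_right hW0 (by norm_num))
    (Nat.pow_le_pow_right hW0 (by norm_num)) (Nat.le_self_pow (by norm_num) W) ?_
  calc W ^ 40 * 1000000 = W ^ 40 * 1000 ^ 2 := by norm_num
    _ ≤ W ^ 40 * W ^ 4 := Nat.mul_le_mul_left _
        ((Nat.pow_le_pow_left hW 2).trans (Nat.pow_le_pow_right hW0 (by norm_num)))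
    _ = W ^ 44 := (pow_add W 40 4).symm

/-- The number of rounds n^(2k-1) is formed by multiplications with n as the second factor. Their
total cost of order k n is harmless. -/
def unknown : MP :=
  .seq initSearch <|
  .seq (forI .l (.sub (.add .k .k) (.lit 1)) <| .setI .count (.lit 0) (.mul (.sc .count) .n)) <|
  .seq (.rep (.sc .count) searchStep) report

theorem unknown_spec (hd : Dims k (2 ^ (k - 1)) E W) (s : St) (hk : s.k = k) (hn : 1 ≤ s.n) :
    ((unknown.exec M s).n = s.n ∧ (unknown.exec M s).k = k ∧ ∃ tup : ℕ → ℕ,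
      (∀ x < k + s.n * k, (unknown.exec M s).low x = lowOut M s.n k (2 ^ (k - 1)) tup x) ∧
      ((Passes M s.n k (2 ^ (k - 1)) tup (s.low 0) (s.low 1 * (s.low 0 / 16) ^ (2 * k)) ∧
          ∀ x < 2 * k - 1, tup x < s.n) ∨
        ∀ r < s.n ^ (2 * k - 1), ∃ tup, (∀ x < 2 * k - 1, tup x = r / s.n ^ x % s.n) ∧
          ¬ Passes M s.n k (2 ^ (k - 1)) tup (s.low 0) (s.low 1 * (s.low 0 / 16) ^ (2 * k)))) ∧
      unknown.time M s ≤ s.n ^ (2 * k) * W ^ 44 := by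
  have hb := hd.b0; have hb1 := hd.b1; have hkpos := hd.kpos
  have hW : 1000 ≤ W := by omega
  set cnt : MP := forI .l (.sub (.add .k .k) (.lit 1)) (.setI .count (.lit 0) (.mul (.sc .count) .n))
    with hcnt
  have hexec : unknown.exec M s = report.exec M ((rep (.sc .count) searchStep).exec M
      (cnt.exec M (initSearch.exec M s))) := by
    rw [unknown, exec, exec, exec, hcnt]
  have ht : unknown.time M s = initSearch.time M s + (cnt.time M (initSearch.exec M s) +
      ((rep (.sc .count) searchStep).time M (cnt.exec M (initSearch.exec M s)) +
      report.time M ((rep (.sc .count) searchStep).exec M (cnt.exec M (initSearch.exec M s))) + 1) + 1)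
      + 1 := by
    rw [unknown, time, time, time, hcnt]
  rw [hexec, ht]
  obtain ⟨⟨h1, hf1, hc1, htup1⟩, ht1⟩ := initSearch_spec (M := M) hd s hk hW
  generalize s.low 1 * (s.low 0 / 16) ^ (2 * k) = τ at *
  generalize initSearch.exec M s = s1 at *
  obtain ⟨⟨h2, hc2⟩, ht2⟩ := exec_forI_and_time_le (M := M) (s := s1) .l (.sub (.add .k .k) (.lit 1))
    (.setI .count (.lit 0) (.mul (.sc .count) .n)) (2 * k - 1) (s.n + 200)
    (fun l t => St.Agree [.l, .count] [] s1 t ∧ t.I .count 0 = s.n ^ l)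
    (by simp [h1.k_eq]; omega) ⟨(St.Agree.refl s1).setI (by decide) _ _, by simpa using hc1⟩ (by
      rintro l hl t ⟨ha, h⟩ hv
      have hn' : t.n = s.n := ha.n.trans h1.n_eq
      refine ⟨⟨by simpa [exec] using hv, ?_, by simp [exec, h, hn', pow_succ]⟩, ?_⟩
      · rw [exec]
        exact (ha.setI (by decide) _ _).setI (by decide) _ _
      · simp [time, hn']; omega)
  rw [← hcnt] at h2 hc2 ht2
  generalize cnt.exec M s1 = s2 at *
  obtain ⟨⟨h3, hs3⟩, ht3⟩ := exec_rep_and_time_le (M := M) (s := s2) (.sc .count) searchStep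
    (s.n ^ (2 * k - 1)) (W ^ 31) (SearchInv M s.n k (2 ^ (k - 1)) E (s.low 0) τ) (by simpa using hc2)
    ⟨h1.congr h2.withLow, Or.inr ⟨by rw [h2.I .found (by decide), hf1], by
      intro x hx
      rw [h2.I .tup (by decide), htup1 x hx, Nat.zero_div, Nat.zero_mod], by simp⟩⟩
    (fun r _ t ht => searchStep_spec hd hn r t ht hW)
  generalize (rep (.sc .count) searchStep).exec M s2 = s3 at *
  obtain ⟨⟨h4, h5, h6⟩, ht4⟩ := report_spec (M := M) hd s3 (by rw [h3.n_eq]; exact hn) h3.k_eq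
    h3.dim_eq h3.ext_eq
  rw [h3.n_eq] at h4 h6 ht4
  refine ⟨⟨h4, h5, s3.I .tup, h6, ?_⟩, ?_⟩
  · rcases hs3 with hs3 | hs3
    · exact Or.inl hs3.2
    · exact Or.inr hs3.2.2
  · have h2k : 2 * k ≤ W := by omega
    have hk2 : 1 ≤ k := by omega
    simp only [IE.cost] at ht2 ht3
    have h400 : s.n + 200 + 200 = s.n + 400 := rfl
    rw [h400] at ht2
    exact search_time_le hW hn hk2 h2k ht1 (ht2.trans (by omega)) (ht3.trans (by omega)) ht4

end MP

/-! ### Back to the random access machine: running times and outputs -/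

theorem RamState.real_eq_low (σ : RamState) {n k x : ℕ} (hn : σ.toSt.n = n) (hk : σ.toSt.k = k)
    (hx : x < k + n * k) : σ.real x = σ.toSt.low x := by
  have hn : σ.int 0 = n := hn
  have hk : σ.int 1 = k := hk
  simp only [RamState.toSt, RamState.realBase, hn, hk]
  rw [if_pos (by omega)]

theorem exp_log_natCast_mul (a k : ℕ) (ha : 0 < a) :
    Real.exp (Real.log (a : ℝ) * k) = ((a ^ k : ℕ) : ℝ) := by
  rw [mul_comm, Real.exp_nat_mul, Real.exp_log (by exact_mod_cast ha), Nat.cast_pow]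

theorem exists_program_known : ∃ (P : RamProg) (K : ℝ),
    ∀ (n k : ℕ) (ζ p ε : ℝ) (A : Fin (2 * k - 1) → Fin n) (M : Finset ℕ → ℝ),
      1 ≤ k → 2 * k - 1 ≤ n →
      (P.time M (inputKnown n k ζ p ε A) : ℝ) ≤ n * Real.exp (K * k) ∧
      ∃ tup : ℕ → ℕ, (∀ t : Fin (2 * k - 1), tup t = A t) ∧ ∀ x < k + n * k,
        (P.exec M (inputKnown n k ζ p ε A)).real x = lowOut M n k (2 ^ (k - 1)) tup x := by
  -- For k ≥ 1, (100000·8^k)^42 ≤ (800000^42)^k, which gives this constant K.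
  refine ⟨MP.known.comp, Real.log ((800000 ^ 42 : ℕ) : ℝ), fun n k ζ p ε A M hk hn => ?_⟩
  have hd := dims_of_le k hk
  obtain ⟨⟨h1, h2, tup, h3, h4⟩, h5⟩ := MP.known_spec (M := M) hd (inputKnown n k ζ p ε A).toSt rfl
    (show 1 ≤ n by omega)
  rw [← MP.toSt_exec_comp] at h1 h2 h4
  refine ⟨?_, tup, fun t => ?_, fun x hx => ?_⟩
  · have h6 : MP.known.comp.time M (inputKnown n k ζ p ε A) ≤ n * (100000 * 8 ^ k) ^ 42 :=
      (MP.time_comp_le M _ _).trans h5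
    have h7 : (100000 * 8 ^ k) ^ 42 ≤ (800000 ^ 42) ^ k := by
      rw [← pow_mul, mul_comm 42, pow_mul]
      refine Nat.pow_le_pow_left ?_ _
      calc 100000 * 8 ^ k ≤ 100000 ^ k * 8 ^ k :=
            Nat.mul_le_mul_right _ (Nat.le_self_pow (by omega) _)
        _ = 800000 ^ k := by rw [← mul_pow]; norm_num
    rw [exp_log_natCast_mul _ _ (by positivity)]
    exact_mod_cast h6.trans (Nat.mul_le_mul_left _ h7)
  · have ht := t.2
    rw [h3 t ht]
    have : (t : ℕ) ≤ 2 * (inputKnown n k ζ p ε A).int 1 := by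
      show (t : ℕ) ≤ 2 * k
      omega
    simp only [RamState.toSt, this, if_true]
    rw [add_comm]
    simp [inputKnown]
  · rw [RamState.real_eq_low _ h1 h2 hx]
    exact h4 x hx

theorem exists_program_unknown : ∃ (P : RamProg) (K : ℝ),
    ∀ (n k : ℕ) (ζ p ε : ℝ) (M : Finset ℕ → ℝ), 1 ≤ k → 2 * k - 1 ≤ n →
      (P.time M (inputUnknown n k ζ p ε) : ℝ) ≤ (n : ℝ) ^ (2 * k) * Real.exp (K * k) ∧
      ∃ tup : ℕ → ℕ, (∀ x < k + n * k,
        (P.exec M (inputUnknown n k ζ p ε)).real x = lowOut M n k (2 ^ (k - 1)) tup x) ∧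
      ((Passes M n k (2 ^ (k - 1)) tup ζ (p * (ζ / 16) ^ (2 * k)) ∧ ∀ x < 2 * k - 1, tup x < n) ∨
        ∀ A : Fin (2 * k - 1) → Fin n, ∃ tup : ℕ → ℕ, (∀ t : Fin (2 * k - 1), tup t = A t) ∧
          ¬ Passes M n k (2 ^ (k - 1)) tup ζ (p * (ζ / 16) ^ (2 * k))) := by
  refine ⟨MP.unknown.comp, Real.log ((800000 ^ 44 : ℕ) : ℝ), fun n k ζ p ε M hk hn => ?_⟩
  have hd := dims_of_le k hk
  obtain ⟨⟨h1, h2, tup, h3, h4⟩, h5⟩ := MP.unknown_spec (M := M) hd (inputUnknown n k ζ p ε).toSt rfl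
    (show 1 ≤ n by omega)
  rw [← MP.toSt_exec_comp] at h1 h2 h3
  have hlow0 : (inputUnknown n k ζ p ε).toSt.low 0 = ζ := by
    simp [RamState.toSt, RamState.realBase, inputUnknown, inputReal]
  have hlow1 : (inputUnknown n k ζ p ε).toSt.low 1 = p := by
    simp [RamState.toSt, RamState.realBase, inputUnknown, inputReal]
  rw [hlow0, hlow1] at h4
  refine ⟨?_, tup, fun x hx => ?_, h4.imp id fun h A => ?_⟩
  · have h6 : MP.unknown.comp.time M (inputUnknown n k ζ p ε) ≤ n ^ (2 * k) * (100000 * 8 ^ k) ^ 44 :=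
      (MP.time_comp_le M _ _).trans h5
    have h7 : (100000 * 8 ^ k) ^ 44 ≤ (800000 ^ 44) ^ k := by
      rw [← pow_mul, mul_comm 44, pow_mul]
      refine Nat.pow_le_pow_left ?_ _
      calc 100000 * 8 ^ k ≤ 100000 ^ k * 8 ^ k :=
            Nat.mul_le_mul_right _ (Nat.le_self_pow (by omega) _)
        _ = 800000 ^ k := by rw [← mul_pow]; norm_num
    rw [exp_log_natCast_mul _ _ (by positivity)]
    exact_mod_cast h6.trans (Nat.mul_le_mul_left _ h7)
  · rw [RamState.real_eq_low _ h1 h2 hx]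
    exact h3 x hx
  -- The number whose base n digits are the members of `A` is one of the rounds of the search.
  · obtain ⟨tup, ht, hp⟩ := h (finFunctionFinEquiv A) (finFunctionFinEquiv A).2
    refine ⟨tup, fun t => ?_, hp⟩
    rw [ht t t.2]
    have : (A t : ℕ) = (finFunctionFinEquiv.symm (finFunctionFinEquiv A) t : Fin n) := by
      rw [Equiv.symm_apply_apply]
    rw [this]
    rfl

/-! ### Complete pivoting: biorthogonality and growth -/

theorem sq_le_argmaxSq (f : ℕ → ℕ → ℝ) (D e : ℕ) : ∀ e' < e, e' / (D + D) < D → e' % (D + D) < D →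
    f (e' / (D + D)) (e' % (D + D)) * f (e' / (D + D)) (e' % (D + D)) ≤
      f (argmaxSq f D e / (D + D)) (argmaxSq f D e % (D + D)) *
        f (argmaxSq f D e / (D + D)) (argmaxSq f D e % (D + D)) := by
  induction e with
  | zero => intro e' h; omega
  | succ e ih =>
    intro e' he' h1 h2
    rw [argmaxSq]
    split_ifs with h
    · rcases Nat.lt_succ_iff_lt_or_eq.1 he' with h3 | rfl
      · exact (ih e' h3 h1 h2).trans h.2.2.le
      · exact le_rfl
    · rcases Nat.lt_succ_iff_lt_or_eq.1 he' with h3 | rfl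
      · exact ih e' h3 h1 h2
      · push Not at h
        exact h h1 h2

theorem abs_le_abs_pivot (f : ℕ → ℕ → ℝ) {D r c : ℕ} (hr : r < D) (hc : c < D) :
    |f r c| ≤ |f (pivotRow f D) (pivotCol f D)| := by
  have h := sq_le_argmaxSq f D ((D + D) * (D + D)) (r * (D + D) + c)
    (MP.index_lt (by omega) (by omega))
  rw [MP.index_div (by omega), MP.index_mod (by omega)] at h
  exact sq_le_sq.1 (by simpa [pivotRow, pivotCol, sq] using h hr hc)

/-- Gaussian elimination on a `D × D` block with pivots `(p t, q t)`; the blocks to the right and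
below start as identity matrices and record the row and the column operations. -/
structure IsElimination (D : ℕ) (f : ℕ → ℕ → ℕ → ℝ) (p q : ℕ → ℕ) : Prop where
  step : ∀ t r c, f (t + 1) r c = f t r c - f t r (q t) * f t (p t) c / f t (p t) (q t)
  row_lt : ∀ t, p t < D
  col_lt : ∀ t, q t < D
  right : ∀ r < D, ∀ e < D, f 0 r (D + e) = if e = r then 1 else 0
  below : ∀ c < D, ∀ e < D, f 0 (D + e) c = if e = c then 1 else 0

namespace IsElimination

variable {D : ℕ} {f : ℕ → ℕ → ℕ → ℝ} {p q : ℕ → ℕ}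

theorem transpose (h : IsElimination D f p q) : IsElimination D (fun t r c => f t c r) q p where
  step t r c := by rw [h.step]; ring
  row_lt := h.col_lt
  col_lt := h.row_lt
  right := h.below
  below := h.right

/-- A step is the same row operation on the block and on the right border. So the border U_t
satisfies U_t f_0 = f_t. Symmetrically f_0 V_t = f_t for the lower border V_t. -/
theorem sum_right_mul (h : IsElimination D f p q) (t : ℕ) : ∀ r < D, ∀ c < D,
    ∑ e ∈ Finset.range D, f t r (D + e) * f 0 e c = f t r c := by
  induction t with
  | zero =>
    intro r hr c hc
    rw [Finset.sum_eq_single_of_mem r (by simpa using hr)]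
    · simp [h.right r hr r hr]
    · intro e he hne
      simp [h.right r hr e (by simpa using he), hne]
  | succ t ih =>
    intro r hr c hc
    rw [h.step t r c, ← ih r hr c hc, ← ih (p t) (h.row_lt t) c hc, Finset.mul_sum, Finset.sum_div,
      ← Finset.sum_sub_distrib]
    refine Finset.sum_congr rfl fun e _ => ?_
    rw [h.step t r (D + e)]
    ring

theorem sum_mul_below (h : IsElimination D f p q) (t : ℕ) : ∀ r < D, ∀ c < D,
    ∑ e ∈ Finset.range D, f 0 r e * f t (D + e) c = f t r c := by
  intro r hr c hc
  rw [← h.transpose.sum_right_mul t c hc r hr]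
  exact Finset.sum_congr rfl fun e _ => mul_comm _ _

theorem pivot_row_eq_zero (h : IsElimination D f p q) {t : ℕ} (hd : f t (p t) (q t) ≠ 0) (c : ℕ) :
    f (t + 1) (p t) c = 0 := by
  rw [h.step, mul_div_assoc, mul_div_cancel₀ _ hd, sub_self]

theorem sum_mul_below_succ (f0 : ℕ → ℝ) (h : IsElimination D f p q) (t c : ℕ) :
    ∑ e ∈ Finset.range D, f0 e * f (t + 1) (D + e) c =
      ∑ e ∈ Finset.range D, f0 e * f t (D + e) c -
        (∑ e ∈ Finset.range D, f0 e * f t (D + e) (q t)) * f t (p t) c / f t (p t) (q t) := by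
  rw [Finset.sum_mul, Finset.sum_div, ← Finset.sum_sub_distrib]
  refine Finset.sum_congr rfl fun e _ => ?_
  rw [h.step]
  ring

/-- That is, f_t V_t = f_t. The column step turns f_t V_t into f_t V_(t+1) = f_(t+1). Passing from
f_t to f_(t+1) on the left subtracts a multiple of the pivot row, and the product of that row with
V_(t+1) is the pivot row of f_(t+1), which is zero. -/
theorem sum_stage_mul_below (h : IsElimination D f p q) (t : ℕ)
    (hd : ∀ s < t, f s (p s) (q s) ≠ 0) : ∀ r < D, ∀ c < D,
    ∑ e ∈ Finset.range D, f t r e * f t (D + e) c = f t r c := by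
  induction t with
  | zero => exact h.sum_mul_below 0
  | succ t ih =>
    intro r hr c hc
    have ih := ih fun s hs => hd s (by omega)
    have key : ∀ r < D, ∑ e ∈ Finset.range D, f t r e * f (t + 1) (D + e) c = f (t + 1) r c := by
      intro r hr
      rw [h.sum_mul_below_succ, ih r hr c hc, ih r hr _ (h.col_lt t), h.step t r c]
    have : ∀ e, f (t + 1) r e * f (t + 1) (D + e) c = f t r e * f (t + 1) (D + e) c -
        f t r (q t) / f t (p t) (q t) * (f t (p t) e * f (t + 1) (D + e) c) := by
      intro e
      rw [h.step t r e]
      ring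
    rw [Finset.sum_congr rfl fun e _ => this e, Finset.sum_sub_distrib, ← Finset.mul_sum, key r hr,
      key _ (h.row_lt t), h.pivot_row_eq_zero (hd t (by omega)), mul_zero, sub_zero]

/-- The pivot row of step s is annihilated by V_(s+1), because it vanishes in the next stage. Later
steps only combine columns of V and preserve this. -/
theorem sum_pivot_row_mul_below (h : IsElimination D f p q) {s t : ℕ} (hst : s < t)
    (hd : ∀ s < t, f s (p s) (q s) ≠ 0) : ∀ c < D,
    ∑ e ∈ Finset.range D, f s (p s) e * f t (D + e) c = 0 := by
  induction t, hst using Nat.le_induction with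
  | base =>
    intro c hc
    have h1 := h.sum_stage_mul_below s (fun r hr => hd r (by omega)) _ (h.row_lt s)
    rw [h.sum_mul_below_succ, h1 c hc, h1 _ (h.col_lt s), mul_div_assoc,
      mul_div_cancel₀ _ (hd s (by omega)), sub_self]
  | succ t hst ih =>
    intro c hc
    have ih := ih fun r hr => hd r (by omega)
    rw [h.sum_mul_below_succ, ih c hc, ih _ (h.col_lt t)]
    simp

theorem sum_sum_of_le (h : IsElimination D f p q) {s t : ℕ} (hst : s ≤ t)
    (hd : ∀ r < t, f r (p r) (q r) ≠ 0) :
    ∑ a ∈ Finset.range D, ∑ b ∈ Finset.range D,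
      f s (p s) (D + a) * f 0 a b * f t (D + b) (q t) = if s = t then f t (p t) (q t) else 0 := by
  rw [Finset.sum_comm]
  have : ∀ b ∈ Finset.range D, ∑ a ∈ Finset.range D,
      f s (p s) (D + a) * f 0 a b * f t (D + b) (q t) = f s (p s) b * f t (D + b) (q t) := by
    intro b hb
    rw [← Finset.sum_mul, h.sum_right_mul s _ (h.row_lt s) b (by simpa using hb)]
  rw [Finset.sum_congr rfl this]
  split_ifs with hs
  · subst hs
    exact h.sum_stage_mul_below s hd _ (h.row_lt s) _ (h.col_lt s)
  · exact h.sum_pivot_row_mul_below (by omega) hd _ (h.col_lt t)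

/-- The recorded row and column combinations are biorthogonal. -/
theorem sum_sum (h : IsElimination D f p q) {k s t : ℕ} (hs : s < k) (ht : t < k)
    (hd : ∀ r < k, f r (p r) (q r) ≠ 0) :
    ∑ a ∈ Finset.range D, ∑ b ∈ Finset.range D,
      f s (p s) (D + a) * f 0 a b * f t (D + b) (q t) = if s = t then f t (p t) (q t) else 0 := by
  rcases le_total s t with hst | hst
  · exact h.sum_sum_of_le hst fun r hr => hd r (by omega)
  · have := h.transpose.sum_sum_of_le hst fun r hr => hd r (by omega)
    rw [Finset.sum_comm]
    rw [Finset.sum_congr rfl fun a _ => Finset.sum_congr rfl fun b _ =>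
      show _ = f t (D + a) (q t) * f 0 b a * f s (p s) (D + b) by ring]
    refine this.trans ?_
    split_ifs with h1 h2 h2
    · rw [h1]
    · exact absurd h1.symm h2
    · exact absurd h2.symm h1
    · rfl

/-- With complete pivoting, the multiple of the pivot row that is subtracted has a factor of
absolute value at most 1. So the ℓ¹ norm of the recorded combinations at most doubles in each step.
-/
theorem sum_abs_right_le (h : IsElimination D f p q) (t : ℕ)
    (hmax : ∀ s < t, ∀ r < D, ∀ c < D, |f s r c| ≤ |f s (p s) (q s)|) : ∀ r < D,
    ∑ e ∈ Finset.range D, |f t r (D + e)| ≤ 2 ^ t := by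
  induction t with
  | zero =>
    intro r hr
    rw [Finset.sum_eq_single_of_mem r (by simpa using hr)]
    · simp [h.right r hr r hr]
    · intro e he hne
      simp [h.right r hr e (by simpa using he), hne]
  | succ t ih =>
    intro r hr
    have ih := ih fun s hs => hmax s (by omega)
    calc ∑ e ∈ Finset.range D, |f (t + 1) r (D + e)|
        ≤ ∑ e ∈ Finset.range D, (|f t r (D + e)| + |f t (p t) (D + e)|) := by
          refine Finset.sum_le_sum fun e _ => ?_
          rw [h.step]
          refine (abs_sub _ _).trans (add_le_add le_rfl ?_)
          rw [abs_div, abs_mul, mul_comm, mul_div_assoc]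
          exact mul_le_of_le_one_right (abs_nonneg _)
            (div_le_one_of_le₀ (hmax t (by omega) r hr _ (h.col_lt t)) (abs_nonneg _))
      _ ≤ 2 ^ t + 2 ^ t := by
          rw [Finset.sum_add_distrib]
          exact add_le_add (ih r hr) (ih _ (h.row_lt t))
      _ = 2 ^ (t + 1) := by ring

theorem eq_sub_sum (h : IsElimination D f p q) (t r c : ℕ) :
    f t r c = f 0 r c -
      ∑ s ∈ Finset.range t, f s r (q s) * f s (p s) c / f s (p s) (q s) := by
  induction t with
  | zero => simp
  | succ t ih => rw [h.step, ih, Finset.sum_range_succ]; ring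

end IsElimination

theorem eliminate_isElimination {f : ℕ → ℕ → ℝ} {D : ℕ} (hD : 1 ≤ D)
    (hr : ∀ r < D, ∀ e < D, f r (D + e) = if e = r then 1 else 0)
    (hb : ∀ c < D, ∀ e < D, f (D + e) c = if e = c then 1 else 0) :
    IsElimination D (eliminate f D) (fun t => pivotRow (eliminate f D t) D)
      (fun t => pivotCol (eliminate f D t) D) where
  step t r c := by rw [eliminate]
  row_lt t := (MP.argmaxSq_lt _ hD _).1
  col_lt t := (MP.argmaxSq_lt _ hD _).2.1
  right := hr
  below := hb

section stage

variable {M : Finset ℕ → ℝ} {n k D : ℕ} {tup : ℕ → ℕ}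

theorem stage_isElimination (M : Finset ℕ → ℝ) (n k : ℕ) (tup : ℕ → ℕ) (hD : 1 ≤ D) :
    IsElimination D (stage M n k D tup) (fun t => pivotRow (stage M n k D tup t) D)
      (fun t => pivotCol (stage M n k D tup t) D) := by
  refine eliminate_isElimination hD (fun r hr e he => ?_) (fun c hc e he => ?_)
  · rw [bordered, if_neg (by omega)]
    exact if_congr (by omega) rfl rfl
  · rw [bordered, if_neg (by omega)]
    exact if_congr (by omega) rfl rfl

theorem stage_zero {r c : ℕ} (hr : r < D) (hc : c < D) :
    stage M n k D tup 0 r c = M (momentSet n k tup (r + D * c) n) := by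
  rw [stage, eliminate, bordered, if_pos ⟨hr, hc⟩]

theorem abs_stage_le (t : ℕ) {r c : ℕ} (hr : r < D) (hc : c < D) :
    |stage M n k D tup t r c| ≤ |pivotVal M n k D tup t| :=
  abs_le_abs_pivot _ hr hc

theorem sum_abs_rowVec_le (hD : 1 ≤ D) (s : ℕ) (hs : s ≤ k) :
    ∑ a ∈ Finset.range D, |rowVec M n k D tup s a| ≤ 2 ^ k := by
  have h := stage_isElimination (D := D) M n k tup hD
  rcases hs.lt_or_eq with hs' | rfl
  · simp only [rowVec, if_pos hs']
    exact (h.sum_abs_right_le s (fun t _ r hr c hc => abs_stage_le t hr hc) _ (h.row_lt s)).trans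
      (pow_le_pow_right₀ one_le_two hs)
  · simp only [rowVec, lt_irrefl, if_false]
    rw [Finset.sum_eq_single_of_mem 0 (by simp; omega) (by intro b _ hb; simp [hb])]
    simpa using one_le_pow₀ one_le_two

theorem sum_abs_colVec_le (hD : 1 ≤ D) (s : ℕ) (hs : s ≤ k) :
    ∑ a ∈ Finset.range D, |colVec M n k D tup s a| ≤ 2 ^ k := by
  have h := (stage_isElimination (D := D) M n k tup hD).transpose
  rcases hs.lt_or_eq with hs' | rfl
  · simp only [colVec, if_pos hs']
    exact (h.sum_abs_right_le s (fun t _ r hr c hc => abs_stage_le t hc hr) _ (h.row_lt s)).trans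
      (pow_le_pow_right₀ one_le_two hs)
  · simp only [colVec, lt_irrefl, if_false]
    rw [Finset.sum_eq_single_of_mem 0 (by simp; omega) (by intro b _ hb; simp [hb])]
    simpa using one_le_pow₀ one_le_two

theorem sum_range_mul_self (D : ℕ) (g : ℕ → ℝ) :
    ∑ c ∈ Finset.range (D * D), g c =
      ∑ a ∈ Finset.range D, ∑ b ∈ Finset.range D, g (a + D * b) := by
  rw [← Finset.sum_product']
  refine (Finset.sum_nbij' (fun x : ℕ × ℕ => x.1 + D * x.2) (fun c => (c % D, c / D)) ?_ ?_ ?_ ?_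
    (fun _ _ => rfl)).symm
  · rintro ⟨a, b⟩ h
    simp only [Finset.mem_product, Finset.mem_range] at h ⊢
    calc a + D * b < D + D * b := by omega
      _ = D * (b + 1) := by ring
      _ ≤ D * D := Nat.mul_le_mul_left _ (by omega)
  · intro c h
    have hc : c < D * D := by simpa using h
    have hD : 0 < D := by
      rcases Nat.eq_zero_or_pos D with rfl | h
      · simp at hc
      · exact h
    simpa using ⟨Nat.mod_lt _ hD, Nat.div_lt_of_lt_mul hc⟩
  · rintro ⟨a, b⟩ h
    simp only [Finset.mem_product, Finset.mem_range] at h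
    ext
    · simp [Nat.mod_eq_of_lt h.1]
    · simp [Nat.add_mul_div_left a b (show 0 < D by omega), Nat.div_eq_of_lt h.1]
  · intro c _
    exact Nat.mod_add_div c D

theorem bil_eq (s u x : ℕ) : bil M n k D tup s u x =
    ∑ a ∈ Finset.range D, ∑ b ∈ Finset.range D, rowVec M n k D tup s a *
      M (momentSet n k tup (a + D * b) x) * colVec M n k D tup u b := by
  rw [bil, sum_range_mul_self]
  refine Finset.sum_congr rfl fun a ha => Finset.sum_congr rfl fun b hb => ?_
  have ha : a < D := by simpa using ha
  rw [Nat.add_mul_mod_self_left, Nat.mod_eq_of_lt ha, Nat.add_mul_div_left _ _ (by omega),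
    Nat.div_eq_of_lt ha, zero_add]

/-- Biorthogonality is exact for the empirical moments, whatever their error; only the comparison
with the model is approximate. -/
theorem bil_none (hD : 1 ≤ D) {s u : ℕ} (hs : s < k) (hu : u < k)
    (hd : ∀ t < k, pivotVal M n k D tup t ≠ 0) :
    bil M n k D tup s u n = if s = u then pivotVal M n k D tup u else 0 := by
  rw [bil_eq]
  refine Eq.trans ?_ ((stage_isElimination (D := D) M n k tup hD).sum_sum hs hu hd)
  refine Finset.sum_congr rfl fun a ha => Finset.sum_congr rfl fun b hb => ?_
  rw [rowVec, if_pos hs, colVec, if_pos hu, stage_zero (by simpa using ha) (by simpa using hb)]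

end stage

/-! ### Products of means over subsets, and their left inverses -/

theorem sum_range_two_pow_prod_bits (m : ℕ) (x y : ℕ → ℝ) :
    ∑ a ∈ Finset.range (2 ^ m), ∏ t ∈ Finset.range m, (if a / 2 ^ t % 2 = 1 then x t else y t) =
      ∏ t ∈ Finset.range m, (x t + y t) := by
  induction m with
  | zero => simp
  | succ m ih =>
    rw [pow_succ, mul_two, Finset.sum_range_add, Finset.prod_range_succ, ← ih, mul_add, add_comm]
    congr 1
    · rw [Finset.sum_mul]
      refine Finset.sum_congr rfl fun a ha => ?_
      have ha : a < 2 ^ m := by simpa using ha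
      rw [Finset.prod_range_succ, Nat.add_div_left _ (by positivity), Nat.div_eq_of_lt ha]
      congr 1
      refine Finset.prod_congr rfl fun t ht => ?_
      have ht : t < m := by simpa using ht
      have : (2 ^ m + a) / 2 ^ t % 2 = a / 2 ^ t % 2 := by
        obtain ⟨e, rfl⟩ := Nat.exists_eq_add_of_lt ht
        have : 2 ^ (t + e + 1) + a = a + 2 ^ t * (2 * 2 ^ e) := by ring
        rw [this, Nat.add_mul_div_left _ _ (by positivity), Nat.add_mul_mod_self_left]
      rw [this]
    · rw [Finset.sum_mul]
      refine Finset.sum_congr rfl fun a ha => ?_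
      have ha : a < 2 ^ m := by simpa using ha
      rw [Finset.prod_range_succ, Nat.div_eq_of_lt ha, if_neg (by norm_num)]

/-- The products of the values of `v` over the sets that the digits of `a` describe. -/
noncomputable def hadamard {k : ℕ} (m : ℕ) (v : ℕ → Fin k → ℝ) (a : ℕ) (j : Fin k) : ℝ :=
  ∏ t ∈ Finset.range m, if a / 2 ^ t % 2 = 1 then v t j else 1

theorem hadamard_mem_Icc {k m : ℕ} {v : ℕ → Fin k → ℝ} (hv : ∀ t j, v t j ∈ Set.Icc (0 : ℝ) 1)
    (a : ℕ) (j : Fin k) : hadamard m v a j ∈ Set.Icc (0 : ℝ) 1 := by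
  refine ⟨Finset.prod_nonneg fun t _ => ?_, Finset.prod_le_one (fun t _ => ?_) fun t _ => ?_⟩ <;>
    split_ifs <;> first | exact (hv _ _).1 | exact (hv _ _).2 | norm_num

theorem hadamard_zero {k m : ℕ} (v : ℕ → Fin k → ℝ) (j : Fin k) : hadamard m v 0 j = 1 := by
  simp [hadamard]

/-- For each class j, assign the κ other classes to the κ observables. The multilinear polynomial
∏_t (X_t - v_t(j_t)) / (v_t(j) - v_t(j_t)) is 1 on class j and 0 on the others, and its coefficients
form row j of the inverse. Each factor has coefficients of absolute value at most 1/ζ, whence the ℓ¹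
norm (2/ζ)^κ. -/
theorem exists_hadamard_left_inverse {κ : ℕ} {v : ℕ → Fin (κ + 1) → ℝ} {ζ : ℝ} (hζ : 0 < ζ)
    (hv : ∀ t j, v t j ∈ Set.Icc (0 : ℝ) 1)
    (hsep : ∀ t < κ, ∀ j j', j ≠ j' → ζ ≤ |v t j - v t j'|) :
    ∃ L : Fin (κ + 1) → ℕ → ℝ,
      (∀ j j', ∑ a ∈ Finset.range (2 ^ κ), L j a * hadamard κ v a j' = if j = j' then 1 else 0) ∧
        ∀ j, ∑ a ∈ Finset.range (2 ^ κ), |L j a| ≤ (2 / ζ) ^ κ := by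
  -- `succAbove` enumerates the classes other than j; the value for t ≥ κ is irrelevant.
  let o : Fin (κ + 1) → ℕ → Fin (κ + 1) := fun j t => if h : t < κ then j.succAbove ⟨t, h⟩ else j
  have ho : ∀ j, ∀ t < κ, o j t ≠ j := fun j t ht => by simp [o, ht, Fin.succAbove_ne]
  refine ⟨fun j a => ∏ t ∈ Finset.range κ, (if a / 2 ^ t % 2 = 1 then 1 / (v t j - v t (o j t))
    else -v t (o j t) / (v t j - v t (o j t))), fun j j' => ?_, fun j => ?_⟩
  · have : ∀ a, (∏ t ∈ Finset.range κ, (if a / 2 ^ t % 2 = 1 then 1 / (v t j - v t (o j t))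
        else -v t (o j t) / (v t j - v t (o j t)))) * hadamard κ v a j' =
        ∏ t ∈ Finset.range κ, (if a / 2 ^ t % 2 = 1 then v t j' / (v t j - v t (o j t))
        else -v t (o j t) / (v t j - v t (o j t))) := by
      intro a
      rw [hadamard, ← Finset.prod_mul_distrib]
      refine Finset.prod_congr rfl fun t _ => ?_
      split_ifs <;> ring
    rw [Finset.sum_congr rfl fun a _ => this a, sum_range_two_pow_prod_bits]
    split_ifs with h
    · subst h
      refine Finset.prod_eq_one fun t ht => ?_
      have ht : t < κ := by simpa using ht
      have h1 := hsep t ht j _ (ho j t ht).symm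
      rw [← add_div, ← sub_eq_add_neg, div_self]
      exact abs_pos.1 (hζ.trans_le h1)
    · obtain ⟨t, rfl⟩ := Fin.exists_succAbove_eq (Ne.symm h)
      refine Finset.prod_eq_zero (i := (t : ℕ)) (by simp) ?_
      simp only [o, t.2, dif_pos]
      ring
  · have h1 : ∀ a ∈ Finset.range (2 ^ κ), |∏ t ∈ Finset.range κ,
        (if a / 2 ^ t % 2 = 1 then 1 / (v t j - v t (o j t))
          else -v t (o j t) / (v t j - v t (o j t)))| ≤
        ∏ t ∈ Finset.range κ, (if a / 2 ^ t % 2 = 1 then 1 / ζ else 1 / ζ) := by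
      intro a _
      rw [Finset.abs_prod]
      refine Finset.prod_le_prod (fun _ _ => abs_nonneg _) fun t ht => ?_
      have ht : t < κ := by simpa using ht
      have h2 := hsep t ht j _ (ho j t ht).symm
      have h3 := hv t (o j t)
      split_ifs
      · rw [abs_div, abs_one]
        exact one_div_le_one_div_of_le hζ h2
      · rw [abs_div, abs_neg, abs_of_nonneg h3.1]
        exact div_le_div₀ zero_le_one h3.2 hζ h2
    refine (Finset.sum_le_sum h1).trans ?_
    rw [sum_range_two_pow_prod_bits, Finset.prod_const, Finset.card_range]
    exact le_of_eq (by ring)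

/-! ### Lower bound for the pivots -/

theorem abs_sum_sum_mul_le {D : ℕ} {x y : ℕ → ℝ} {g : ℕ → ℕ → ℝ} {a b c : ℝ}
    (hx : ∑ r ∈ Finset.range D, |x r| ≤ a) (hy : ∑ r ∈ Finset.range D, |y r| ≤ b) (hc : 0 ≤ c)
    (hg : ∀ r < D, ∀ s < D, |g r s| ≤ c) :
    |∑ r ∈ Finset.range D, ∑ s ∈ Finset.range D, x r * g r s * y s| ≤ a * b * c := by
  have ha : 0 ≤ a := (Finset.sum_nonneg fun _ _ => abs_nonneg _).trans hx
  calc _ ≤ ∑ r ∈ Finset.range D, ∑ s ∈ Finset.range D, |x r| * |y s| * c := by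
        refine (Finset.abs_sum_le_sum_abs _ _).trans (Finset.sum_le_sum fun r hr => ?_)
        refine (Finset.abs_sum_le_sum_abs _ _).trans (Finset.sum_le_sum fun s hs => ?_)
        rw [abs_mul, abs_mul, mul_right_comm]
        exact mul_le_mul_of_nonneg_left (hg r (by simpa using hr) s (by simpa using hs))
          (by positivity)
    _ = (∑ r ∈ Finset.range D, |x r|) * (∑ r ∈ Finset.range D, |y r|) * c := by
        rw [Finset.sum_mul_sum, Finset.sum_mul]
        exact Finset.sum_congr rfl fun r _ => (Finset.sum_mul _ _ _).symm
    _ ≤ _ := mul_le_mul_of_nonneg_right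
        (mul_le_mul hx hy (Finset.sum_nonneg fun _ _ => abs_nonneg _) ha) hc

/-- A bilinear form that is close to a sum of `k` products, the factors of which have left inverses,
cannot be made small by fewer than `k` elimination steps. -/
theorem IsElimination.le_of_left_inverse {D k : ℕ} {f : ℕ → ℕ → ℕ → ℝ} {p q : ℕ → ℕ}
    (h : IsElimination D f p q) {t : ℕ} (ht : t < k) {H G : ℕ → Fin k → ℝ} {w : Fin k → ℝ}
    {δ β η w0 : ℝ} (hδ : 0 ≤ δ) (hf0 : ∀ a < D, ∀ b < D, |f 0 a b - ∑ j, w j * H a j * G b j| ≤ δ)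
    (hf : ∀ a < D, ∀ b < D, |f t a b| ≤ β) (hβ : 0 ≤ β) (hw : ∀ j, w0 ≤ w j)
    {L R : Fin k → ℕ → ℝ}
    (hL : ∀ j j', ∑ a ∈ Finset.range D, L j a * H a j' = if j = j' then 1 else 0)
    (hR : ∀ j j', ∑ a ∈ Finset.range D, R j a * G a j' = if j = j' then 1 else 0)
    (hL1 : ∀ j, ∑ a ∈ Finset.range D, |L j a| ≤ η) (hR1 : ∀ j, ∑ a ∈ Finset.range D, |R j a| ≤ η) :
    w0 ≤ k * η ^ 2 * (β + δ) := by
  have hk : 0 < k := by omega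
  have : Nonempty (Fin k) := ⟨⟨0, hk⟩⟩
  have hη : 0 ≤ η := (Finset.sum_nonneg fun _ _ => abs_nonneg _).trans (hL1 ⟨0, hk⟩)
  -- These are t < k homogeneous equations in k unknowns. They make the row combination x = ∑ z_j
  -- L_j orthogonal to all earlier pivot columns.
  obtain ⟨z, hz, hz0⟩ : ∃ z : Fin k → ℝ, z ≠ 0 ∧ ∀ s < t,
      ∑ j, z j * ∑ a ∈ Finset.range D, L j a * f s a (q s) = 0 := by
    let A : Matrix (Fin t) (Fin k) ℝ := .of fun s j => ∑ a ∈ Finset.range D, L j a * f s a (q s)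
    have h1 : LinearMap.ker A.mulVecLin ≠ ⊥ :=
      LinearMap.ker_ne_bot_of_finrank_lt (by simpa using ht)
    obtain ⟨z, hz, hz0⟩ := Submodule.exists_mem_ne_zero_of_ne_bot h1
    refine ⟨z, hz0, fun s hs => ?_⟩
    have := congrFun (LinearMap.mem_ker.1 hz) ⟨s, hs⟩
    simpa [A, Matrix.mulVec, dotProduct, mul_comm] using this
  -- Testing against the column combination of a largest coordinate makes |z_i| cancel at the end.
  obtain ⟨i, hi⟩ := Finite.exists_max fun j => |z j|
  have hzi : 0 < |z i| := by
    by_contra hneg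
    refine hz (funext fun j => abs_nonpos_iff.1 ((hi j).trans (not_lt.1 hneg)))
  set x : ℕ → ℝ := fun a => ∑ j, z j * L j a with hx
  have hx1 : ∑ a ∈ Finset.range D, |x a| ≤ |z i| * (k * η) := by
    calc ∑ a ∈ Finset.range D, |x a| ≤ ∑ a ∈ Finset.range D, ∑ j, |z i| * |L j a| := by
          refine Finset.sum_le_sum fun a _ => (Finset.abs_sum_le_sum_abs _ _).trans
            (Finset.sum_le_sum fun j _ => ?_)
          rw [abs_mul]
          exact mul_le_mul_of_nonneg_right (hi j) (abs_nonneg _)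
      _ = |z i| * ∑ j, ∑ a ∈ Finset.range D, |L j a| := by
          rw [Finset.sum_comm, Finset.mul_sum]
          exact Finset.sum_congr rfl fun j _ => (Finset.mul_sum _ _ _).symm
      _ ≤ |z i| * (k * η) := by
          refine mul_le_mul_of_nonneg_left ?_ (abs_nonneg _)
          refine (Finset.sum_le_sum fun j _ => hL1 j).trans ?_
          simp
  have hxH : ∀ j, ∑ a ∈ Finset.range D, x a * H a j = z j := by
    intro j
    simp only [hx, Finset.sum_mul]
    rw [Finset.sum_comm]
    simp only [mul_assoc, ← Finset.mul_sum, hL]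
    simp
  have hxf : ∀ s < t, ∑ a ∈ Finset.range D, x a * f s a (q s) = 0 := by
    intro s hs
    rw [← hz0 s hs]
    simp only [hx, Finset.sum_mul]
    rw [Finset.sum_comm]
    simp only [mul_assoc, ← Finset.mul_sum]
  -- The eliminated part is a sum of rank one matrices built from the earlier pivot columns, and x
  -- annihilates it. So at x and R_i the current stage agrees with the initial matrix, which is
  -- close to w_i z_i there.
  have h1 : ∑ a ∈ Finset.range D, ∑ b ∈ Finset.range D, x a * f t a b * R i b =
      ∑ a ∈ Finset.range D, ∑ b ∈ Finset.range D, x a * f 0 a b * R i b := by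
    have h2 : ∀ s ∈ Finset.range t, ∑ a ∈ Finset.range D, ∑ b ∈ Finset.range D,
        x a * (f s a (q s) * f s (p s) b / f s (p s) (q s)) * R i b = 0 := by
      intro s hs
      calc _ = ∑ a ∈ Finset.range D, (x a * f s a (q s)) * ∑ b ∈ Finset.range D,
            (f s (p s) b / f s (p s) (q s)) * R i b := by
            refine Finset.sum_congr rfl fun a _ => ?_
            rw [Finset.mul_sum]
            exact Finset.sum_congr rfl fun b _ => by ring
        _ = 0 := by rw [← Finset.sum_mul, hxf s (by simpa using hs), zero_mul]
    rw [← sub_eq_zero, ← Finset.sum_sub_distrib, ← neg_eq_zero, ← Finset.sum_eq_zero h2,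
      Finset.sum_comm, ← Finset.sum_neg_distrib]
    refine Finset.sum_congr rfl fun a _ => ?_
    rw [← Finset.sum_sub_distrib, Finset.sum_comm, ← Finset.sum_neg_distrib]
    refine Finset.sum_congr rfl fun b _ => ?_
    rw [h.eq_sub_sum t a b, ← Finset.sum_mul, ← Finset.mul_sum]
    ring
  have h2 : ∑ a ∈ Finset.range D, ∑ b ∈ Finset.range D,
      x a * (∑ j, w j * H a j * G b j) * R i b = w i * z i := by
    calc _ = ∑ j, w j * (∑ a ∈ Finset.range D, x a * H a j) *
          ∑ b ∈ Finset.range D, R i b * G b j := by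
          simp only [Finset.mul_sum, Finset.sum_mul]
          rw [Finset.sum_comm]
          simp_rw [Finset.sum_comm (s := Finset.range D) (t := Finset.univ)]
          refine Finset.sum_congr rfl fun j _ => Finset.sum_congr rfl fun a _ =>
            Finset.sum_congr rfl fun b _ => by ring
      _ = w i * z i := by simp [hxH, hR]
  have h3 : w i * z i = ∑ a ∈ Finset.range D, ∑ b ∈ Finset.range D, x a *
      (f t a b - (f 0 a b - ∑ j, w j * H a j * G b j)) * R i b := by
    simp only [mul_sub, sub_mul, Finset.sum_sub_distrib]
    rw [h1, h2]
    ring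
  have h4 : |w i * z i| ≤ |z i| * (k * η) * η * (β + δ) := by
    rw [h3]
    exact abs_sum_sum_mul_le hx1 (hR1 i) (by positivity) fun a ha b hb =>
      (abs_sub _ _).trans (add_le_add (hf a ha b hb) (hf0 a ha b hb))
  rw [abs_mul, mul_comm] at h4
  have h5 : |w i| ≤ k * η ^ 2 * (β + δ) :=
    le_of_mul_le_mul_left (h4.trans_eq (by ring)) hzi
  exact (hw i).trans ((le_abs_self _).trans h5)

/-! ### Real eigenvalues of perturbed diagonal matrices -/

namespace Matrix

variable {k : ℕ}

theorem det_diagonal_sub_ne_zero {y : Fin k → ℝ} {E : Matrix (Fin k) (Fin k) ℝ}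
    (h : ∀ i, ∑ j, |E i j| < |y i|) : (diagonal y - E).det ≠ 0 := by
  refine det_ne_zero_of_sum_row_lt_diag fun i => ?_
  have h1 : ∑ j ∈ Finset.univ.erase i, ‖(diagonal y - E) i j‖ =
      ∑ j ∈ Finset.univ.erase i, |E i j| := by
    refine Finset.sum_congr rfl fun j hj => ?_
    have hj : i ≠ j := (Finset.ne_of_mem_erase hj).symm
    simp [diagonal_apply_ne _ hj]
  have h2 : |E i i| + ∑ j ∈ Finset.univ.erase i, |E i j| = ∑ j, |E i j| :=
    Finset.add_sum_erase Finset.univ (fun j => |E i j|) (Finset.mem_univ i)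
  have h3 := h i
  rw [h1, sub_apply, diagonal_apply_eq, Real.norm_eq_abs]
  have := abs_sub_abs_le_abs_sub (y i) (E i i)
  linarith

/-- Along the segment from the diagonal matrix to the perturbed one diagonal dominance persists, so
the determinant never vanishes and keeps its sign. -/
theorem det_diagonal_sub_mul_prod_pos {y : Fin k → ℝ} {E : Matrix (Fin k) (Fin k) ℝ}
    (h : ∀ i, ∑ j, |E i j| < |y i|) : 0 < (diagonal y - E).det * ∏ i, y i := by
  by_contra hneg
  let g : ℝ → ℝ := fun s => (diagonal y - s • E).det
  have hg : Continuous g := by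
    refine Continuous.matrix_det (A := fun s : ℝ => diagonal y - s • E) ?_
    fun_prop
  have h0 : g 0 = ∏ i, y i := by simp [g, det_diagonal]
  have h1 : g 1 = (diagonal y - E).det := by simp [g]
  rw [← h0, ← h1] at hneg
  have hmem : (0 : ℝ) ∈ Set.uIcc (g 0) (g 1) := by
    rw [Set.mem_uIcc]
    rcases le_total 0 (g 0) with ha | ha <;> rcases le_total 0 (g 1) with hb | hb
    · rcases ha.eq_or_lt with ha | ha
      · exact Or.inl ⟨ha.symm.le, hb⟩
      rcases hb.eq_or_lt with hb | hb
      · exact Or.inr ⟨hb.symm.le, ha.le⟩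
      exact absurd (mul_pos hb ha) hneg
    · exact Or.inr ⟨hb, ha⟩
    · exact Or.inl ⟨ha, hb⟩
    · rcases ha.eq_or_lt with ha | ha
      · exact Or.inr ⟨hb, ha.symm.le⟩
      rcases hb.eq_or_lt with hb | hb
      · exact Or.inl ⟨ha.le, hb.symm.le⟩
      exact absurd (mul_pos_of_neg_of_neg hb ha) hneg
  obtain ⟨s, hs, hs0⟩ := intermediate_value_uIcc hg.continuousOn hmem
  rw [Set.uIcc_of_le zero_le_one] at hs
  refine det_diagonal_sub_ne_zero (y := y) (E := s • E) (fun i => ?_) hs0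
  refine lt_of_le_of_lt (Finset.sum_le_sum fun j _ => ?_) (h i)
  rw [smul_apply, smul_eq_mul, abs_mul, abs_of_nonneg hs.1]
  exact mul_le_of_le_one_left (abs_nonneg _) hs.2

theorem eval_charpoly_diagonal_add (m : Fin k → ℝ) (E : Matrix (Fin k) (Fin k) ℝ) (x : ℝ) :
    (diagonal m + E).charpoly.eval x = (diagonal (fun i => x - m i) - E).det := by
  rw [eval_charpoly, scalar_apply, ← sub_sub, diagonal_sub]

/-- Every real eigenvalue of a perturbed diagonal matrix is close to a diagonal entry. -/
theorem exists_abs_sub_le_of_isRoot {m : Fin k → ℝ} {E : Matrix (Fin k) (Fin k) ℝ} {ρ x : ℝ}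
    (hE : ∀ i, ∑ j, |E i j| ≤ ρ) (hx : (diagonal m + E).charpoly.IsRoot x) :
    ∃ i, |x - m i| ≤ ρ := by
  by_contra! h
  rw [Polynomial.IsRoot, eval_charpoly_diagonal_add] at hx
  exact det_diagonal_sub_ne_zero (fun i => (hE i).trans_lt (h i)) hx

/-- A perturbed diagonal matrix with well separated diagonal entries has a real eigenvalue close to
each of them. -/
theorem exists_isRoot_abs_sub_le {m : Fin k → ℝ} {E : Matrix (Fin k) (Fin k) ℝ} {ρ r ζ : ℝ}
    (hE : ∀ i, ∑ j, |E i j| ≤ ρ) (hm : ∀ i j, i ≠ j → ζ ≤ |m i - m j|) (hρ : ρ < r)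
    (hr : r + ρ < ζ) (hr0 : 0 < r) (i : Fin k) :
    ∃ x, (diagonal m + E).charpoly.IsRoot x ∧ |x - m i| ≤ r := by
  have hρ0 : 0 ≤ ρ := (Finset.sum_nonneg fun _ _ => abs_nonneg _).trans (hE i)
  -- At m_i ± r the perturbation is dominated: for the index i since ρ < r, for the others since r +
  -- ρ < ζ. So the characteristic polynomial has the sign of the unperturbed one.
  have key : ∀ e : ℝ, |e| = r → 0 < (diagonal m + E).charpoly.eval (m i + e) *
      ∏ j, (m i + e - m j) := by
    intro e he
    rw [eval_charpoly_diagonal_add]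
    refine det_diagonal_sub_mul_prod_pos fun j => (hE j).trans_lt ?_
    rcases eq_or_ne i j with rfl | hij
    · rwa [add_sub_cancel_left, he]
    · have := hm i j hij
      have h1 := abs_sub_abs_le_abs_sub (m i - m j) (-e)
      rw [abs_neg, he] at h1
      rw [show m i + e - m j = m i - m j - -e by ring]
      linarith
  -- Only the factor of index i changes sign between the two points.
  have hprod : (∏ j, (m i + r - m j)) * ∏ j, (m i + -r - m j) < 0 := by
    rw [← Finset.prod_mul_distrib, ← Finset.mul_prod_erase _ _ (Finset.mem_univ i)]
    refine mul_neg_of_neg_of_pos (by nlinarith) (Finset.prod_pos fun j hj => ?_)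
    have h1 := hm i j (Finset.ne_of_mem_erase hj).symm
    have h2 : r * r < (m i - m j) * (m i - m j) := by
      rw [← abs_mul_abs_self (m i - m j)]
      nlinarith
    nlinarith
  have h1 := key r (abs_of_pos hr0)
  have h2 := key (-r) (by rw [abs_neg, abs_of_pos hr0])
  generalize hf : (diagonal m + E).charpoly = f at *
  have h3 : f.eval (m i + r) * f.eval (m i + -r) < 0 := by
    have h4 := mul_pos h1 h2
    have h5 : 0 < (f.eval (m i + r) * f.eval (m i + -r)) *
      ((∏ j, (m i + r - m j)) * ∏ j, (m i + -r - m j)) := by linarith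
    by_contra h6
    exact absurd h5 (not_lt.2 (mul_nonpos_of_nonneg_of_nonpos (not_lt.1 h6) hprod.le))
  have hmem : (0 : ℝ) ∈ Set.uIcc (f.eval (m i + -r)) (f.eval (m i + r)) := by
    rw [Set.mem_uIcc]
    rcases mul_neg_iff.1 h3 with ⟨ha, hb⟩ | ⟨ha, hb⟩
    · exact Or.inl ⟨hb.le, ha.le⟩
    · exact Or.inr ⟨ha.le, hb.le⟩
  obtain ⟨x, hx, hx0⟩ := intermediate_value_uIcc f.continuous.continuousOn hmem
  rw [Set.uIcc_of_le (by linarith)] at hx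
  exact ⟨x, hx0, abs_le.2 ⟨by linarith [hx.1], by linarith [hx.2]⟩⟩

theorem realEigenvalue_of_lt {A : Matrix (Fin k) (Fin k) ℝ} {j : ℕ} (hj : j < A.charpoly.roots.card) :
    ∃ h : j < (A.charpoly.roots.sort (· ≥ ·)).length,
      realEigenvalue A j = (A.charpoly.roots.sort (· ≥ ·))[j] := by
  have h : j < (A.charpoly.roots.sort (· ≥ ·)).length := by rwa [Multiset.length_sort]
  exact ⟨h, List.getD_eq_getElem _ _ h⟩

theorem isRoot_realEigenvalue_of_lt {A : Matrix (Fin k) (Fin k) ℝ} {j : ℕ}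
    (hj : j < A.charpoly.roots.card) : A.charpoly.IsRoot (realEigenvalue A j) := by
  obtain ⟨h, he⟩ := realEigenvalue_of_lt hj
  rw [he]
  have := List.getElem_mem h
  rw [Multiset.mem_sort] at this
  exact Polynomial.isRoot_of_mem_roots this

theorem realEigenvalue_of_le {A : Matrix (Fin k) (Fin k) ℝ} {j : ℕ}
    (hj : A.charpoly.roots.card ≤ j) : realEigenvalue A j = 0 :=
  List.getD_eq_default _ _ (by rwa [Multiset.length_sort])

/-- If the listed eigenvalues have gaps, then all of them are eigenvalues. -/
theorem isRoot_realEigenvalue_of_gap {A : Matrix (Fin k) (Fin k) ℝ} {g : ℝ} (hg : 0 < g)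
    (h : ∀ j < k - 1, realEigenvalue A (j + 1) + g ≤ realEigenvalue A j) {j : ℕ} (hj : j < k) :
    A.charpoly.IsRoot (realEigenvalue A j) := by
  refine isRoot_realEigenvalue_of_lt (hj.trans_le ?_)
  by_contra! hlt
  have hdeg : A.charpoly.natDegree = k := by simp [charpoly_natDegree_eq_dim]
  by_cases h1 : A.charpoly.roots.card + 2 ≤ k
  -- If two real eigenvalues are missing, two consecutive list entries have the default value 0, and
  -- there is no gap.
  · have := h A.charpoly.roots.card (by omega)
    rw [realEigenvalue_of_le le_rfl, realEigenvalue_of_le (by omega)] at this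
    linarith
  -- A single one cannot be missing: the cofactor of the real linear factors would have degree 1 and
  -- hence a real root.
  · obtain ⟨q, -, h2, h3⟩ := Polynomial.exists_prod_multiset_X_sub_C_mul A.charpoly
    have h4 : q.natDegree = 1 := by omega
    have hq0 : q ≠ 0 := by
      rintro rfl
      simp at h4
    obtain ⟨x, hx⟩ := Polynomial.exists_root_of_degree_eq_one
      ((Polynomial.degree_eq_iff_natDegree_eq hq0).2 h4)
    have := (Polynomial.mem_roots hq0).2 hx
    simp [h3] at this

theorem realEigenvalue_gap {A : Matrix (Fin k) (Fin k) ℝ} {g : ℝ} (hg : 0 ≤ g)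
    (h : ∀ j < k - 1, realEigenvalue A (j + 1) + g ≤ realEigenvalue A j) {i j : ℕ} (hij : i < j)
    (hj : j < k) : realEigenvalue A j + g ≤ realEigenvalue A i := by
  induction j, hij using Nat.le_induction with
  | base => exact h i (by omega)
  | succ j hij ih =>
    have h1 := ih (by omega)
    have h2 := h j (by omega)
    linarith

/-- The k distinct roots exhaust the characteristic polynomial. So the sorted list contains each of
them once, and consecutive entries are distinct values of `μ`. -/
theorem gap_realEigenvalue_of_roots {A : Matrix (Fin k) (Fin k) ℝ} {μ : Fin k → ℝ} {g : ℝ}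
    (hg : 0 < g) (hμ : ∀ i, A.charpoly.IsRoot (μ i)) (hgap : ∀ i j, i ≠ j → g ≤ |μ i - μ j|) {j : ℕ}
    (hj : j < k - 1) : realEigenvalue A (j + 1) + g ≤ realEigenvalue A j := by
  have hinj : Function.Injective μ := by
    intro a b hab
    by_contra hne
    have := hgap a b hne
    rw [hab, sub_self, abs_zero] at this
    linarith
  have hne := A.charpoly_monic.ne_zero
  have hroots : (Finset.univ.val.map μ : Multiset ℝ) = A.charpoly.roots := by
    refine Multiset.eq_of_le_of_card_le ((Multiset.le_iff_subset
      (Finset.univ.nodup.map hinj)).2 fun x hx => ?_) ?_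
    · obtain ⟨i, -, rfl⟩ := Multiset.mem_map.1 hx
      exact (Polynomial.mem_roots hne).2 (hμ i)
    · refine (Polynomial.card_roots' _).trans ?_
      simp [charpoly_natDegree_eq_dim]
  have hcard : A.charpoly.roots.card = k := by simp [← hroots]
  obtain ⟨h1, e1⟩ := realEigenvalue_of_lt (A := A) (j := j) (by omega)
  obtain ⟨h2, e2⟩ := realEigenvalue_of_lt (A := A) (j := j + 1) (by omega)
  have hmem : ∀ i, ∀ hi : i < (A.charpoly.roots.sort (· ≥ ·)).length,
      ∃ a, μ a = (A.charpoly.roots.sort (· ≥ ·))[i] := by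
    intro i hi
    have := List.getElem_mem hi
    have h3 := (Multiset.mem_sort _).1 this
    generalize (A.charpoly.roots.sort (· ≥ ·))[i] = x at h3 ⊢
    rw [← hroots] at h3
    obtain ⟨a, -, ha⟩ := Multiset.mem_map.1 h3
    exact ⟨a, ha⟩
  have hnodup : (A.charpoly.roots.sort (· ≥ ·)).Nodup := by
    rw [← Multiset.coe_nodup, Multiset.sort_eq, ← hroots]
    exact Finset.univ.nodup.map hinj
  have hle : (A.charpoly.roots.sort (· ≥ ·))[j + 1] ≤ (A.charpoly.roots.sort (· ≥ ·))[j] :=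
    List.pairwise_iff_getElem.1 (Multiset.pairwise_sort _ _) j (j + 1) h1 h2 (by omega)
  obtain ⟨a, ha⟩ := hmem j h1
  obtain ⟨b, hb⟩ := hmem (j + 1) h2
  have hab : a ≠ b := by
    rintro rfl
    have := (hnodup.getElem_inj_iff).1 (ha.symm.trans hb)
    omega
  have := hgap a b hab
  rw [ha, hb, abs_of_nonneg (by linarith)] at this
  rw [e1, e2]
  linarith

end Matrix

/-! ### Approximate diagonalisation and spectral projections -/

namespace Matrix

open scoped Matrix.Norms.Operator

variable {k : ℕ}

theorem norm_le_of_abs_le {A : Matrix (Fin k) (Fin k) ℝ} {c : ℝ} (hc : 0 ≤ c)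
    (h : ∀ i j, |A i j| ≤ c) : ‖A‖ ≤ k * c := by
  lift c to NNReal using hc
  rw [linfty_opNorm_def]
  have : Finset.univ.sup (fun i => ∑ j, ‖A i j‖₊) ≤ k * c := by
    refine Finset.sup_le fun i _ => ?_
    calc ∑ j, ‖A i j‖₊ ≤ ∑ _j : Fin k, c := Finset.sum_le_sum fun j _ => by
          exact_mod_cast h i j
      _ = k * c := by simp
  exact_mod_cast this

theorem sum_abs_le_norm (A : Matrix (Fin k) (Fin k) ℝ) (i : Fin k) : ∑ j, |A i j| ≤ ‖A‖ := by
  rw [linfty_opNorm_def]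
  have h : ∑ j, ‖A i j‖₊ ≤ Finset.univ.sup (fun i => ∑ j, ‖A i j‖₊) :=
    Finset.le_sup (f := fun i => ∑ j, ‖A i j‖₊) (Finset.mem_univ i)
  have h' : ((∑ j, ‖A i j‖₊ : NNReal) : ℝ) ≤ _ := NNReal.coe_le_coe.2 h
  simpa using h'

theorem abs_dotProduct_le (x y : Fin k → ℝ) : |x ⬝ᵥ y| ≤ k * ‖x‖ * ‖y‖ := by
  calc |x ⬝ᵥ y| ≤ ∑ i, |x i * y i| := Finset.abs_sum_le_sum_abs _ _
    _ ≤ ∑ _i : Fin k, ‖x‖ * ‖y‖ := Finset.sum_le_sum fun i _ => by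
        rw [abs_mul]
        exact mul_le_mul (norm_le_pi_norm x i) (norm_le_pi_norm y i) (abs_nonneg _) (norm_nonneg _)
    _ = k * ‖x‖ * ‖y‖ := by simp [mul_assoc]

/-- An approximate diagonalisation of `A`, with an approximate inverse `P` of `F`, gives an exact
conjugation of `A` to a perturbed diagonal matrix. -/
theorem exists_conjugation {F P E₁ E₂ A : Matrix (Fin k) (Fin k) ℝ} {m : Fin k → ℝ} {a b h : ℝ}
    (hF : ‖F‖ ≤ a) (hP : ‖P‖ ≤ b) (hFP : F * P = 1 - E₁) (hA : A = F * diagonal m * P + E₂)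
    (hE₁ : ‖E₁‖ ≤ h) (hE₂ : ‖E₂‖ ≤ h) (hh : h ≤ 1 / 2) (hm : ‖m‖ ≤ 1) (ha : 1 ≤ a) (hb : 1 ≤ b) :
    ∃ Fi E₃ : Matrix (Fin k) (Fin k) ℝ, F * Fi = 1 ∧ Fi * F = 1 ∧ ‖Fi‖ ≤ 2 * b ∧
      A = F * (diagonal m + E₃) * Fi ∧ ‖E₃‖ ≤ 6 * a ^ 2 * b ^ 2 * h := by
  have h0 : 0 ≤ h := (norm_nonneg _).trans hE₁
  have hu : IsUnit (1 - E₁) := isUnit_one_sub_of_norm_lt_one (by linarith)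
  obtain ⟨V, hV⟩ := hu.exists_right_inv
  set Fi := P * V with hFi
  have h1 : F * Fi = 1 := by rw [hFi, ← mul_assoc, hFP, hV]
  have h2 : Fi * F = 1 := mul_eq_one_comm.1 h1
  have h3 : P = Fi - Fi * E₁ := by
    calc P = Fi * F * P := by rw [h2, one_mul]
      _ = Fi - Fi * E₁ := by rw [mul_assoc, hFP, mul_sub, mul_one]
  -- From Fi = P + Fi E₁ and ‖E₁‖ ≤ 1/2, the term ‖Fi‖/2 is absorbed on the left.
  have h4 : ‖Fi‖ ≤ 2 * b := by
    have h5 : Fi = P + Fi * E₁ := by rw [h3]; abel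
    have h6 : ‖Fi‖ ≤ ‖P‖ + ‖Fi‖ * ‖E₁‖ := by
      conv_lhs => rw [h5]
      exact (norm_add_le _ _).trans (add_le_add le_rfl (norm_mul_le _ _))
    nlinarith [norm_nonneg Fi]
  have hd : ‖diagonal m‖ ≤ 1 := by rwa [linfty_opNorm_diagonal]
  have h7 : ‖E₂ - F * diagonal m * (Fi * E₁)‖ ≤ h + a * 1 * (2 * b * h) := by
    refine (norm_sub_le _ _).trans (add_le_add hE₂ ?_)
    refine (norm_mul_le _ _).trans (mul_le_mul ((norm_mul_le _ _).trans ?_)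
      ((norm_mul_le _ _).trans ?_) (norm_nonneg _) (by positivity))
    · exact mul_le_mul hF hd (norm_nonneg _) (by positivity)
    · exact mul_le_mul h4 hE₁ (norm_nonneg _) (by positivity)
  -- Replacing P by Fi - Fi E₁ in the formula for A leaves the bracketed residual; conjugation moves
  -- it next to the diagonal.
  refine ⟨Fi, Fi * (E₂ - F * diagonal m * (Fi * E₁)) * F, h1, h2, h4, ?_, ?_⟩
  · have : F * (Fi * (E₂ - F * diagonal m * (Fi * E₁)) * F) * Fi =
        E₂ - F * diagonal m * (Fi * E₁) := by
      calc _ = (F * Fi) * (E₂ - F * diagonal m * (Fi * E₁)) * (F * Fi) := by noncomm_ring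
        _ = _ := by rw [h1, one_mul, mul_one]
    rw [mul_add, add_mul, this, hA]
    conv_lhs => rw [h3]
    noncomm_ring
  · calc _ ≤ 2 * b * (h + a * 1 * (2 * b * h)) * a := by
          refine (norm_mul_le _ _).trans (mul_le_mul ((norm_mul_le _ _).trans ?_) hF
            (norm_nonneg _) (by positivity))
          exact mul_le_mul h4 h7 (norm_nonneg _) (by positivity)
      _ = 2 * a * b * h * (1 + 2 * (a * b)) := by ring
      _ ≤ 2 * a * b * h * (a * b + 2 * (a * b)) := by
          have : 1 ≤ a * b := by nlinarith
          gcongr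
      _ = 6 * a ^ 2 * b ^ 2 * h := by ring

theorem charpoly_conj {F Fi N : Matrix (Fin k) (Fin k) ℝ} (h1 : F * Fi = 1) (h2 : Fi * F = 1) :
    (F * N * Fi).charpoly = N.charpoly := by
  have h := charpoly_units_conj ⟨F, Fi, h1, h2⟩ N
  rwa [show ((⟨F, Fi, h1, h2⟩ : (Matrix (Fin k) (Fin k) ℝ)ˣ) : Matrix (Fin k) (Fin k) ℝ)⁻¹ = Fi from
    inv_eq_right_inv h1] at h

/-- The Lagrange polynomials of approximate eigenvalues, applied to a perturbed diagonal matrix. -/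
theorem lagrange_error {E : Matrix (Fin k) (Fin k) ℝ} {m : Fin k → ℝ} {ρ ζ : ℝ} (hζ : 0 < ζ)
    (hE : ‖E‖ ≤ ρ) (hρ : ρ ≤ 1 / 4) (hm : ∀ i, m i ∈ Set.Icc (0 : ℝ) 1) {μ : ℕ → ℝ}
    {σ : Equiv.Perm (Fin k)} (hσ : ∀ j : Fin k, |μ j - m (σ j)| ≤ ρ)
    (hgap : ∀ i < k, ∀ j < k, i ≠ j → ζ / 2 ≤ |μ i - μ j|) (hζ1 : ζ ≤ 1) (j : Fin k)
    {ω : ℕ → Fin k → ℝ} (hω : ∀ l < k, ω (l + 1) = if l = j then ω l else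
      (μ j - μ l)⁻¹ • ((diagonal m + E) *ᵥ ω l - μ l • ω l)) :
    ‖ω k‖ ≤ (8 / ζ) ^ k * ‖ω 0‖ ∧ ∀ i, |ω k i - if i = σ j then ω 0 i else 0| ≤
      k * (8 / ζ) ^ k * ρ * ‖ω 0‖ := by
  have hρ0 : 0 ≤ ρ := (norm_nonneg _).trans hE
  set R := 8 / ζ with hR
  have hR1 : 1 ≤ R := by rw [hR, le_div_iff₀ hζ]; linarith
  -- The comparison uses the computed eigenvalue that belongs to the coordinate i, not the mean m_i.
  -- Then the factors are exactly 1 or contain an exact 0, and the product over all l is the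
  -- indicator of i = σ j.
  let c : ℕ → Fin k → ℝ := fun l i =>
    ∏ l' ∈ Finset.range l, if l' = j then 1 else (μ (σ.symm i) - μ l') / (μ j - μ l')
  have hμ : ∀ i : Fin k, |m i - μ (σ.symm i)| ≤ ρ := by
    intro i
    have := hσ (σ.symm i)
    rwa [Equiv.apply_symm_apply, abs_sub_comm] at this
  have hfac : ∀ l < k, ∀ i : Fin k, l ≠ j → |(μ (σ.symm i) - μ l) / (μ j - μ l)| ≤ 4 / ζ := by
    intro l hl i hlj
    have h1 := hgap j j.2 l hl (Ne.symm hlj)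
    have h2 := abs_le.1 (hμ i)
    have h3 := abs_le.1 (hσ ⟨l, hl⟩)
    have h4 := hm i
    have h5 := hm (σ ⟨l, hl⟩)
    rw [abs_div, div_le_div_iff₀ (by linarith) hζ]
    have h6 : |μ (σ.symm i) - μ l| ≤ 2 := by
      simp only at h3
      exact abs_le.2 ⟨by linarith [h4.1, h5.2], by linarith [h4.2, h5.1]⟩
    nlinarith
  have hstep : ∀ l < k, l ≠ j → ∀ i, ∃ r, |r| ≤ 4 * ρ / ζ * ‖ω l‖ ∧
      ω (l + 1) i = (μ (σ.symm i) - μ l) / (μ j - μ l) * ω l i + r := by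
    intro l hl hlj i
    refine ⟨(μ j - μ l)⁻¹ * ((m i - μ (σ.symm i)) * ω l i + (E *ᵥ ω l) i), ?_, ?_⟩
    · have h1 := hgap j j.2 l hl (Ne.symm hlj)
      have h2 : |(m i - μ (σ.symm i)) * ω l i + (E *ᵥ ω l) i| ≤ 2 * ρ * ‖ω l‖ := by
        have h3 : |(m i - μ (σ.symm i)) * ω l i| ≤ ρ * ‖ω l‖ := by
          rw [abs_mul]
          exact mul_le_mul (hμ i) (norm_le_pi_norm (ω l) i) (abs_nonneg _) hρ0
        have h4 : |(E *ᵥ ω l) i| ≤ ρ * ‖ω l‖ :=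
          (norm_le_pi_norm (E *ᵥ ω l) i).trans ((linfty_opNorm_mulVec _ _).trans
            (mul_le_mul_of_nonneg_right hE (norm_nonneg _)))
        exact (abs_add_le _ _).trans (by linarith)
      rw [abs_mul, abs_inv]
      calc _ ≤ (ζ / 2)⁻¹ * (2 * ρ * ‖ω l‖) :=
            mul_le_mul (inv_anti₀ (by linarith) h1) h2 (abs_nonneg _) (by positivity)
        _ = _ := by field_simp; ring
    · rw [hω l hl, if_neg hlj, add_mulVec]
      simp only [Pi.smul_apply, Pi.sub_apply, Pi.add_apply, mulVec_diagonal, smul_eq_mul]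
      ring
  have key : ∀ l ≤ k, ‖ω l‖ ≤ R ^ l * ‖ω 0‖ ∧
      ∀ i, |ω l i - c l i * ω 0 i| ≤ l * R ^ l * ρ * ‖ω 0‖ := by
    intro l
    induction l with
    | zero => simp [c]
    | succ l ih =>
      intro hl
      obtain ⟨ih1, ih2⟩ := ih (by omega)
      by_cases hlj : l = j
      · have h1 : ω (l + 1) = ω l := by rw [hω l (by omega), if_pos hlj]
        have h2 : ∀ i, c (l + 1) i = c l i := fun i => by
          simp only [c]
          rw [Finset.prod_range_succ, if_pos hlj, mul_one]
        rw [h1]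
        refine ⟨ih1.trans ?_, fun i => ?_⟩
        · gcongr
          omega
        · rw [h2]
          refine (ih2 i).trans ?_
          gcongr
          · omega
          · omega
      -- The exact factor contributes 4/ζ (a difference at most 2 over a gap at least ζ/2), and its
      -- error contributes 4ρ/ζ with ρ ≤ 1/4.
      · have h4 : 4 / ζ + 4 * ρ / ζ ≤ R := by
          rw [← add_div, hR]
          exact div_le_div_of_nonneg_right (by linarith) hζ.le
        refine ⟨(pi_norm_le_iff_of_nonneg (by positivity)).2 fun i => ?_, fun i => ?_⟩
        · obtain ⟨r, hr, he⟩ := hstep l (by omega) hlj i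
          rw [he]
          calc |(μ (σ.symm i) - μ l) / (μ j - μ l) * ω l i + r|
              ≤ 4 / ζ * ‖ω l‖ + 4 * ρ / ζ * ‖ω l‖ := by
                refine (abs_add_le _ _).trans (add_le_add ?_ hr)
                rw [abs_mul]
                exact mul_le_mul (hfac l (by omega) i hlj) (norm_le_pi_norm (ω l) i) (abs_nonneg _)
                  (by positivity)
            _ = (4 / ζ + 4 * ρ / ζ) * ‖ω l‖ := by ring
            _ ≤ R * (R ^ l * ‖ω 0‖) := mul_le_mul h4 ih1 (norm_nonneg _) (by positivity)
            _ = R ^ (l + 1) * ‖ω 0‖ := by ring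
        · obtain ⟨r, hr, he⟩ := hstep l (by omega) hlj i
          have h5 : c (l + 1) i = c l i * ((μ (σ.symm i) - μ l) / (μ j - μ l)) := by
            simp only [c]
            rw [Finset.prod_range_succ, if_neg hlj]
          have h6 : (4 : ℝ) / ζ ≤ R := by
            rw [hR]
            exact div_le_div_of_nonneg_right (by norm_num) hζ.le
          rw [he, h5]
          calc |(μ (σ.symm i) - μ l) / (μ j - μ l) * ω l i + r -
                c l i * ((μ (σ.symm i) - μ l) / (μ j - μ l)) * ω 0 i|
              = |(μ (σ.symm i) - μ l) / (μ j - μ l) * (ω l i - c l i * ω 0 i) + r| := by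
                congr 1; ring
            _ ≤ 4 / ζ * (l * R ^ l * ρ * ‖ω 0‖) + 4 * ρ / ζ * (R ^ l * ‖ω 0‖) := by
                refine (abs_add_le _ _).trans (add_le_add ?_ (hr.trans
                  (mul_le_mul_of_nonneg_left ih1 (by positivity))))
                rw [abs_mul]
                exact mul_le_mul (hfac l (by omega) i hlj) (ih2 i) (abs_nonneg _) (by positivity)
            _ = 4 / ζ * ((l + 1) * R ^ l * ρ * ‖ω 0‖) := by ring
            _ ≤ R * ((l + 1) * R ^ l * ρ * ‖ω 0‖) := mul_le_mul_of_nonneg_right h6 (by positivity)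
            _ = ((l + 1 : ℕ) : ℝ) * R ^ (l + 1) * ρ * ‖ω 0‖ := by push_cast; ring
  obtain ⟨k1, k2⟩ := key k le_rfl
  refine ⟨k1, fun i => ?_⟩
  have h1 := k2 i
  have hck : c k i * ω 0 i = if i = σ j then ω 0 i else 0 := by
    split_ifs with hi
    · have : c k i = 1 := by
        refine Finset.prod_eq_one fun l hl => ?_
        split_ifs with hlj
        · rfl
        · have h2 := hgap j j.2 l (by simpa using hl) (Ne.symm hlj)
          rw [hi, Equiv.symm_apply_apply, div_self]
          exact abs_pos.1 (by linarith)
      rw [this, one_mul]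
    · have : c k i = 0 := by
        refine Finset.prod_eq_zero (i := (σ.symm i : ℕ)) (by simp) ?_
        rw [if_neg, sub_self, zero_div]
        intro h2
        exact hi (by rw [← Fin.ext h2, Equiv.apply_symm_apply])
      rw [this, zero_mul]
  rwa [hck] at h1

/-- In the coordinates ω = Fi w the matrix A becomes diag(m) + E₃. The Lagrange product then nearly
projects onto the coordinate σ j, where the right vector is close to β and the left one to α. -/
theorem coefficient_error {F P Fi E₁ E₃ A : Matrix (Fin k) (Fin k) ℝ} {m : Fin k → ℝ}
    {a b h ζ : ℝ} (hF : ‖F‖ ≤ a) (hFP : F * P = 1 - E₁) (hE₁ : ‖E₁‖ ≤ h) (hFFi : F * Fi = 1)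
    (hFiF : Fi * F = 1) (hFi : ‖Fi‖ ≤ 2 * b) (hA : A = F * (diagonal m + E₃) * Fi)
    (hE₃ : ‖E₃‖ ≤ 6 * a ^ 2 * b ^ 2 * h) (hsmall : 6 * a ^ 2 * b ^ 2 * h ≤ 1 / 4)
    (ha : 1 ≤ a) (hb : 1 ≤ b) (hζ : 0 < ζ) (hζ1 : ζ ≤ 1) (hm : ∀ i, m i ∈ Set.Icc (0 : ℝ) 1)
    {μ : ℕ → ℝ} {σ : Equiv.Perm (Fin k)} (hσ : ∀ j : Fin k, |μ j - m (σ j)| ≤ 6 * a ^ 2 * b ^ 2 * h)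
    (hgap : ∀ i < k, ∀ j < k, i ≠ j → ζ / 2 ≤ |μ i - μ j|) (j : Fin k) {w : ℕ → Fin k → ℝ}
    (hw : ∀ l < k, w (l + 1) = if l = j then w l else (μ j - μ l)⁻¹ • (A *ᵥ w l - μ l • w l))
    {α β e e' g : Fin k → ℝ} (hα : ‖α‖ ≤ 1) (hβ : ‖β‖ ≤ 1) (he : ‖e‖ ≤ h) (he' : ‖e'‖ ≤ h)
    (hw0 : w 0 = F *ᵥ β + e) (hg : g = α ᵥ* P + e') :
    |g ⬝ᵥ w k - α (σ j) * β (σ j)| ≤ 20 * k ^ 2 * (8 / ζ) ^ k * a ^ 2 * b ^ 2 * h := by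
  have h0 : 0 ≤ h := (norm_nonneg _).trans hE₁
  set ρ := 6 * a ^ 2 * b ^ 2 * h with hρ
  set ω : ℕ → Fin k → ℝ := fun l => Fi *ᵥ w l with hω
  set R := (8 / ζ) ^ k with hR
  have hR1 : 1 ≤ R := one_le_pow₀ (by rw [le_div_iff₀ hζ]; linarith)
  have hk1 : (1 : ℝ) ≤ k := by exact_mod_cast (show 1 ≤ k by have := j.2; omega)
  have hwω : ∀ l, w l = F *ᵥ ω l := fun l => by
    simp only [hω]
    rw [mulVec_mulVec, hFFi, one_mulVec]
  have hstep : ∀ l < k, ω (l + 1) = if l = j then ω l else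
      (μ j - μ l)⁻¹ • ((diagonal m + E₃) *ᵥ ω l - μ l • ω l) := by
    intro l hl
    simp only [hω]
    rw [hw l hl]
    split_ifs
    · rfl
    · rw [mulVec_smul, mulVec_sub, mulVec_smul, hA, mulVec_mulVec, mul_assoc, ← mul_assoc Fi, hFiF,
        one_mul, ← mulVec_mulVec]
  obtain ⟨l1, l2⟩ := lagrange_error hζ hE₃ hsmall hm hσ hgap hζ1 j hstep
  have hω0 : ω 0 = β + Fi *ᵥ e := by
    simp only [hω]
    rw [hw0, mulVec_add, mulVec_mulVec, hFiF, one_mulVec]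
  have hab : 1 ≤ a ^ 2 * b := by nlinarith
  have hFie : ‖Fi *ᵥ e‖ ≤ 2 * b * h :=
    (linfty_opNorm_mulVec _ _).trans (mul_le_mul hFi he (norm_nonneg _) (by positivity))
  have hbh : 2 * b * h ≤ 1 := by
    have : 2 * b * h * 1 ≤ 2 * b * h * (a ^ 2 * b) := by gcongr
    nlinarith
  have hω02 : ‖ω 0‖ ≤ 2 := by
    rw [hω0]
    exact (norm_add_le _ _).trans (by linarith)
  have hωk : ‖ω k‖ ≤ R * 2 := l1.trans (mul_le_mul_of_nonneg_left hω02 (by positivity))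
  have hPF : P * F = 1 - Fi * E₁ * F := by
    calc P * F = Fi * (F * P) * F := by rw [← mul_assoc, hFiF, one_mul]
      _ = 1 - Fi * E₁ * F := by rw [hFP, mul_sub, mul_one, sub_mul, hFiF]
  -- Four errors: of the projection, of the right vector, of P as an inverse of F, and of the left
  -- vector.
  have hdot : g ⬝ᵥ w k - α (σ j) * β (σ j) =
      α ⬝ᵥ (fun i => ω k i - if i = σ j then ω 0 i else 0) + α (σ j) * (Fi *ᵥ e) (σ j) -
        α ⬝ᵥ ((Fi * E₁ * F) *ᵥ ω k) + e' ⬝ᵥ (F *ᵥ ω k) := by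
    have h1 : g ⬝ᵥ w k = α ⬝ᵥ ω k - α ⬝ᵥ ((Fi * E₁ * F) *ᵥ ω k) + e' ⬝ᵥ (F *ᵥ ω k) := by
      rw [hg, hwω k, add_dotProduct, ← dotProduct_mulVec, mulVec_mulVec, hPF, sub_mulVec,
        one_mulVec, dotProduct_sub]
    have h2 : α ⬝ᵥ (fun i => ω k i - if i = σ j then ω 0 i else 0) =
        α ⬝ᵥ ω k - α (σ j) * ω 0 (σ j) := by
      simp [dotProduct, mul_sub, Finset.sum_sub_distrib]
    rw [h1, h2, hω0, Pi.add_apply]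
    ring
  have b1 : |α ⬝ᵥ (fun i => ω k i - if i = σ j then ω 0 i else 0)| ≤ k * 1 * (k * R * ρ * 2) := by
    refine (abs_dotProduct_le _ _).trans (mul_le_mul (mul_le_mul_of_nonneg_left hα (by positivity))
      ((pi_norm_le_iff_of_nonneg (by positivity)).2 fun i => (l2 i).trans ?_) (norm_nonneg _)
      (by positivity))
    exact mul_le_mul_of_nonneg_left hω02 (by positivity)
  have b2 : |α (σ j) * (Fi *ᵥ e) (σ j)| ≤ 1 * (2 * b * h) := by
    rw [abs_mul]
    exact mul_le_mul ((norm_le_pi_norm α _).trans hα) ((norm_le_pi_norm (Fi *ᵥ e) _).trans hFie)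
      (abs_nonneg _) zero_le_one
  have b3 : |α ⬝ᵥ ((Fi * E₁ * F) *ᵥ ω k)| ≤ k * 1 * (2 * b * h * a * (R * 2)) := by
    refine (abs_dotProduct_le _ _).trans (mul_le_mul (mul_le_mul_of_nonneg_left hα (by positivity))
      ((linfty_opNorm_mulVec _ _).trans (mul_le_mul ((norm_mul_le _ _).trans (mul_le_mul
        ((norm_mul_le _ _).trans (mul_le_mul hFi hE₁ (norm_nonneg _) (by positivity))) hF
        (norm_nonneg _) (by positivity))) hωk (norm_nonneg _) (by positivity))) (norm_nonneg _)
      (by positivity))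
  have b4 : |e' ⬝ᵥ (F *ᵥ ω k)| ≤ k * h * (a * (R * 2)) := by
    refine (abs_dotProduct_le _ _).trans (mul_le_mul (mul_le_mul_of_nonneg_left he' (by positivity))
      ((linfty_opNorm_mulVec _ _).trans (mul_le_mul hF hωk (norm_nonneg _) (by positivity)))
      (norm_nonneg _) (by positivity))
  rw [hdot]
  have b5 : |α ⬝ᵥ (fun i => ω k i - if i = σ j then ω 0 i else 0) + α (σ j) * (Fi *ᵥ e) (σ j) -
        α ⬝ᵥ ((Fi * E₁ * F) *ᵥ ω k) + e' ⬝ᵥ (F *ᵥ ω k)| ≤ k * 1 * (k * R * ρ * 2) +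
        1 * (2 * b * h) + k * 1 * (2 * b * h * a * (R * 2)) + k * h * (a * (R * 2)) :=
    (abs_add_le _ _).trans (add_le_add ((abs_sub _ _).trans (add_le_add ((abs_add_le _ _).trans
      (add_le_add b1 b2)) b3)) b4)
  refine b5.trans ?_
  have x1 : b * h ≤ k ^ 2 * R * a ^ 2 * b ^ 2 * h := by
    have : 1 ≤ (k : ℝ) ^ 2 * R * (a ^ 2 * b) := one_le_mul_of_one_le_of_one_le
      (one_le_mul_of_one_le_of_one_le (one_le_pow₀ hk1) hR1) hab
    calc b * h = 1 * (b * h) := by ring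
      _ ≤ ((k : ℝ) ^ 2 * R * (a ^ 2 * b)) * (b * h) := by gcongr
      _ = _ := by ring
  have x2 : k * b * h * a * R ≤ k ^ 2 * R * a ^ 2 * b ^ 2 * h := by
    have : 1 ≤ (k : ℝ) * (a * b) := one_le_mul_of_one_le_of_one_le hk1
      (one_le_mul_of_one_le_of_one_le ha hb)
    calc k * b * h * a * R = 1 * (k * b * h * a * R) := by ring
      _ ≤ ((k : ℝ) * (a * b)) * (k * b * h * a * R) := by gcongr
      _ = _ := by ring
  have x3 : k * h * a * R ≤ k * b * h * a * R := by
    calc k * h * a * R = k * 1 * h * a * R := by ring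
      _ ≤ k * b * h * a * R := by gcongr
  rw [hρ]
  nlinarith

end Matrix

/-! ### Moments of the model and their bilinear forms -/

namespace MixModel

variable {n k : ℕ}

noncomputable def moment (Q : MixModel n k) (S : Finset ℕ) : ℝ :=
  ∑ j, Q.weight j * ∏ i ∈ Finset.univ.filter (fun i : Fin n => (i : ℕ) ∈ S), Q.mean i j

/-- The means of the observable `x`, and `1` if there is no such observable. -/
noncomputable def meanOrOne (Q : MixModel n k) (x : ℕ) (j : Fin k) : ℝ :=
  if h : x < n then Q.mean ⟨x, h⟩ j else 1

theorem meanOrOne_of_lt (Q : MixModel n k) {x : ℕ} (h : x < n) (j : Fin k) :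
    Q.meanOrOne x j = Q.mean ⟨x, h⟩ j := dif_pos h

theorem meanOrOne_of_le (Q : MixModel n k) {x : ℕ} (h : n ≤ x) (j : Fin k) :
    Q.meanOrOne x j = 1 := dif_neg (by omega)

theorem meanOrOne_mem (Q : MixModel n k) (x : ℕ) (j : Fin k) :
    Q.meanOrOne x j ∈ Set.Icc (0 : ℝ) 1 := by
  rw [meanOrOne]
  split_ifs
  · exact Q.mean_mem _ _
  · simp

theorem weight_nonneg (Q : MixModel n k) (j : Fin k) : 0 ≤ Q.weight j := Q.weight_mem.1 j

theorem weight_le_one (Q : MixModel n k) (j : Fin k) : Q.weight j ≤ 1 := by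
  rw [← Q.weight_mem.2]
  exact Finset.single_le_sum (fun i _ => Q.weight_nonneg i) (Finset.mem_univ j)

/-- Indices from n on may repeat, as they contribute the factor 1; repeated observables would be
lost in the set, so they are excluded. -/
theorem prod_filter_mem_image (Q : MixModel n k) (j : Fin k) (s : Finset ℕ) (g : ℕ → ℕ)
    (hg : ∀ t ∈ s, ∀ t' ∈ s, g t < n → g t = g t' → t = t') :
    ∏ i ∈ Finset.univ.filter (fun i : Fin n => (i : ℕ) ∈ s.image g), Q.mean i j =
      ∏ t ∈ s, Q.meanOrOne (g t) j := by
  have h1 : ∏ t ∈ s, Q.meanOrOne (g t) j =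
      ∏ t ∈ s.filter (fun t => g t < n), Q.meanOrOne (g t) j := by
    rw [Finset.prod_filter]
    refine Finset.prod_congr rfl fun t _ => ?_
    split_ifs with h
    · rfl
    · exact Q.meanOrOne_of_le (not_lt.1 h) j
  rw [h1]
  symm
  refine Finset.prod_bij (fun t ht => ⟨g t, (Finset.mem_filter.1 ht).2⟩) (fun t ht => ?_)
    (fun t ht t' ht' h => ?_) (fun i hi => ?_) (fun t ht => ?_)
  · simp only [Finset.mem_filter, Finset.mem_univ, true_and]
    exact Finset.mem_image_of_mem g (Finset.mem_filter.1 ht).1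
  · obtain ⟨h2, h3⟩ := Finset.mem_filter.1 ht
    exact hg t h2 t' (Finset.mem_filter.1 ht').1 h3 (Fin.mk.inj h)
  · obtain ⟨t, ht, he⟩ := Finset.mem_image.1 (Finset.mem_filter.1 hi).2
    exact ⟨t, Finset.mem_filter.2 ⟨ht, by rw [he]; exact i.2⟩, Fin.ext he⟩
  · exact Q.meanOrOne_of_lt _ j

theorem digit_low {κ a b t : ℕ} (ht : t < κ) : (a + 2 ^ κ * b) / 2 ^ t % 2 = a / 2 ^ t % 2 := by
  obtain ⟨e, rfl⟩ := Nat.exists_eq_add_of_lt ht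
  have : a + 2 ^ (t + e + 1) * b = a + 2 ^ t * (2 * (2 ^ e * b)) := by ring
  rw [this, Nat.add_mul_div_left _ _ (by positivity), Nat.add_mul_mod_self_left]

theorem digit_high {κ a b t : ℕ} (ha : a < 2 ^ κ) :
    (a + 2 ^ κ * b) / 2 ^ (κ + t) % 2 = b / 2 ^ t % 2 := by
  rw [pow_add, ← Nat.div_div_eq_div_mul, Nat.add_mul_div_left _ _ (by positivity),
    Nat.div_eq_of_lt ha, zero_add]

/-- The products of means that belong to the rows of the moment matrix. -/
noncomputable def rowProd (Q : MixModel n k) (tup : ℕ → ℕ) : ℕ → Fin k → ℝ :=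
  hadamard (k - 1) fun t => Q.meanOrOne (tup t)

/-- The products of means that belong to the columns of the moment matrix. -/
noncomputable def colProd (Q : MixModel n k) (tup : ℕ → ℕ) : ℕ → Fin k → ℝ :=
  hadamard (k - 1) fun t => Q.meanOrOne (tup (k - 1 + t))

/-- The k-1 low digits of the code select the row observables and the high digits the column
observables. So each class contributes a product of a row factor and a column factor. -/
theorem moment_momentSet (Q : MixModel n k) (hk : 1 ≤ k) {tup : ℕ → ℕ}
    (hinj : ∀ t < 2 * k - 2, ∀ t' < t, tup t ≠ tup t') {a b x : ℕ} (ha : a < 2 ^ (k - 1))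
    (hx : x < n → ∀ t < 2 * k - 2, (a + 2 ^ (k - 1) * b) / 2 ^ t % 2 = 1 → tup t ≠ x) :
    Q.moment (momentSet n k tup (a + 2 ^ (k - 1) * b) x) =
      ∑ j, Q.weight j * Q.meanOrOne x j * Q.rowProd tup a j * Q.colProd tup b j := by
  obtain ⟨κ, rfl⟩ : ∃ κ, k = κ + 1 := ⟨k - 1, by omega⟩
  rw [moment]
  refine Finset.sum_congr rfl fun j _ => ?_
  rw [momentSet, prod_filter_mem_image]
  · have e1 : 2 * (κ + 1) - 1 = κ + κ + 1 := by omega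
    have e2 : 2 * (κ + 1) - 2 = κ + κ := by omega
    rw [e1, e2, Finset.prod_range_succ, if_pos rfl, Finset.prod_range_add, rowProd, colProd,
      hadamard, hadamard]
    simp only [Nat.add_sub_cancel]
    have h1 : ∏ t ∈ Finset.range κ, Q.meanOrOne (if t = κ + κ then x else
        if (a + 2 ^ κ * b) / 2 ^ t % 2 = 1 then tup t else n) j =
        ∏ t ∈ Finset.range κ, if a / 2 ^ t % 2 = 1 then Q.meanOrOne (tup t) j else 1 := by
      refine Finset.prod_congr rfl fun t ht => ?_
      have ht : t < κ := by simpa using ht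
      rw [if_neg (by omega), digit_low ht]
      split_ifs
      · rfl
      · exact Q.meanOrOne_of_le le_rfl j
    have h2 : ∏ t ∈ Finset.range κ, Q.meanOrOne (if κ + t = κ + κ then x else
        if (a + 2 ^ κ * b) / 2 ^ (κ + t) % 2 = 1 then tup (κ + t) else n) j =
        ∏ t ∈ Finset.range κ, if b / 2 ^ t % 2 = 1 then Q.meanOrOne (tup (κ + t)) j else 1 := by
      refine Finset.prod_congr rfl fun t ht => ?_
      have ht : t < κ := by simpa using ht
      rw [if_neg (by omega), digit_high (by simpa using ha)]
      split_ifs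
      · rfl
      · exact Q.meanOrOne_of_le le_rfl j
    rw [h1, h2]
    ring
  · have hne : ∀ t < 2 * (κ + 1) - 2, ∀ t' < 2 * (κ + 1) - 2, tup t = tup t' → t = t' := by
      intro t ht t' ht' h
      rcases lt_trichotomy t t' with h1 | h1 | h1
      · exact absurd h.symm (hinj t' ht' t h1)
      · exact h1
      · exact absurd h (hinj t ht t' h1)
    intro t ht t' ht' hlt he
    simp only [Finset.mem_range] at ht ht'
    by_cases h1 : t = 2 * (κ + 1) - 2 <;> by_cases h2 : t' = 2 * (κ + 1) - 2
    · rw [h1, h2]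
    · rw [if_pos h1] at hlt
      rw [if_pos h1, if_neg h2] at he
      split_ifs at he with h3
      · exact absurd he.symm (hx hlt t' (by omega) h3)
      · omega
    · rw [if_neg h1] at hlt
      rw [if_neg h1, if_pos h2] at he
      split_ifs at he hlt with h3
      · exact absurd he (hx (by omega) t (by omega) h3)
      · omega
    · rw [if_neg h1] at hlt
      rw [if_neg h1, if_neg h2] at he
      split_ifs at he hlt with h3 h4
      · exact hne t (by omega) t' (by omega) he
      all_goals omega

/-- The table of moments `M` is accurate up to `δ` for all the sets that are looked up. -/
def IsApprox (Q : MixModel n k) (M : Finset ℕ → ℝ) (δ : ℝ) : Prop :=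
  ∀ S : Finset ℕ, S.card ≤ 2 * k - 1 → |M S - Q.moment S| ≤ δ

theorem IsApprox.abs_momentSet_sub_le {Q : MixModel n k} {M : Finset ℕ → ℝ} {δ : ℝ}
    (h : Q.IsApprox M δ) (hk : 1 ≤ k) {tup : ℕ → ℕ}
    (hinj : ∀ t < 2 * k - 2, ∀ t' < t, tup t ≠ tup t') {a b x : ℕ} (ha : a < 2 ^ (k - 1))
    (hx : x < n → ∀ t < 2 * k - 2, (a + 2 ^ (k - 1) * b) / 2 ^ t % 2 = 1 → tup t ≠ x) :
    |M (momentSet n k tup (a + 2 ^ (k - 1) * b) x) -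
      ∑ j, Q.weight j * Q.meanOrOne x j * Q.rowProd tup a j * Q.colProd tup b j| ≤ δ := by
  rw [← Q.moment_momentSet hk hinj ha hx]
  refine h _ (Finset.card_image_le.trans ?_)
  simp

/-- The combinations of the products of means that are given by the elimination. -/
noncomputable def rowFactor (Q : MixModel n k) (M : Finset ℕ → ℝ) (tup : ℕ → ℕ) (s : ℕ)
    (j : Fin k) : ℝ :=
  ∑ a ∈ Finset.range (2 ^ (k - 1)), rowVec M n k (2 ^ (k - 1)) tup s a * Q.rowProd tup a j

noncomputable def colFactor (Q : MixModel n k) (M : Finset ℕ → ℝ) (tup : ℕ → ℕ) (s : ℕ)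
    (j : Fin k) : ℝ :=
  ∑ a ∈ Finset.range (2 ^ (k - 1)), colVec M n k (2 ^ (k - 1)) tup s a * Q.colProd tup a j

theorem abs_sum_mul_le_of_mem_Icc {D : ℕ} {x y : ℕ → ℝ} {c : ℝ}
    (hx : ∑ a ∈ Finset.range D, |x a| ≤ c) (hy : ∀ a, y a ∈ Set.Icc (0 : ℝ) 1) :
    |∑ a ∈ Finset.range D, x a * y a| ≤ c := by
  refine (Finset.abs_sum_le_sum_abs _ _).trans (le_trans (Finset.sum_le_sum fun a _ => ?_) hx)
  rw [abs_mul, abs_of_nonneg (hy a).1]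
  exact mul_le_of_le_one_right (abs_nonneg _) (hy a).2

theorem abs_rowFactor_le (Q : MixModel n k) (M : Finset ℕ → ℝ) (tup : ℕ → ℕ) {s : ℕ} (hs : s ≤ k)
    (j : Fin k) : |Q.rowFactor M tup s j| ≤ 2 ^ k :=
  abs_sum_mul_le_of_mem_Icc (sum_abs_rowVec_le Nat.one_le_two_pow s hs)
    fun a => hadamard_mem_Icc (fun _ _ => Q.meanOrOne_mem _ _) a j

theorem abs_colFactor_le (Q : MixModel n k) (M : Finset ℕ → ℝ) (tup : ℕ → ℕ) {s : ℕ} (hs : s ≤ k)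
    (j : Fin k) : |Q.colFactor M tup s j| ≤ 2 ^ k :=
  abs_sum_mul_le_of_mem_Icc (sum_abs_colVec_le Nat.one_le_two_pow s hs)
    fun a => hadamard_mem_Icc (fun _ _ => Q.meanOrOne_mem _ _) a j

theorem rowFactor_self (Q : MixModel n k) (M : Finset ℕ → ℝ) (tup : ℕ → ℕ) (j : Fin k) :
    Q.rowFactor M tup k j = 1 := by
  rw [rowFactor, Finset.sum_eq_single_of_mem 0 (by simp) (by intro b _ hb; simp [rowVec, hb])]
  simp [rowVec, rowProd, hadamard_zero]

theorem colFactor_self (Q : MixModel n k) (M : Finset ℕ → ℝ) (tup : ℕ → ℕ) (j : Fin k) :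
    Q.colFactor M tup k j = 1 := by
  rw [colFactor, Finset.sum_eq_single_of_mem 0 (by simp) (by intro b _ hb; simp [colVec, hb])]
  simp [colVec, colProd, hadamard_zero]

/-- Both vectors have ℓ¹ norm at most 2^k, so an entrywise error δ becomes at most 4^k δ. For s = k
the row is the empty set, so x may be a row observable; likewise for u = k and the columns. -/
theorem IsApprox.abs_bil_sub_le {Q : MixModel n k} {M : Finset ℕ → ℝ} {δ : ℝ}
    (h : Q.IsApprox M δ) (hδ : 0 ≤ δ) (hk : 1 ≤ k) {tup : ℕ → ℕ}
    (hinj : ∀ t < 2 * k - 2, ∀ t' < t, tup t ≠ tup t') {s u x : ℕ} (hs : s ≤ k) (hu : u ≤ k)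
    (hx1 : x < n → s < k → ∀ t < k - 1, tup t ≠ x)
    (hx2 : x < n → u < k → ∀ t < k - 1, tup (k - 1 + t) ≠ x) :
    |bil M n k (2 ^ (k - 1)) tup s u x -
      ∑ j, Q.rowFactor M tup s j * (Q.weight j * Q.meanOrOne x j) * Q.colFactor M tup u j| ≤
      4 ^ k * δ := by
  classical
  set D := 2 ^ (k - 1) with hD
  have hexact : ∑ j, Q.rowFactor M tup s j * (Q.weight j * Q.meanOrOne x j) *
      Q.colFactor M tup u j = ∑ a ∈ Finset.range D, ∑ b ∈ Finset.range D, rowVec M n k D tup s a *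
        (∑ j, Q.weight j * Q.meanOrOne x j * Q.rowProd tup a j * Q.colProd tup b j) *
        colVec M n k D tup u b := by
    simp only [rowFactor, colFactor, Finset.sum_mul, Finset.mul_sum]
    simp_rw [Finset.sum_comm (s := Finset.range D) (t := Finset.univ)]
    refine Finset.sum_congr rfl fun j _ => ?_
    rw [Finset.sum_comm]
    exact Finset.sum_congr rfl fun a _ => Finset.sum_congr rfl fun b _ => by ring
  -- Entries with a zero coefficient are masked: there x may coincide with a selected observable,
  -- and the moment need not be close to the product formula.
  set g : ℕ → ℕ → ℝ := fun a b => if rowVec M n k D tup s a = 0 ∨ colVec M n k D tup u b = 0 then 0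
    else M (momentSet n k tup (a + D * b) x) -
      ∑ j, Q.weight j * Q.meanOrOne x j * Q.rowProd tup a j * Q.colProd tup b j with hg
  have hdiff : bil M n k D tup s u x - ∑ j, Q.rowFactor M tup s j *
      (Q.weight j * Q.meanOrOne x j) * Q.colFactor M tup u j = ∑ a ∈ Finset.range D,
        ∑ b ∈ Finset.range D, rowVec M n k D tup s a * g a b * colVec M n k D tup u b := by
    rw [hexact, bil_eq, ← Finset.sum_sub_distrib]
    refine Finset.sum_congr rfl fun a _ => ?_
    rw [← Finset.sum_sub_distrib]
    refine Finset.sum_congr rfl fun b _ => ?_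
    simp only [hg]
    split_ifs with h0
    · rcases h0 with h0 | h0 <;> simp [h0]
    · ring
  rw [hdiff]
  refine (abs_sum_sum_mul_le (sum_abs_rowVec_le Nat.one_le_two_pow s hs)
    (sum_abs_colVec_le Nat.one_le_two_pow u hu) hδ fun a ha b hb => ?_).trans_eq ?_
  · simp only [hg]
    split_ifs with h0
    · simpa using hδ
    · push Not at h0
      refine h.abs_momentSet_sub_le hk hinj ha fun hxn t ht hbit => ?_
      rcases lt_or_ge t (k - 1) with h1 | h1
      · refine hx1 hxn ?_ t h1
        by_contra hsk
        rw [rowVec, if_neg hsk] at h0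
        have ha0 : a = 0 := by
          by_contra hne
          exact h0.1 (if_neg hne)
        rw [digit_low h1, ha0] at hbit
        simp at hbit
      · obtain ⟨t', rfl⟩ := Nat.exists_eq_add_of_le h1
        refine hx2 hxn ?_ t' (by omega)
        by_contra huk
        rw [colVec, if_neg huk] at h0
        have hb0 : b = 0 := by
          by_contra hne
          exact h0.2 (if_neg hne)
        rw [digit_high ha, hb0] at hbit
        simp at hbit
  · rw [← mul_pow]
    norm_num

end MixModel

/-! ### From accurate moments to accurate coefficients -/

namespace MixModel

open Matrix
open scoped Matrix.Norms.Operator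

variable {n k : ℕ}

/-- F evaluates the row combinations on the classes. P combines the weights, the column combinations
and the reciprocals of the pivots. Every computed quantity is a bilinear form of moments, so it
equals an expression in F, the means and P up to 4^k δ, divided by τ where a pivot occurs. -/
theorem IsApprox.exists_factorization {Q : MixModel n k} {M : Finset ℕ → ℝ} {δ τ a b h : ℝ}
    (hM : Q.IsApprox M δ) (hδ : 0 ≤ δ) (hk : 1 ≤ k) {tup : ℕ → ℕ}
    (hinj : ∀ t < 2 * k - 1, ∀ t' < t, tup t ≠ tup t')
    (hτ0 : 0 < τ) (hτ1 : τ ≤ 1) (hτ : ∀ u < k, τ ≤ |pivotVal M n k (2 ^ (k - 1)) tup u|)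
    (ha : k * 2 ^ k ≤ a) (hb : k * (2 ^ k / τ) ≤ b) (hh : k * (4 ^ k * δ / τ) ≤ h)
    (hh1 : h ≤ 1 / 2) :
    ∃ F P Fi E₁ E₃ : Matrix (Fin k) (Fin k) ℝ, ‖F‖ ≤ a ∧ F * P = 1 - E₁ ∧ ‖E₁‖ ≤ h ∧ F * Fi = 1 ∧
      Fi * F = 1 ∧ ‖Fi‖ ≤ 2 * b ∧ (Matrix.of fun s u : Fin k => matEntry M n k (2 ^ (k - 1)) tup s u) =
        F * (diagonal (Q.meanOrOne (tup (2 * k - 2))) + E₃) * Fi ∧ ‖E₃‖ ≤ 6 * a ^ 2 * b ^ 2 * h ∧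
      (∀ x, (x < n → ∀ t < k - 1, tup t ≠ x) →
        ‖(fun s : Fin k => bil M n k (2 ^ (k - 1)) tup s k x) -
          F *ᵥ (fun j => Q.weight j * Q.meanOrOne x j)‖ ≤ h) ∧
      ∀ x, (x < n → ∀ t < k - 1, tup (k - 1 + t) ≠ x) →
        ‖(fun u : Fin k => bil M n k (2 ^ (k - 1)) tup k u x / pivotVal M n k (2 ^ (k - 1)) tup u) -
          Q.meanOrOne x ᵥ* P‖ ≤ h := by
  have hk' : (1 : ℝ) ≤ k := by exact_mod_cast hk
  have hinj' : ∀ t < 2 * k - 2, ∀ t' < t, tup t ≠ tup t' := fun t ht => hinj t (by omega)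
  have h2k : (1 : ℝ) ≤ 2 ^ k := one_le_pow₀ one_le_two
  have hd0 : ∀ u < k, pivotVal M n k (2 ^ (k - 1)) tup u ≠ 0 := fun u hu =>
    abs_pos.1 (hτ0.trans_le (hτ u hu))
  have hdiv : ∀ u < k, ∀ x : ℝ, |x| ≤ 4 ^ k * δ →
      |x / pivotVal M n k (2 ^ (k - 1)) tup u| ≤ 4 ^ k * δ / τ := by
    intro u hu x hx
    rw [abs_div]
    exact div_le_div₀ (by positivity) hx hτ0 (hτ u hu)
  have hsmall : 4 ^ k * δ / τ ≤ h := le_trans (le_mul_of_one_le_left (by positivity) hk') hh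
  set F : Matrix (Fin k) (Fin k) ℝ := .of fun s j => Q.rowFactor M tup s j with hF
  set P : Matrix (Fin k) (Fin k) ℝ := .of fun j u =>
    Q.weight j * Q.colFactor M tup u j / pivotVal M n k (2 ^ (k - 1)) tup u with hP
  set A : Matrix (Fin k) (Fin k) ℝ := .of fun s u => matEntry M n k (2 ^ (k - 1)) tup s u with hA
  have hnF : ‖F‖ ≤ a := (norm_le_of_abs_le (by positivity) fun s j =>
    Q.abs_rowFactor_le M tup s.2.le j).trans ha
  have hnP : ‖P‖ ≤ b := by
    refine (norm_le_of_abs_le (c := 2 ^ k / τ) (by positivity) fun j u => ?_).trans hb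
    rw [hP, of_apply, abs_div, abs_mul, abs_of_nonneg (Q.weight_nonneg j)]
    exact div_le_div₀ (by positivity) ((mul_le_of_le_one_left (abs_nonneg _)
      (Q.weight_le_one j)).trans (Q.abs_colFactor_le M tup u.2.le j)) hτ0 (hτ u u.2)
  -- The empirical form without a further observable is exactly diagonal, so 1 - F P consists of
  -- sampling errors divided by pivots.
  have hnE₁ : ‖1 - F * P‖ ≤ h := by
    refine (norm_le_of_abs_le (c := 4 ^ k * δ / τ) (by positivity) fun s u => ?_).trans hh
    have h1 := hM.abs_bil_sub_le hδ hk hinj' s.2.le u.2.le (x := n) (by simp) (by simp)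
    have h2 := hdiv u u.2 _ h1
    rw [bil_none Nat.one_le_two_pow s.2 u.2 hd0] at h2
    convert h2 using 2
    rw [sub_div, Matrix.sub_apply, one_apply, mul_apply, Finset.sum_div]
    congr 1
    · simp only [Fin.ext_iff]
      split_ifs with hsu
      · rw [div_self (hd0 u u.2)]
      · rw [zero_div]
    · refine Finset.sum_congr rfl fun j _ => ?_
      rw [hF, hP, of_apply, of_apply, Q.meanOrOne_of_le le_rfl]
      ring
  have hnE₂ : ‖A - F * diagonal (Q.meanOrOne (tup (2 * k - 2))) * P‖ ≤ h := by
    refine (norm_le_of_abs_le (c := 4 ^ k * δ / τ) (by positivity) fun s u => ?_).trans hh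
    have h1 := hM.abs_bil_sub_le hδ hk hinj' s.2.le u.2.le (x := tup (2 * k - 2))
      (fun _ _ t ht => (hinj (2 * k - 2) (by omega) t (by omega)).symm)
      (fun _ _ t ht => (hinj (2 * k - 2) (by omega) (k - 1 + t) (by omega)).symm)
    have h2 := hdiv u u.2 _ h1
    convert h2 using 2
    rw [sub_div, Matrix.sub_apply, mul_apply, Finset.sum_div]
    congr 1
    refine Finset.sum_congr rfl fun j _ => ?_
    rw [mul_diagonal, hF, hP, of_apply, of_apply]
    ring
  have hm : ‖Q.meanOrOne (tup (2 * k - 2))‖ ≤ 1 := (pi_norm_le_iff_of_nonneg zero_le_one).2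
    fun j => by
      rw [Real.norm_eq_abs, abs_of_nonneg (Q.meanOrOne_mem _ j).1]
      exact (Q.meanOrOne_mem _ j).2
  have ha1 : 1 ≤ a := le_trans (one_le_mul_of_one_le_of_one_le hk' h2k) ha
  have hb1 : 1 ≤ b := by
    refine le_trans (one_le_mul_of_one_le_of_one_le hk' ?_) hb
    rw [le_div_iff₀ hτ0]
    linarith
  obtain ⟨Fi, E₃, h1, h2, h3, h4, h5⟩ := exists_conjugation (E₁ := 1 - F * P) hnF hnP (by abel)
    (show A = F * diagonal _ * P + (A - F * diagonal (Q.meanOrOne (tup (2 * k - 2))) * P) by abel)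
    hnE₁ hnE₂ hh1 hm ha1 hb1
  refine ⟨F, P, Fi, 1 - F * P, E₃, hnF, by abel, hnE₁, h1, h2, h3, h4, h5, fun x hx => ?_,
    fun x hx => ?_⟩
  · refine (pi_norm_le_iff_of_nonneg (by linarith [norm_nonneg (1 - F * P)])).2 fun s => ?_
    have h6 := hM.abs_bil_sub_le hδ hk hinj' s.2.le le_rfl (x := x) (fun h _ => hx h) (by simp)
    have h7 : 4 ^ k * δ ≤ h := by
      refine le_trans ?_ hsmall
      rw [le_div_iff₀ hτ0]
      exact mul_le_of_le_one_right (by positivity) hτ1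
    refine le_trans (le_of_eq ?_) (h6.trans h7)
    rw [Real.norm_eq_abs]
    congr 2
    simp [hF, mulVec, dotProduct, Q.colFactor_self]
  · refine (pi_norm_le_iff_of_nonneg (by linarith [norm_nonneg (1 - F * P)])).2 fun u => ?_
    have h6 := hM.abs_bil_sub_le hδ hk hinj' le_rfl u.2.le (x := x) (by simp) (fun h _ => hx h)
    refine le_trans (le_of_eq ?_) ((hdiv u u.2 _ h6).trans hsmall)
    rw [Real.norm_eq_abs, sub_div, Finset.sum_div, Pi.sub_apply]
    congr 2
    simp only [hP, vecMul, dotProduct, of_apply, Q.rowFactor_self]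
    exact Finset.sum_congr rfl fun j _ => by ring

theorem coefficient_eq_dotProduct (M : Finset ℕ → ℝ) (n k D : ℕ) (tup : ℕ → ℕ) (j xw xv : ℕ) :
    coefficient M n k D tup j xw xv =
      (fun u : Fin k => bil M n k D tup k u xw / pivotVal M n k D tup u) ⬝ᵥ
        fun s : Fin k => lagrangeVec M n k D tup j xv k s := by
  rw [coefficient, Finset.sum_range]
  rfl

theorem lagrangeVec_succ (M : Finset ℕ → ℝ) (n k D : ℕ) (tup : ℕ → ℕ) (j xv l : ℕ) :
    (fun s : Fin k => lagrangeVec M n k D tup j xv (l + 1) s) =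
      if l = j then fun s : Fin k => lagrangeVec M n k D tup j xv l s
      else (eigVal M n k D tup j - eigVal M n k D tup l)⁻¹ •
        ((Matrix.of fun s u : Fin k => matEntry M n k D tup s u) *ᵥ
          (fun s : Fin k => lagrangeVec M n k D tup j xv l s) -
          eigVal M n k D tup l • fun s : Fin k => lagrangeVec M n k D tup j xv l s) := by
  funext s
  rw [lagrangeVec]
  split_ifs
  · rfl
  · simp only [Pi.smul_apply, Pi.sub_apply, smul_eq_mul, mulVec, dotProduct, of_apply]
    rw [Finset.sum_range, div_eq_inv_mul]

/-- If a tuple passes the test, then the coefficients that the algorithm computes are close to the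
products of weights and means of the model. -/
theorem IsApprox.abs_coefficient_sub_le {Q : MixModel n k} {M : Finset ℕ → ℝ} {δ τ ζ a b h : ℝ}
    (hM : Q.IsApprox M δ) (hδ : 0 ≤ δ) (hk : 1 ≤ k) {tup : ℕ → ℕ} (hζ : 0 < ζ) (hζ1 : ζ ≤ 1)
    (hpass : Passes M n k (2 ^ (k - 1)) tup ζ τ) (hτ0 : 0 < τ) (hτ1 : τ ≤ 1)
    (ha : k * 2 ^ k ≤ a) (hb : k * (2 ^ k / τ) ≤ b) (hh : k * (4 ^ k * δ / τ) ≤ h)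
    (hh1 : h ≤ 1 / 2) (hρ : 6 * a ^ 2 * b ^ 2 * h < ζ / 4) :
    ∃ σ : Equiv.Perm (Fin k), ∀ (j : Fin k) (xw xv : ℕ),
      (xw < n → ∀ t < k - 1, tup (k - 1 + t) ≠ xw) → (xv < n → ∀ t < k - 1, tup t ≠ xv) →
      |coefficient M n k (2 ^ (k - 1)) tup j xw xv -
        Q.meanOrOne xw (σ j) * (Q.weight (σ j) * Q.meanOrOne xv (σ j))| ≤
          20 * k ^ 2 * (8 / ζ) ^ k * a ^ 2 * b ^ 2 * h := by
  obtain ⟨hinj, hpiv, hgap⟩ := hpass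
  have hk' : (1 : ℝ) ≤ k := by exact_mod_cast hk
  have h2k : (1 : ℝ) ≤ 2 ^ k := one_le_pow₀ one_le_two
  have ha1 : 1 ≤ a := le_trans (one_le_mul_of_one_le_of_one_le hk' h2k) ha
  have hb1 : 1 ≤ b := by
    refine le_trans (one_le_mul_of_one_le_of_one_le hk' ?_) hb
    rw [le_div_iff₀ hτ0]
    linarith
  have hτ : ∀ u < k, τ ≤ |pivotVal M n k (2 ^ (k - 1)) tup u| := fun u hu => by
    have h1 := not_lt.1 (hpiv u hu)
    rw [← abs_mul_abs_self (pivotVal M n k (2 ^ (k - 1)) tup u)] at h1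
    nlinarith [abs_nonneg (pivotVal M n k (2 ^ (k - 1)) tup u)]
  obtain ⟨F, P, Fi, E₁, E₃, hF, hFP, hE₁, hFFi, hFiF, hFi, hA, hE₃, hv, hw⟩ :=
    hM.exists_factorization hδ hk hinj hτ0 hτ1 hτ ha hb hh hh1
  set A : Matrix (Fin k) (Fin k) ℝ := .of fun s u => matEntry M n k (2 ^ (k - 1)) tup s u with hAdef
  set ρ := 6 * a ^ 2 * b ^ 2 * h with hρdef
  have hgap' : ∀ j < k - 1, realEigenvalue A (j + 1) + ζ / 2 ≤ realEigenvalue A j :=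
    fun j hj => not_lt.1 (hgap j hj)
  have hclose : ∀ j : Fin k, ∃ i : Fin k,
      |realEigenvalue A j - Q.meanOrOne (tup (2 * k - 2)) i| ≤ ρ := by
    intro j
    have h1 := isRoot_realEigenvalue_of_gap (by linarith) hgap' j.2
    rw [hA, charpoly_conj hFFi hFiF] at h1
    rw [hA]
    exact exists_abs_sub_le_of_isRoot (fun i => (sum_abs_le_norm E₃ i).trans hE₃) h1
  choose σ hσ using hclose
  have hsep : ∀ i < k, ∀ j < k, i ≠ j → ζ / 2 ≤ |realEigenvalue A i - realEigenvalue A j| := by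
    have h1 : ∀ i j, i < j → j < k → ζ / 2 ≤ |realEigenvalue A i - realEigenvalue A j| := by
      intro i j hij hj
      have := realEigenvalue_gap (by linarith) hgap' hij hj
      exact (le_abs_self _).trans' (by linarith)
    intro i hi j hj hij
    rcases hij.lt_or_gt with h2 | h2
    · exact h1 i j h2 hj
    · rw [abs_sub_comm]
      exact h1 j i h2 hi
  -- Two eigenvalues near the same mean would be at most 2ρ < ζ/2 apart, against the tested gap.
  have hσinj : Function.Injective σ := by
    intro i j hij
    by_contra hne
    have h1 := hsep i i.2 j j.2 (fun h => hne (Fin.ext h))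
    have h2 := hσ i
    have h3 := hσ j
    rw [← hij, abs_sub_comm] at h3
    have h4 := abs_sub_le (realEigenvalue A i) (Q.meanOrOne (tup (2 * k - 2)) (σ i))
      (realEigenvalue A j)
    linarith
  refine ⟨Equiv.ofBijective σ (Finite.injective_iff_bijective.1 hσinj), fun j xw xv hxw hxv => ?_⟩
  have hnorm : ∀ x, ‖Q.meanOrOne x‖ ≤ 1 := fun x => (pi_norm_le_iff_of_nonneg zero_le_one).2
    fun j => by
      rw [Real.norm_eq_abs, abs_of_nonneg (Q.meanOrOne_mem _ j).1]
      exact (Q.meanOrOne_mem _ j).2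
  have hnorm' : ‖fun j => Q.weight j * Q.meanOrOne xv j‖ ≤ 1 :=
    (pi_norm_le_iff_of_nonneg zero_le_one).2 fun j => by
      rw [Real.norm_eq_abs, abs_of_nonneg (mul_nonneg (Q.weight_nonneg j) (Q.meanOrOne_mem _ j).1)]
      exact mul_le_one₀ (Q.weight_le_one j) (Q.meanOrOne_mem _ j).1 (Q.meanOrOne_mem _ j).2
  rw [coefficient_eq_dotProduct]
  exact coefficient_error (μ := fun l => realEigenvalue A l)
    (σ := Equiv.ofBijective σ (Finite.injective_iff_bijective.1 hσinj))
    (w := fun l s => lagrangeVec M n k (2 ^ (k - 1)) tup j xv l s) hF hFP hE₁ hFFi hFiF hFi hA hE₃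
    (by linarith) ha1 hb1 hζ hζ1 (Q.meanOrOne_mem _) hσ hsep j
    (fun l _ => lagrangeVec_succ M n k (2 ^ (k - 1)) tup j xv l) (hnorm xw) hnorm' (hv xv hxv)
    (hw xw hxw) (by simp only [lagrangeVec]; abel) (by abel)

end MixModel

/-! ### Acceptance of separated tuples and accuracy of the output -/

namespace MixModel

open Matrix
open scoped Matrix.Norms.Operator

variable {n k : ℕ}

/-- A complete pivot bounds all entries of its stage, so the rank argument with η = (2/ζ)^(k-1)
gives 2τ ≤ |pivot| + δ, and δ ≤ τ. -/
theorem IsApprox.le_abs_pivotVal {Q : MixModel n k} {M : Finset ℕ → ℝ} {δ τ ζ p : ℝ}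
    (hM : Q.IsApprox M δ) (hδ : 0 ≤ δ) (hk : 1 ≤ k) {tup : ℕ → ℕ} (hζ : 0 < ζ)
    (hinj : ∀ t < 2 * k - 1, ∀ t' < t, tup t ≠ tup t')
    (hsep : ∀ t < 2 * k - 1, ∀ j j', j ≠ j' →
      ζ ≤ |Q.meanOrOne (tup t) j - Q.meanOrOne (tup t) j'|)
    (hp : ∀ j, p ≤ Q.weight j) (hτ : 2 * τ * k * ((2 / ζ) ^ (k - 1)) ^ 2 ≤ p) (hδτ : δ ≤ τ)
    {t : ℕ} (ht : t < k) : τ ≤ |pivotVal M n k (2 ^ (k - 1)) tup t| := by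
  obtain ⟨κ, rfl⟩ : ∃ κ, k = κ + 1 := ⟨k - 1, by omega⟩
  obtain ⟨L, hL, hL1⟩ := exists_hadamard_left_inverse hζ
    (v := fun t => Q.meanOrOne (tup t)) (fun t j => Q.meanOrOne_mem _ j)
    (fun t ht => hsep t (by omega))
  obtain ⟨R, hR, hR1⟩ := exists_hadamard_left_inverse hζ
    (v := fun t => Q.meanOrOne (tup (κ + t))) (fun t j => Q.meanOrOne_mem _ j)
    (fun t ht => hsep (κ + t) (by omega))
  have h1 := (stage_isElimination (D := 2 ^ κ) M n (κ + 1) tup Nat.one_le_two_pow).le_of_left_inverse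
    ht (H := Q.rowProd tup) (G := Q.colProd tup) (w := Q.weight) hδ (fun a ha b hb => by
      have h2 := hM.abs_momentSet_sub_le hk (fun t ht => hinj t (by omega)) (a := a) (b := b) (x := n)
        ha (by simp)
      simp only [Q.meanOrOne_of_le le_rfl, mul_one] at h2
      rw [stage_zero ha hb]
      exact h2) (fun a ha b hb => abs_stage_le t ha hb) (abs_nonneg _) hp hL hR hL1 hR1
  have hpos : 0 < ((κ + 1 : ℕ) : ℝ) * ((2 / ζ) ^ κ) ^ 2 := by positivity
  have h3 : 2 * τ ≤ |pivotVal M n (κ + 1) (2 ^ κ) tup t| + δ := by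
    refine le_of_mul_le_mul_left ?_ hpos
    refine le_trans (le_of_eq ?_) (hτ.trans h1)
    rw [Nat.add_sub_cancel]
    ring
  rw [Nat.add_sub_cancel]
  linarith

/-- A tuple of separated observables passes the test. -/
theorem IsApprox.passes {Q : MixModel n k} {M : Finset ℕ → ℝ} {δ τ ζ p a b h : ℝ}
    (hM : Q.IsApprox M δ) (hδ : 0 ≤ δ) (hk : 1 ≤ k) {tup : ℕ → ℕ} (hζ : 0 < ζ)
    (hinj : ∀ t < 2 * k - 1, ∀ t' < t, tup t ≠ tup t')
    (hsep : ∀ t < 2 * k - 1, ∀ j j', j ≠ j' →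
      ζ ≤ |Q.meanOrOne (tup t) j - Q.meanOrOne (tup t) j'|)
    (hp : ∀ j, p ≤ Q.weight j) (hτ : 2 * τ * k * ((2 / ζ) ^ (k - 1)) ^ 2 ≤ p) (hδτ : δ ≤ τ)
    (hτ0 : 0 < τ) (hτ1 : τ ≤ 1) (ha : k * 2 ^ k ≤ a) (hb : k * (2 ^ k / τ) ≤ b)
    (hh : k * (4 ^ k * δ / τ) ≤ h) (hh1 : h ≤ 1 / 2) (hρ : 6 * a ^ 2 * b ^ 2 * h < ζ / 4) :
    Passes M n k (2 ^ (k - 1)) tup ζ τ := by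
  have hpiv : ∀ u < k, τ ≤ |pivotVal M n k (2 ^ (k - 1)) tup u| := fun u hu =>
    hM.le_abs_pivotVal hδ hk hζ hinj hsep hp hτ hδτ hu
  refine ⟨hinj, fun u hu => not_lt.2 ?_, fun j hj => not_lt.2 ?_⟩
  · rw [← abs_mul_abs_self (pivotVal M n k (2 ^ (k - 1)) tup u)]
    exact mul_le_mul (hpiv u hu) (hpiv u hu) hτ0.le (abs_nonneg _)
  · obtain ⟨F, P, Fi, E₁, E₃, -, -, -, hFFi, hFiF, -, hA, hE₃, -, -⟩ :=
      hM.exists_factorization hδ hk hinj hτ0 hτ1 hpiv ha hb hh hh1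
    -- Moving means that are ζ apart by at most ζ/4 each leaves the gap ζ/2 of the test.
    have hroots := fun i => exists_isRoot_abs_sub_le (r := ζ / 4)
      (fun i => (sum_abs_le_norm E₃ i).trans hE₃) (hsep (2 * k - 2) (by omega)) hρ (by linarith)
      (by linarith) i
    choose μ hμ hμ1 using hroots
    refine gap_realEigenvalue_of_roots (μ := μ) (by linarith) (fun i => ?_) (fun i i' hii => ?_) hj
    · rw [hA, charpoly_conj hFFi hFiF]
      exact hμ i
    · have h1 := hsep (2 * k - 2) (by omega) i i' hii
      have h2 := hμ1 i
      have h3 := hμ1 i'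
      rw [abs_sub_comm] at h2
      have h4 := abs_sub_le (Q.meanOrOne (tup (2 * k - 2)) i) (μ i)
        (Q.meanOrOne (tup (2 * k - 2)) i')
      have h5 := abs_sub_le (μ i) (μ i') (Q.meanOrOne (tup (2 * k - 2)) i')
      linarith

theorem abs_clamp_sub_le {x m : ℝ} (hm : m ∈ Set.Icc (0 : ℝ) 1) :
    |max 0 (min 1 x) - m| ≤ |x - m| := by
  obtain ⟨h0, h1⟩ := hm
  rcases le_total x 0 with hx | hx
  · rw [min_eq_right (by linarith), max_eq_left hx, abs_le]
    constructor <;> cases abs_cases (x - m) <;> linarith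
  rcases le_total x 1 with hx1 | hx1
  · rw [min_eq_right hx1, max_eq_right hx]
  · rw [min_eq_left hx1, max_eq_right zero_le_one, abs_le]
    constructor <;> cases abs_cases (x - m) <;> linarith

/-- Accurate coefficients yield a model that is close to the given one. -/
theorem exists_model_of_coefficient {Q : MixModel n k} {M : Finset ℕ → ℝ} {D : ℕ} {η ε p : ℝ}
    (hk : 1 ≤ k) {tup : ℕ → ℕ} (hinj : ∀ t < 2 * k - 1, ∀ t' < t, tup t ≠ tup t')
    (hp0 : 0 < p) (hp1 : p ≤ 1) (hε : 0 < ε) (hε1 : ε ≤ 1) (hp : ∀ j, p ≤ Q.weight j) (hη0 : 0 ≤ η)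
    (hη : 6 * k * η < ε * p) {σ : Equiv.Perm (Fin k)}
    (h : ∀ (j : Fin k) (xw xv : ℕ),
      (xw < n → ∀ t < k - 1, tup (k - 1 + t) ≠ xw) → (xv < n → ∀ t < k - 1, tup t ≠ xv) →
      |coefficient M n k D tup j xw xv -
        Q.meanOrOne xw (σ j) * (Q.weight (σ j) * Q.meanOrOne xv (σ j))| ≤ η) :
    ∃ Q' : MixModel n k, (∀ j : Fin k, Q'.weight j = weightOut M n k D tup j) ∧
      (∀ (i : Fin n) (j : Fin k), Q'.mean i j = meanOut M n k D tup i j) ∧ Q.dModel Q' < ε := by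
  have hk' : (1 : ℝ) ≤ k := by exact_mod_cast hk
  have hkη : η ≤ k * η := le_mul_of_one_le_left hη0 hk'
  have hεp : ε * p ≤ p := mul_le_of_le_one_left hp0.le hε1
  have hεp' : ε * p ≤ ε := mul_le_of_le_one_right hε.le hp1
  have hc : ∀ j : Fin k, |coefficient M n k D tup j n n - Q.weight (σ j)| ≤ η := by
    intro j
    have := h j n n (by simp) (by simp)
    rwa [Q.meanOrOne_of_le le_rfl, one_mul, mul_one] at this
  have hsum : |1 - ∑ i ∈ Finset.range k, coefficient M n k D tup i n n| ≤ k * η := by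
    have h1 : ∑ j, Q.weight (σ j) = 1 := by
      rw [Equiv.sum_comp σ Q.weight]
      exact Q.weight_mem.2
    rw [Finset.sum_range, ← h1, ← Finset.sum_sub_distrib]
    calc _ ≤ ∑ j : Fin k, |Q.weight (σ j) - coefficient M n k D tup j n n| :=
          Finset.abs_sum_le_sum_abs _ _
      _ ≤ ∑ _j : Fin k, η := Finset.sum_le_sum fun j _ => by
          rw [abs_sub_comm]
          exact hc j
      _ = k * η := by simp
  have hw : ∀ j : Fin k, |weightOut M n k D tup j - Q.weight (σ j)| ≤ η + k * η := by
    intro j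
    rw [weightOut, add_sub_right_comm]
    refine (abs_add_le _ _).trans (add_le_add (hc j) ?_)
    split_ifs
    · exact hsum
    · simpa using by positivity
  have hwpos : ∀ j : Fin k, p / 2 ≤ weightOut M n k D tup j := by
    intro j
    have h1 := (abs_le.1 (hw j)).1
    have h2 := hp (σ j)
    linarith
  have hwsum : ∑ j : Fin k, weightOut M n k D tup j = 1 := by
    simp only [weightOut]
    rw [Finset.sum_add_distrib, Finset.sum_eq_single_of_mem (⟨k - 1, by omega⟩ : Fin k)
      (Finset.mem_univ _) (fun j _ hj => if_neg fun h => hj (Fin.ext h)), if_pos rfl,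
      ← Finset.sum_range (fun j => coefficient M n k D tup j n n)]
    ring
  have hmean : ∀ (i : Fin n) (j : Fin k), |meanOut M n k D tup i j - Q.mean i (σ j)| < ε := by
    intro i j
    rw [meanOut]
    refine (abs_clamp_sub_le (Q.mean_mem i (σ j))).trans_lt ?_
    obtain ⟨c, hcdef⟩ : ∃ c, c = if ∃ l < k - 1, tup (k - 1 + l) = i then
      coefficient M n k D tup j n i else coefficient M n k D tup j i n := ⟨_, rfl⟩
    have hc1 : |c - Q.weight (σ j) * Q.mean i (σ j)| ≤ η := by
      rw [hcdef]
      split_ifs with hT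
      · obtain ⟨l, hl, he⟩ := hT
        have := h j n i (by simp) (fun _ t ht => by
          rw [← he]
          exact (hinj (k - 1 + l) (by omega) t (by omega)).symm)
        rwa [Q.meanOrOne_of_le le_rfl, one_mul, Q.meanOrOne_of_lt i.2] at this
      · have := h j i n (fun _ t ht he => hT ⟨t, ht, he⟩) (by simp)
        rwa [Q.meanOrOne_of_le le_rfl, mul_one, Q.meanOrOne_of_lt i.2, mul_comm] at this
    rw [← hcdef]
    have hm := Q.mean_mem i (σ j)
    have hw1 := hw j
    have hw2 := hwpos j
    generalize weightOut M n k D tup j = w at *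
    generalize Q.mean i (σ j) = m at *
    generalize Q.weight (σ j) = v at *
    have hw0 : 0 < w := by linarith
    rw [div_sub' hw0.ne', abs_div, abs_of_pos hw0, div_lt_iff₀ hw0]
    -- The total is at most 3kη < ε p/2, and w ≥ p/2, so the quotient is accurate up to ε.
    have h1 : |c - w * m| ≤ η + (η + k * η) := by
      have h2 : c - w * m = (c - v * m) - (w - v) * m := by ring
      rw [h2]
      refine (abs_sub _ _).trans (add_le_add hc1 ?_)
      rw [abs_mul, abs_of_nonneg hm.1]
      exact (mul_le_of_le_one_right (abs_nonneg _) hm.2).trans hw1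
    have h3 : ε * (p / 2) ≤ ε * w := mul_le_mul_of_nonneg_left hw2 hε.le
    linarith
  refine ⟨⟨fun j => weightOut M n k D tup j, fun i j => meanOut M n k D tup i j,
    ⟨fun j => (by linarith [hwpos j]), hwsum⟩, fun i j => ⟨le_max_left _ _,
      max_le zero_le_one (min_le_left _ _)⟩⟩, fun _ => rfl, fun _ _ => rfl, ?_⟩
  refine (ciInf_le (Set.finite_range _).bddBelow σ.symm).trans_lt (max_lt ?_ ?_)
  · refine (dist_pi_lt_iff hε).2 fun j => ?_
    rw [Real.dist_eq, abs_sub_comm]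
    have := hw (σ.symm j)
    rw [Equiv.apply_symm_apply] at this
    refine lt_of_le_of_lt this (by linarith)
  · refine (dist_pi_lt_iff hε).2 fun i => (dist_pi_lt_iff hε).2 fun j => ?_
    rw [Real.dist_eq, abs_sub_comm]
    have := hmean i (σ.symm j)
    rwa [Equiv.apply_symm_apply] at this

theorem nat_le_two_pow_real (k : ℕ) : (k : ℝ) ≤ 2 ^ k := by
  exact_mod_cast k.lt_two_pow_self.le

/-- The accuracy `ε τ ^ 8` of the moments suffices. -/
theorem error_lt {k : ℕ} (hk : 1 ≤ k) {ζ p ε τ : ℝ} (hζ : 0 < ζ) (hζ1 : ζ ≤ 1) (hp : 0 < p)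
    (hp1 : p ≤ 1) (hε : 0 < ε) (hτ : τ = p * (ζ / 16) ^ (2 * k)) :
    6 * k * (20 * k ^ 2 * (8 / ζ) ^ k * (k * 2 ^ k) ^ 2 * (k * (2 ^ k / τ)) ^ 2 *
      (k * (4 ^ k * (ε * τ ^ 8) / τ))) < ε * p := by
  obtain ⟨t, ht⟩ : ∃ t, t = (ζ / 16) ^ k := ⟨_, rfl⟩
  have ht0 : 0 < t := by rw [ht]; positivity
  have hτt : τ = p * t ^ 2 := by rw [hτ, ht, ← pow_mul, mul_comm k 2]
  have ht1 : t ≤ 1 / 16 ^ k := by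
    rw [ht, ← _root_.one_div_pow]
    exact pow_le_pow_left₀ (by positivity) (by linarith) k
  have h8 : (8 / ζ) ^ k = 1 / (2 ^ k * t) := by
    rw [ht, ← mul_pow, ← _root_.one_div_pow]
    congr 1
    field_simp
    norm_num
  have h16 : (1 : ℝ) ≤ 2 ^ k := one_le_pow₀ one_le_two
  have hk2 := nat_le_two_pow_real k
  have e4 : (4 : ℝ) ^ k = (2 ^ k) ^ 2 := by rw [← pow_mul, mul_comm, pow_mul]; norm_num
  have e16 : (16 : ℝ) ^ k = (2 ^ k) ^ 4 := by rw [← pow_mul, mul_comm, pow_mul]; norm_num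
  have h2 : (2 : ℝ) ≤ 2 ^ k := by
    calc (2 : ℝ) = 2 ^ 1 := by norm_num
      _ ≤ 2 ^ k := pow_le_pow_right₀ one_le_two hk
  have hk0 : (0 : ℝ) < k := by exact_mod_cast hk
  rw [h8, e4, hτt]
  rw [e16] at ht1
  generalize (2 : ℝ) ^ k = y at *
  have hy0 : 0 < y := by linarith
  -- Of the eight factors τ = p t², three are consumed by the divisions by pivots, and (8/ζ)^k =
  -- 1/(y t) takes one more t. The remaining t⁹ with t ≤ y⁻⁴ beats 120 k⁸ y⁵ ≤ y²⁰.
  have hexp : 6 * k * (20 * k ^ 2 * (1 / (y * t)) * (k * y) ^ 2 * (k * (y / (p * t ^ 2))) ^ 2 *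
      (k * (y ^ 2 * (ε * (p * t ^ 2) ^ 8) / (p * t ^ 2)))) =
      ε * p * (120 * k ^ 8 * y ^ 5 * p ^ 4 * t ^ 9) := by
    field_simp
    ring
  rw [hexp]
  refine mul_lt_of_lt_one_right (by positivity) ?_
  have ht1' : t * y ^ 4 ≤ 1 := by rwa [le_div_iff₀ (by positivity)] at ht1
  calc 120 * (k : ℝ) ^ 8 * y ^ 5 * p ^ 4 * t ^ 9 ≤ 120 * y ^ 8 * y ^ 5 * 1 ^ 4 * t ^ 9 := by gcongr
    _ < 2 ^ 7 * y ^ 8 * y ^ 5 * 1 ^ 4 * t ^ 9 := by gcongr; norm_num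
    _ ≤ y ^ 7 * y ^ 8 * y ^ 5 * 1 ^ 4 * t ^ 9 := by gcongr
    _ ≤ y ^ 7 * y ^ 8 * y ^ 5 * 1 ^ 4 * t ^ 9 * y ^ 16 :=
        le_mul_of_one_le_right (by positivity) (one_le_pow₀ h16)
    _ = (t * y ^ 4) ^ 9 := by ring
    _ ≤ 1 := pow_le_one₀ (by positivity) ht1'

/-- The threshold is low enough for separated tuples: (ζ/16 · 2/ζ)^(2k) = 8^(-2k), and 2k ≤ 8^k. -/
theorem tau_le {k : ℕ} {ζ p τ : ℝ} (hζ : 0 < ζ) (hζ1 : ζ ≤ 1) (hp : 0 < p)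
    (hτ : τ = p * (ζ / 16) ^ (2 * k)) : 2 * τ * k * ((2 / ζ) ^ (k - 1)) ^ 2 ≤ p := by
  have h1 : 1 ≤ 2 / ζ := by rw [le_div_iff₀ hζ]; linarith
  have h2 : (2 / ζ) ^ (k - 1) ≤ (2 / ζ) ^ k := pow_le_pow_right₀ h1 (by omega)
  have h3 : 2 * (k : ℝ) ≤ 8 ^ k := by
    have h4 := nat_le_two_pow_real k
    rcases Nat.eq_zero_or_pos k with rfl | hk
    · norm_num
    · calc 2 * (k : ℝ) ≤ 4 ^ k * 2 ^ k := by
            refine mul_le_mul ?_ h4 (by positivity) (by positivity)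
            calc (2 : ℝ) ≤ 4 ^ 1 := by norm_num
              _ ≤ 4 ^ k := pow_le_pow_right₀ (by norm_num) hk
        _ = 8 ^ k := by rw [← mul_pow]; norm_num
  have h5 : (ζ / 16) ^ (2 * k) * ((2 / ζ) ^ k) ^ 2 * 8 ^ k ≤ 1 := by
    rw [← pow_mul, mul_comm k 2, ← mul_pow, pow_mul, ← mul_pow]
    refine pow_le_one₀ (by positivity) ?_
    have : ζ / 16 * (2 / ζ) = 1 / 8 := by field_simp; norm_num
    rw [this]
    norm_num
  calc 2 * τ * k * ((2 / ζ) ^ (k - 1)) ^ 2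
      = p * ((ζ / 16) ^ (2 * k) * ((2 / ζ) ^ (k - 1)) ^ 2 * (2 * k)) := by rw [hτ]; ring
    _ ≤ p * ((ζ / 16) ^ (2 * k) * ((2 / ζ) ^ k) ^ 2 * 8 ^ k) := by gcongr
    _ ≤ p * 1 := by gcongr
    _ = p := mul_one p

/-- With sufficiently accurate moments, every tuple that passes the test yields a model close to the
given one, and every tuple of separated observables passes. -/
theorem IsApprox.exists_model_and_passes {Q : MixModel n k} {M : Finset ℕ → ℝ} {ζ p ε τ : ℝ}
    (hk : 1 ≤ k) (hζ : 0 < ζ) (hζ1 : ζ ≤ 1) (hp0 : 0 < p) (hε : 0 < ε) (hε1 : ε ≤ 1)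
    (hp : ∀ j, p ≤ Q.weight j) (hτ : τ = p * (ζ / 16) ^ (2 * k)) (hM : Q.IsApprox M (ε * τ ^ 8))
    (tup : ℕ → ℕ) :
    (Passes M n k (2 ^ (k - 1)) tup ζ τ → ∃ Q' : MixModel n k,
      (∀ j : Fin k, Q'.weight j = weightOut M n k (2 ^ (k - 1)) tup j) ∧
      (∀ (i : Fin n) (j : Fin k), Q'.mean i j = meanOut M n k (2 ^ (k - 1)) tup i j) ∧
      Q.dModel Q' < ε) ∧
    ((∀ t < 2 * k - 1, ∀ t' < t, tup t ≠ tup t') →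
      (∀ t < 2 * k - 1, ∀ j j', j ≠ j' →
        ζ ≤ |Q.meanOrOne (tup t) j - Q.meanOrOne (tup t) j'|) →
      Passes M n k (2 ^ (k - 1)) tup ζ τ) := by
  have hp1 : p ≤ 1 := (hp ⟨0, hk⟩).trans (Q.weight_le_one _)
  have hk' : (1 : ℝ) ≤ k := by exact_mod_cast hk
  have hτ0 : 0 < τ := by rw [hτ]; positivity
  have hτ1 : τ ≤ 1 := by
    rw [hτ]
    exact mul_le_one₀ hp1 (by positivity) (pow_le_one₀ (by positivity) (by linarith))
  have herr := error_lt hk hζ hζ1 hp0 hp1 hε hτ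
  have hδ : 0 ≤ ε * τ ^ 8 := by positivity
  have hδτ : ε * τ ^ 8 ≤ τ := by
    calc ε * τ ^ 8 ≤ 1 * τ ^ 1 := mul_le_mul hε1 (pow_le_pow_of_le_one hτ0.le hτ1 (by norm_num))
          (by positivity) zero_le_one
      _ = τ := by ring
  have ha1 : (1 : ℝ) ≤ k * 2 ^ k := one_le_mul_of_one_le_of_one_le hk' (one_le_pow₀ one_le_two)
  have hb1 : 1 ≤ k * (2 ^ k / τ) := by
    refine one_le_mul_of_one_le_of_one_le hk' ?_
    rw [le_div_iff₀ hτ0, one_mul]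
    exact hτ1.trans (one_le_pow₀ one_le_two)
  have h8 : 8 / ζ ≤ (8 / ζ) ^ k := le_self_pow₀ (by rw [le_div_iff₀ hζ]; linarith) (by omega)
  have h81 : 8 ≤ 8 / ζ := by rw [le_div_iff₀ hζ]; linarith
  have hh0 : 0 ≤ k * (4 ^ k * (ε * τ ^ 8) / τ) := by positivity
  generalize ha : (k : ℝ) * 2 ^ k = a at *
  generalize hb : (k : ℝ) * (2 ^ k / τ) = b at *
  generalize hh : (k : ℝ) * (4 ^ k * (ε * τ ^ 8) / τ) = h at *
  set X := 20 * (k : ℝ) ^ 2 * (8 / ζ) ^ k * a ^ 2 * b ^ 2 * h with hX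
  have hX0 : 0 ≤ X := by positivity
  have hX1 : 6 * X < 1 := by
    have h1 : 1 * X ≤ k * X := mul_le_mul_of_nonneg_right hk' hX0
    have h2 : ε * p ≤ 1 := mul_le_one₀ hε1 hp0.le hp1
    linarith
  have hab : h ≤ a ^ 2 * b ^ 2 * h := le_mul_of_one_le_left hh0
    (one_le_mul_of_one_le_of_one_le (one_le_pow₀ ha1) (one_le_pow₀ hb1))
  have hk2 : (1 : ℝ) ≤ k ^ 2 := one_le_pow₀ hk'
  -- The smallness of the final error X also implies the smallness conditions on ρ and h needed on
  -- the way.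
  have hXρ : 20 * 1 * (8 / ζ) * (a ^ 2 * b ^ 2 * h) ≤ X := by
    have : X = 20 * (k : ℝ) ^ 2 * (8 / ζ) ^ k * (a ^ 2 * b ^ 2 * h) := by rw [hX]; ring
    rw [this]
    gcongr
  have hρ : 6 * a ^ 2 * b ^ 2 * h < ζ / 4 := by
    have h1 : 20 * 1 * (8 / ζ) * (a ^ 2 * b ^ 2 * h) = 160 * (a ^ 2 * b ^ 2 * h) / ζ := by ring
    rw [h1, div_le_iff₀ hζ] at hXρ
    nlinarith
  have hh1 : h ≤ 1 / 2 := by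
    have h1 : 20 * 1 * 8 * (a ^ 2 * b ^ 2 * h) ≤ 20 * 1 * (8 / ζ) * (a ^ 2 * b ^ 2 * h) := by gcongr
    linarith
  refine ⟨fun hpass => ?_, fun hinj hsep => ?_⟩
  · obtain ⟨σ, hσ⟩ := hM.abs_coefficient_sub_le hδ hk hζ hζ1 hpass hτ0 hτ1 ha.le hb.le hh.le hh1 hρ
    exact exists_model_of_coefficient hk hpass.1 hp0 hp1 hε hε1 hp hX0 herr hσ
  · exact hM.passes hδ hk hζ hinj hsep hp (tau_le hζ hζ1 hp0 hτ) hδτ hτ0 hτ1 ha.le hb.le hh.le hh1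
      hρ

end MixModel

/-! ### Concentration of the empirical moments -/

section hoeffding

open ProbabilityTheory

/-- Hoeffding's inequality for the deviation of the average of independent samples. -/
theorem measure_pi_average_le {Ω : Type*} [MeasurableSpace Ω] (P : Measure Ω)
    [IsProbabilityMeasure P] {f : Ω → ℝ} (hf : Measurable f) {b δ : ℝ} (hb : 0 < b)
    (hfb : ∀ᵐ x ∂P, f x ∈ Set.Icc (-b) b) (hδ : 0 ≤ δ) {N : ℕ} (hN : 0 < N) :
    Measure.pi (fun _ : Fin N => P) {x | δ < |(∑ t, f (x t)) / N - ∫ y, f y ∂P|} ≤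
      ENNReal.ofReal (2 * Real.exp (-(N * δ ^ 2 / (2 * b ^ 2)))) := by
  set PN := Measure.pi (fun _ : Fin N => P) with hR
  set m := ∫ y, f y ∂P with hm
  have hN' : (0 : ℝ) < N := by exact_mod_cast hN
  let X : Fin N → (Fin N → Ω) → ℝ := fun t x => f (x t) - m
  have hsub : ∀ t, HasSubgaussianMGF (X t) ((‖b - -b‖₊ / 2) ^ 2) PN := by
    intro t
    have h1 := measurePreserving_eval (fun _ : Fin N => P) t
    have h2 : ∫ x : Fin N → Ω, f (x t) ∂PN = m := by
      have := integral_map (μ := PN) (φ := fun x : Fin N → Ω => x t) h1.measurable.aemeasurable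
        (f := f) (by rw [show Measure.map _ PN = P from h1.map_eq]; exact hf.aestronglyMeasurable)
      rw [← this, show Measure.map _ PN = P from h1.map_eq]
    have h3 := hasSubgaussianMGF_of_mem_Icc (μ := PN) (X := fun x : Fin N → Ω => f (x t)) (a := -b)
      (b := b) (hf.comp (measurable_pi_apply t)).aemeasurable (h1.quasiMeasurePreserving.ae hfb)
    rwa [h2] at h3
  have hind : iIndepFun X PN := iIndepFun_pi (X := fun _ y => f y - m)
    fun _ => (hf.sub_const m).aemeasurable
  -- The lower tail is the upper tail of the negated variables.
  have hind' : iIndepFun (fun t => -X t) PN := iIndepFun_pi (X := fun _ y => -(f y - m))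
    fun _ => (hf.sub_const m).neg.aemeasurable
  have hexp : Real.exp (-(N * δ) ^ 2 / (2 * ∑ _t : Fin N, ((‖b - -b‖₊ / 2) ^ 2 : NNReal))) =
      Real.exp (-(N * δ ^ 2 / (2 * b ^ 2))) := by
    congr 1
    have h4 : (((‖b - -b‖₊ / 2) ^ 2 : NNReal) : ℝ) = b ^ 2 := by
      push_cast
      rw [Real.norm_eq_abs, sub_neg_eq_add, abs_of_pos (by linarith)]
      ring
    rw [NNReal.coe_sum]
    simp only [h4, Finset.sum_const, Finset.card_univ, Fintype.card_fin, nsmul_eq_mul]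
    field_simp
  have h5 := HasSubgaussianMGF.measure_sum_ge_le_of_iIndepFun (s := Finset.univ) hind (fun t _ => hsub t)
    (ε := N * δ) (by positivity)
  have h6 := HasSubgaussianMGF.measure_sum_ge_le_of_iIndepFun (s := Finset.univ) hind' (fun t _ => (hsub t).neg)
    (ε := N * δ) (by positivity)
  rw [hexp] at h5 h6
  have hsubset : {x | δ < |(∑ t, f (x t)) / N - m|} ⊆
      {x | N * δ ≤ ∑ t, X t x} ∪ {x | N * δ ≤ ∑ t, (-X t) x} := by
    intro x hx
    have hx : δ < |(∑ t, f (x t)) / N - m| := hx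
    have h7 : ∑ t, X t x = N * ((∑ t, f (x t)) / N - m) := by
      simp only [X, Finset.sum_sub_distrib, Finset.sum_const, Finset.card_univ, Fintype.card_fin,
        nsmul_eq_mul]
      field_simp
    have h8 : ∑ t, (-X t) x = N * -((∑ t, f (x t)) / N - m) := by
      rw [mul_neg, ← h7, ← Finset.sum_neg_distrib]
      rfl
    rcases lt_abs.1 hx with h | h
    · left
      show N * δ ≤ ∑ t, X t x
      rw [h7]
      exact mul_le_mul_of_nonneg_left h.le hN'.le
    · right
      show N * δ ≤ ∑ t, (-X t) x
      rw [h8]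
      exact mul_le_mul_of_nonneg_left h.le hN'.le
  rw [ENNReal.le_ofReal_iff_toReal_le (measure_ne_top _ _) (by positivity)]
  calc _ ≤ PN.real ({x | N * δ ≤ ∑ t, X t x} ∪ {x | N * δ ≤ ∑ t, (-X t) x}) :=
        measureReal_mono hsubset
    _ ≤ _ := (measureReal_union_le _ _).trans (by linarith)

end hoeffding

namespace MixModel

variable {n k : ℕ} {Q : MixModel n k} {B : ℝ} {ν : Fin k → Fin n → Measure ℝ}

theorem IsConditional.isProbabilityMeasure_law (hν : Q.IsConditional B ν) :
    IsProbabilityMeasure (Q.law ν) := by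
  have := fun j i => (hν j i).1
  refine ⟨?_⟩
  simp only [law, Measure.coe_finsetSum, Finset.sum_apply, Measure.smul_apply, measure_univ,
    smul_eq_mul, mul_one]
  rw [← ENNReal.ofReal_sum_of_nonneg fun j _ => Q.weight_nonneg j, Q.weight_mem.2,
    ENNReal.ofReal_one]

theorem IsConditional.ae_law (hν : Q.IsConditional B ν) :
    ∀ᵐ x ∂(Q.law ν), ∀ i, x i ∈ Set.Icc (-B) B := by
  have := fun j i => (hν j i).1
  rw [law, ← Measure.sum_fintype, Measure.ae_sum_iff]
  intro j
  refine Measure.ae_smul_measure (ae_all_iff.2 fun i => ?_) _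
  exact (measurePreserving_eval (ν j) i).quasiMeasurePreserving.ae (hν j i).2.1

/-- Within a component the coordinates are independent, so the integral factors; coordinates outside
`s` contribute 1. Boundedness provides integrability. -/
theorem IsConditional.integral_prod_law (hν : Q.IsConditional B ν) (s : Finset (Fin n)) :
    ∫ x, ∏ i ∈ s, x i ∂(Q.law ν) = ∑ j, Q.weight j * ∏ i ∈ s, Q.mean i j := by
  have := fun j i => (hν j i).1
  have hmeas : Measurable fun x : Fin n → ℝ => ∏ i ∈ s, x i :=
    Finset.measurable_prod _ fun i _ => measurable_pi_apply i
  have hint : ∀ j, Integrable (fun x : Fin n → ℝ => ∏ i ∈ s, x i) (Measure.pi (ν j)) := by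
    intro j
    have h1 : ∀ᵐ x ∂(Measure.pi (ν j)), ∀ i, x i ∈ Set.Icc (-B) B := ae_all_iff.2 fun i =>
      (measurePreserving_eval (ν j) i).quasiMeasurePreserving.ae (hν j i).2.1
    refine Integrable.of_bound hmeas.aestronglyMeasurable (B ^ s.card) ?_
    filter_upwards [h1] with x hx
    rw [Real.norm_eq_abs, Finset.abs_prod, ← Finset.prod_const]
    exact Finset.prod_le_prod (fun _ _ => abs_nonneg _) fun i _ => abs_le.2 (hx i)
  rw [law, integral_finsetSum_measure fun j _ => (hint j).smul_measure ENNReal.ofReal_ne_top]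
  refine Finset.sum_congr rfl fun j _ => ?_
  rw [integral_smul_measure, ENNReal.toReal_ofReal (Q.weight_nonneg j), smul_eq_mul]
  congr 1
  have h2 : ∀ x : Fin n → ℝ, ∏ i ∈ s, x i = ∏ i, (if i ∈ s then fun y => y else fun _ => 1) (x i) := by
    intro x
    rw [← Finset.prod_subset (Finset.subset_univ s) (fun i _ hi => by simp [hi])]
    exact Finset.prod_congr rfl fun i hi => by simp [hi]
  rw [integral_congr_ae (Filter.Eventually.of_forall h2), integral_fintype_prod_eq_prod,
    ← Finset.prod_subset (Finset.subset_univ s) (fun i _ hi => by simp [hi])]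
  exact Finset.prod_congr rfl fun i hi => by simp [hi, (hν j i).2.2]

/-- The observables whose indices are values of `g`. -/
def indexSet {r : ℕ} (n : ℕ) (g : Fin r → Fin (n + 1)) : Finset (Fin n) :=
  Finset.univ.filter fun i => ∃ t, g t = i.castSucc

theorem card_indexSet_le {r : ℕ} (g : Fin r → Fin (n + 1)) : (indexSet n g).card ≤ r := by
  calc (indexSet n g).card = ((indexSet n g).image Fin.castSucc).card :=
        (Finset.card_image_of_injective _ (Fin.castSucc_injective n)).symm
    _ ≤ (Finset.univ.image g).card := Finset.card_le_card fun x hx => by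
        obtain ⟨i, hi, rfl⟩ := Finset.mem_image.1 hx
        obtain ⟨t, ht⟩ := (Finset.mem_filter.1 hi).2
        exact Finset.mem_image.2 ⟨t, Finset.mem_univ _, ht⟩
    _ ≤ r := Finset.card_image_le.trans (by simp)

/-- Lists of length r over n + 1 symbols, the last serving as padding, cover all relevant sets. So
the union bound has (n+1)^r terms, although S ranges over infinitely many sets. -/
theorem exists_indexSet_eq {r : ℕ} {S : Finset ℕ} (hS : S.card ≤ r) :
    ∃ g : Fin r → Fin (n + 1),
      Finset.univ.filter (fun i : Fin n => (i : ℕ) ∈ S) = indexSet n g := by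
  refine ⟨fun t => if h : (t : ℕ) < S.card then
    ⟨min (S.equivFin.symm ⟨t, h⟩ : ℕ) n, by omega⟩ else Fin.last n, ?_⟩
  ext i
  simp only [indexSet, Finset.mem_filter, Finset.mem_univ, true_and]
  constructor
  · intro hi
    have h1 := (S.equivFin ⟨i, hi⟩).2
    refine ⟨⟨S.equivFin ⟨i, hi⟩, h1.trans_le hS⟩, ?_⟩
    rw [dif_pos h1]
    ext
    simp [i.2.le]
  · rintro ⟨t, ht⟩
    split_ifs at ht with h
    · have h1 := congrArg Fin.val ht
      simp only [Fin.val_castSucc] at h1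
      have h2 : (S.equivFin.symm ⟨t, h⟩ : ℕ) = i := by have := i.2; omega
      rw [← h2]
      exact (S.equivFin.symm ⟨t, h⟩).2
    · have h1 := congrArg Fin.val ht
      have := i.2
      simp at h1
      omega

/-- The probability that some empirical moment deviates from its expectation by more than `δ`. -/
theorem IsConditional.measure_not_isApprox_le (hν : Q.IsConditional B ν) {b δ : ℝ} (hb : 1 ≤ b)
    (hB : B ≤ b) (hδ : 0 ≤ δ) {N : ℕ} (hN : 0 < N) :
    Q.sampleLaw ν N {x | ¬ Q.IsApprox (empiricalMoment x) δ} ≤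
      ENNReal.ofReal (((n : ℝ) + 1) ^ (2 * k - 1) *
        (2 * Real.exp (-(N * δ ^ 2 / (2 * (b ^ (2 * k - 1)) ^ 2))))) := by
  have := hν.isProbabilityMeasure_law
  have hsub : {x : Fin N → Fin n → ℝ | ¬ Q.IsApprox (empiricalMoment x) δ} ⊆
      ⋃ g : Fin (2 * k - 1) → Fin (n + 1), {x | δ < |(∑ t, ∏ i ∈ indexSet n g, x t i) / N -
        ∫ y, ∏ i ∈ indexSet n g, y i ∂(Q.law ν)|} := by
    intro x hx
    have hx : ¬ Q.IsApprox (empiricalMoment x) δ := hx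
    simp only [IsApprox] at hx
    push Not at hx
    obtain ⟨S, hS, hlt⟩ := hx
    obtain ⟨g, hg⟩ := exists_indexSet_eq (n := n) hS
    refine Set.mem_iUnion.2 ⟨g, ?_⟩
    rw [empiricalMoment, moment, hg] at hlt
    rw [Set.mem_ofPred_eq, hν.integral_prod_law]
    exact hlt
  refine (measure_mono hsub).trans ((measure_iUnion_le _).trans ?_)
  have hg : ∀ g : Fin (2 * k - 1) → Fin (n + 1), Q.sampleLaw ν N
      {x | δ < |(∑ t, ∏ i ∈ indexSet n g, x t i) / N -
        ∫ y, ∏ i ∈ indexSet n g, y i ∂(Q.law ν)|} ≤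
      ENNReal.ofReal (2 * Real.exp (-(N * δ ^ 2 / (2 * (b ^ (2 * k - 1)) ^ 2)))) := by
    intro g
    refine measure_pi_average_le (Q.law ν) (f := fun y => ∏ i ∈ indexSet n g, y i)
      (Finset.measurable_prod _ fun i _ => measurable_pi_apply i) (by positivity) ?_ hδ hN
    filter_upwards [hν.ae_law] with x hx
    refine abs_le.1 ?_
    rw [Finset.abs_prod]
    calc ∏ i ∈ indexSet n g, |x i| ≤ ∏ _i ∈ indexSet n g, b :=
          Finset.prod_le_prod (fun _ _ => abs_nonneg _) fun i _ => (abs_le.2 (hx i)).trans hB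
      _ = b ^ (indexSet n g).card := Finset.prod_const b
      _ ≤ b ^ (2 * k - 1) := pow_le_pow_right₀ hb (card_indexSet_le g)
  rw [tsum_fintype]
  refine (Finset.sum_le_sum fun g _ => hg g).trans (le_of_eq ?_)
  rw [Finset.sum_const, Finset.card_univ, Fintype.card_fun, Fintype.card_fin, Fintype.card_fin,
    nsmul_eq_mul, ENNReal.ofReal_mul (p := ((n : ℝ) + 1) ^ (2 * k - 1)) (by positivity)]
  congr 1
  rw [← ENNReal.ofReal_natCast]
  push_cast
  rfl

end MixModel

/-! ### The required number of samples -/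

theorem union_bound_le {n k c : ℕ} (hn : 1 ≤ n) (hk : 1 ≤ k) {y : ℝ}
    (hy : (c + 2 * k) * Real.log (n + 1) ≤ y) :
    ((n : ℝ) + 1) ^ (2 * k - 1) * (2 * Real.exp (-y)) ≤ 1 / ((n : ℝ) + 1) ^ c := by
  have hn' : (1 : ℝ) ≤ n := by exact_mod_cast hn
  have h1 : Real.exp (-y) ≤ 1 / ((n : ℝ) + 1) ^ (c + 2 * k) := by
    calc Real.exp (-y) ≤ Real.exp (-((c + 2 * k) * Real.log (n + 1))) :=
          Real.exp_le_exp.2 (neg_le_neg hy)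
      _ = 1 / ((n : ℝ) + 1) ^ (c + 2 * k) := by
          rw [Real.exp_neg, one_div]
          congr 1
          have : ((c : ℝ) + 2 * k) = ((c + 2 * k : ℕ) : ℝ) := by push_cast; rfl
          rw [this, Real.exp_nat_mul, Real.exp_log (by positivity)]
  obtain ⟨m, hm⟩ : ∃ m, 2 * k = m + 1 := ⟨2 * k - 1, by omega⟩
  rw [hm, Nat.add_sub_cancel]
  rw [hm] at h1
  calc ((n : ℝ) + 1) ^ m * (2 * Real.exp (-y))
      ≤ ((n : ℝ) + 1) ^ m * ((n + 1) * (1 / ((n : ℝ) + 1) ^ (c + (m + 1)))) := by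
        gcongr
        linarith
    _ = 1 / ((n : ℝ) + 1) ^ c := by
        rw [pow_add, pow_add]
        field_simp

theorem le_half_of_separated {x y z ζ : ℝ} (hx : x ∈ Set.Icc (0 : ℝ) 1) (hy : y ∈ Set.Icc (0 : ℝ) 1)
    (hz : z ∈ Set.Icc (0 : ℝ) 1) (hxy : ζ ≤ |x - y|) (hxz : ζ ≤ |x - z|) (hyz : ζ ≤ |y - z|) :
    ζ ≤ 1 / 2 := by
  obtain ⟨h1, h2⟩ := hx
  obtain ⟨h3, h4⟩ := hy
  obtain ⟨h5, h6⟩ := hz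
  rcases abs_cases (x - y) with ⟨e1, -⟩ | ⟨e1, -⟩ <;> rcases abs_cases (x - z) with ⟨e2, -⟩ | ⟨e2, -⟩ <;>
    rcases abs_cases (y - z) with ⟨e3, -⟩ | ⟨e3, -⟩ <;> linarith

/-- The constant G^k has to be absorbed into (1/ζ)^(Ck), although ζ may be 1. For k ≥ 3 separation
forces 1/ζ ≥ 2, so G ≤ (1/ζ)^G; for k ≤ 2 the constant is at most G². -/
theorem const_pow_le {G k : ℕ} {ζ : ℝ} (hζ : 0 < ζ) (hζ1 : ζ ≤ 1) (hG : 1 ≤ G)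
    (h : 3 ≤ k → ζ ≤ 1 / 2) :
    (G : ℝ) ^ k * (1 / ζ) ^ (32 * k) ≤ (G ^ 2 + G + 32 : ℕ) * (1 / ζ) ^ ((G ^ 2 + G + 32) * k) := by
  have h1 : 1 ≤ 1 / ζ := by rw [le_div_iff₀ hζ]; linarith
  have hG' : (1 : ℝ) ≤ G := by exact_mod_cast hG
  rcases lt_or_ge k 3 with hk | hk
  · refine mul_le_mul ?_ (pow_le_pow_right₀ h1 (Nat.mul_le_mul_right _ (by omega))) (by positivity)
      (by positivity)
    calc (G : ℝ) ^ k ≤ G ^ 2 := pow_le_pow_right₀ hG' (by omega)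
      _ ≤ (G ^ 2 + G + 32 : ℕ) := by push_cast; linarith
  · have h2 : 2 ≤ 1 / ζ := by rw [le_div_iff₀ hζ]; linarith [h hk]
    have h3 : (G : ℝ) ≤ (1 / ζ) ^ G :=
      (by exact_mod_cast G.lt_two_pow_self.le : (G : ℝ) ≤ 2 ^ G).trans
        (pow_le_pow_left₀ zero_le_two h2 G)
    calc (G : ℝ) ^ k * (1 / ζ) ^ (32 * k) ≤ ((1 / ζ) ^ G) ^ k * (1 / ζ) ^ (32 * k) := by gcongr
      _ = (1 / ζ) ^ ((G + 32) * k) := by rw [← pow_mul, ← pow_add]; ring_nf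
      _ ≤ (1 / ζ) ^ ((G ^ 2 + G + 32) * k) :=
          pow_le_pow_right₀ h1 (Nat.mul_le_mul_right _ (by omega))
      _ ≤ _ := le_mul_of_one_le_left (by positivity) (by exact_mod_cast (by omega))

/-- The number of samples in the statement suffices for Hoeffding's inequality. -/
theorem exists_sampleBound_ge (b : ℕ) (hb : 1 ≤ b) : ∃ C : ℕ, ∀ (n k : ℕ) (ζ p ε τ : ℝ), 1 ≤ k →
    0 < ζ → ζ ≤ 1 → 0 < p → p ≤ 1 → 0 < ε → (3 ≤ k → ζ ≤ 1 / 2) → τ = p * (ζ / 16) ^ (2 * k) →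
    4 * k * (b : ℝ) ^ (4 * k) * Real.log (n + 1) / (ε * τ ^ 8) ^ 2 ≤ sampleBound C n k ζ p ε := by
  -- 4k ≤ 8^k, the squared range of the products is bounded by b^(4k), and τ^16 contains
  -- (ζ/16)^(32k).
  obtain ⟨G, hGdef⟩ : ∃ G : ℕ, G = 8 * b ^ 4 * 16 ^ 32 := ⟨_, rfl⟩
  have hG : 1 ≤ G := by rw [hGdef]; exact Nat.one_le_iff_ne_zero.2 (by positivity)
  refine ⟨G ^ 2 + G + 32, fun n k ζ p ε τ hk hζ hζ1 hp hp1 hε h3 hτ => ?_⟩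
  have hlog : 0 ≤ Real.log ((n : ℝ) + 1) := Real.log_nonneg (by linarith [Nat.cast_nonneg (α := ℝ) n])
  have hp' : 1 ≤ 1 / p := by rw [le_div_iff₀ hp]; linarith
  have h1 : 4 * (k : ℝ) * (b : ℝ) ^ (4 * k) * (16 ^ 32) ^ k ≤ (G : ℝ) ^ k := by
    have h4 : (4 : ℝ) ≤ 4 ^ k := le_self_pow₀ (by norm_num) (by omega)
    have h5 : (k : ℝ) ≤ 2 ^ k := by exact_mod_cast k.lt_two_pow_self.le
    calc 4 * (k : ℝ) * (b : ℝ) ^ (4 * k) * (16 ^ 32) ^ k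
        ≤ 4 ^ k * 2 ^ k * (b : ℝ) ^ (4 * k) * (16 ^ 32) ^ k := by gcongr
      _ = (G : ℝ) ^ k := by
          rw [hGdef, pow_mul, ← mul_pow, ← mul_pow, ← mul_pow]
          push_cast
          norm_num
  have h2 : 4 * k * (b : ℝ) ^ (4 * k) * Real.log (n + 1) / (ε * τ ^ 8) ^ 2 =
      (4 * k * (b : ℝ) ^ (4 * k) * (16 ^ 32) ^ k) * (1 / ζ) ^ (32 * k) * (1 / p) ^ 16 *
        Real.log (n + 1) * (1 / ε) ^ 2 := by
    have h6 : (ε * τ ^ 8) ^ 2 = ε ^ 2 * p ^ 16 * (ζ ^ (32 * k) / (16 ^ 32) ^ k) := by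
      rw [hτ, div_pow, ← pow_mul 16 32 k]
      ring_nf
    rw [h6]
    have hu : ((16 : ℝ) ^ 32) ^ k ≠ 0 := by positivity
    have hz : ζ ^ (32 * k) ≠ 0 := by positivity
    rw [one_div_pow (n := 32 * k)]
    generalize ((16 : ℝ) ^ 32) ^ k = u at hu ⊢
    generalize ζ ^ (32 * k) = z at hz ⊢
    field_simp
  rw [h2, sampleBound]
  have h7 := const_pow_le hζ hζ1 hG h3
  have h8 : (1 / p) ^ 16 ≤ (1 / p) ^ (G ^ 2 + G + 32) := pow_le_pow_right₀ hp' (by omega)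
  calc _ ≤ (G : ℝ) ^ k * (1 / ζ) ^ (32 * k) * (1 / p) ^ 16 * Real.log (n + 1) * (1 / ε) ^ 2 := by
        gcongr
    _ ≤ ((G ^ 2 + G + 32 : ℕ) * (1 / ζ) ^ ((G ^ 2 + G + 32) * k)) * (1 / p) ^ (G ^ 2 + G + 32) *
        Real.log (n + 1) * (1 / ε) ^ 2 := by gcongr
    _ = _ := by ring

namespace MixModel

variable {n k : ℕ} {Q : MixModel n k} {B : ℝ} {ν : Fin k → Fin n → Measure ℝ}

theorem IsConditional.measure_not_isApprox_le_of_sample (hν : Q.IsConditional B ν) {b δ : ℝ}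
    (hb : 1 ≤ b) (hB : B ≤ b) (hδ : 0 < δ) (hn : 1 ≤ n) (hk : 1 ≤ k) {c N : ℕ}
    (hN : (c + 1) * (4 * k * b ^ (4 * k) * Real.log (n + 1) / δ ^ 2) ≤ N) :
    Q.sampleLaw ν N {x | ¬ Q.IsApprox (empiricalMoment x) δ} ≤
      ENNReal.ofReal (1 / ((n : ℝ) + 1) ^ c) := by
  have hn' : (1 : ℝ) ≤ n := by exact_mod_cast hn
  have hk' : (1 : ℝ) ≤ k := by exact_mod_cast hk
  have hlog : 0 < Real.log ((n : ℝ) + 1) := Real.log_pos (by linarith)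
  have hN0 : 0 < N := by
    have : (0 : ℝ) < N := lt_of_lt_of_le (by positivity) hN
    exact_mod_cast this
  refine (hν.measure_not_isApprox_le hb hB hδ.le hN0).trans (ENNReal.ofReal_le_ofReal
    (union_bound_le hn hk ?_))
  have h1 : (b ^ (2 * k - 1)) ^ 2 ≤ b ^ (4 * k) := by
    rw [← pow_mul]
    exact pow_le_pow_right₀ hb (by omega)
  rw [le_div_iff₀ (by positivity)]
  rw [← mul_div_assoc, div_le_iff₀ (by positivity)] at hN
  refine le_trans ?_ hN
  -- c + 2k ≤ (c + 1)·2k turns the exponent of the union bound into the factor c + 1 of the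
  -- statement.
  calc (c + 2 * k) * Real.log (n + 1) * (2 * (b ^ (2 * k - 1)) ^ 2)
      ≤ ((c + 1) * (2 * k)) * Real.log (n + 1) * (2 * b ^ (4 * k)) := by
        gcongr
        nlinarith [Nat.cast_nonneg (α := ℝ) c]
    _ = _ := by ring

theorem exists_sample_size (B : ℝ) : ∃ C : ℕ, ∀ (n k : ℕ) (ζ p ε τ : ℝ), 1 ≤ k → 1 ≤ n → 0 < ζ →
    ζ ≤ 1 → 0 < p → 0 < ε → τ = p * (ζ / 16) ^ (2 * k) →
    ∀ (Q : MixModel n k) (ν : Fin k → Fin n → Measure ℝ), (∀ j, p ≤ Q.weight j) →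
    Q.IsConditional B ν → (∃ i, Q.Separated ζ i) →
    ∀ c N : ℕ, (c + 1) * sampleBound C n k ζ p ε ≤ N →
      Q.sampleLaw ν N {x | ¬ Q.IsApprox (empiricalMoment x) (ε * τ ^ 8)} ≤
        ENNReal.ofReal (1 / ((n : ℝ) + 1) ^ c) := by
  obtain ⟨b, hb⟩ := exists_nat_ge (max 1 B)
  have hb1 : 1 ≤ (b : ℝ) := (le_max_left _ _).trans hb
  obtain ⟨C, hC⟩ := exists_sampleBound_ge b (by exact_mod_cast hb1)
  refine ⟨C, fun n k ζ p ε τ hk hn hζ hζ1 hp0 hε hτ Q ν hp hν hsep c N hN => ?_⟩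
  have hp1 : p ≤ 1 := (hp ⟨0, hk⟩).trans (Q.weight_le_one _)
  have h3 : 3 ≤ k → ζ ≤ 1 / 2 := by
    intro h3
    obtain ⟨i, hi⟩ := hsep
    exact le_half_of_separated (Q.mean_mem i ⟨0, by omega⟩) (Q.mean_mem i ⟨1, by omega⟩)
      (Q.mean_mem i ⟨2, by omega⟩) (hi _ _ (by simp)) (hi _ _ (by simp)) (hi _ _ (by simp))
  refine hν.measure_not_isApprox_le_of_sample hb1 ((le_max_right _ _).trans hb)
    (by rw [hτ]; positivity) hn hk (le_trans ?_ hN)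
  exact mul_le_mul_of_nonneg_left (hC n k ζ p ε τ hk hζ hζ1 hp0 hp1 hε h3 hτ) (by positivity)

theorem outputs_of_lowOut {s : RamState} {M : Finset ℕ → ℝ} {D : ℕ} {tup : ℕ → ℕ}
    (hs : ∀ x < k + n * k, s.real x = lowOut M n k D tup x) {Q' : MixModel n k}
    (hw : ∀ j : Fin k, Q'.weight j = weightOut M n k D tup j)
    (hm : ∀ (i : Fin n) (j : Fin k), Q'.mean i j = meanOut M n k D tup i j) : Outputs s Q' := by
  refine ⟨fun j => ?_, fun i j => ?_⟩
  · rw [hs j (by have := j.2; omega), lowOut, if_pos j.2, hw]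
  · have h1 : (i : ℕ) * k + j < n * k := MP.index_lt i.2 j.2
    rw [hs _ (by omega), lowOut, if_neg (by omega), hm]
    have h2 : k + (i : ℕ) * k + j - k = i * k + j := by omega
    rw [h2, MP.index_div j.2, MP.index_mod j.2]

theorem Separated.meanOrOne {ζ : ℝ} {i : Fin n} (h : Q.Separated ζ i) {x : ℕ} (hx : x = i)
    (j j' : Fin k) (hj : j ≠ j') : ζ ≤ |Q.meanOrOne x j - Q.meanOrOne x j'| := by
  subst hx
  rw [Q.meanOrOne_of_lt i.2, Q.meanOrOne_of_lt i.2]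
  exact h j j' hj

theorem ne_of_injective {r : ℕ} {A : Fin r → Fin n} (hA : Function.Injective A) {tup : ℕ → ℕ}
    (htup : ∀ t : Fin r, tup t = A t) : ∀ t < r, ∀ t' < t, tup t ≠ tup t' := by
  intro t ht t' ht' he
  have h1 := htup ⟨t, ht⟩
  have h2 := htup ⟨t', by omega⟩
  simp only at h1 h2
  rw [h1, h2] at he
  have := Fin.mk.inj (hA (Fin.ext he))
  omega

end MixModel

theorem corollary3p3 :
    -- a set of `2k - 1` separated observables is known
    (∃ (P : RamProg) (K : ℝ),
      (∀ (n k : ℕ) (ζ p ε : ℝ) (A : Fin (2 * k - 1) → Fin n) (M : Finset ℕ → ℝ),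
        1 ≤ k → 2 * k - 1 ≤ n → Function.Injective A →
        (P.time M (inputKnown n k ζ p ε A) : ℝ) ≤ n * Real.exp (K * k)) ∧
      ∀ B : ℝ, ∃ C : ℕ,
        ∀ (n k : ℕ) (ζ p ε : ℝ), 1 ≤ k → 2 * k - 1 ≤ n → 0 < ζ → ζ ≤ 1 → 0 < p → 0 < ε → ε ≤ 1 →
        ∀ (Q : MixModel n k) (ν : Fin k → Fin n → MeasureTheory.Measure ℝ)
          (A : Fin (2 * k - 1) → Fin n),
        (∀ j, p ≤ Q.weight j) → Q.IsConditional B ν →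
        Function.Injective A → (∀ t, Q.Separated ζ (A t)) →
        ∀ c N : ℕ, (c + 1) * sampleBound C n k ζ p ε ≤ N →
          Q.sampleLaw ν N {x | ¬ Identifies P (inputKnown n k ζ p ε A) x Q ε} ≤
            ENNReal.ofReal (1 / ((n : ℝ) + 1) ^ c)) ∧
    -- no such set is known, but one exists
    (∃ (P : RamProg) (K : ℝ),
      (∀ (n k : ℕ) (ζ p ε : ℝ) (M : Finset ℕ → ℝ),
        1 ≤ k → 2 * k - 1 ≤ n →
        (P.time M (inputUnknown n k ζ p ε) : ℝ) ≤ (n : ℝ) ^ (2 * k) * Real.exp (K * k)) ∧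
      ∀ B : ℝ, ∃ C : ℕ,
        ∀ (n k : ℕ) (ζ p ε : ℝ), 1 ≤ k → 2 * k - 1 ≤ n → 0 < ζ → ζ ≤ 1 → 0 < p → 0 < ε → ε ≤ 1 →
        ∀ (Q : MixModel n k) (ν : Fin k → Fin n → MeasureTheory.Measure ℝ),
        (∀ j, p ≤ Q.weight j) → Q.IsConditional B ν →
        (∃ A : Fin (2 * k - 1) → Fin n, Function.Injective A ∧ ∀ t, Q.Separated ζ (A t)) →
        ∀ c N : ℕ, (c + 1) * sampleBound C n k ζ p ε ≤ N →
          Q.sampleLaw ν N {x | ¬ Identifies P (inputUnknown n k ζ p ε) x Q ε} ≤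
            ENNReal.ofReal (1 / ((n : ℝ) + 1) ^ c)) := by
  constructor
  · obtain ⟨P, K, hP⟩ := exists_program_known
    refine ⟨P, K, fun n k ζ p ε A M hk hn _ => (hP n k ζ p ε A M hk hn).1, fun B => ?_⟩
    obtain ⟨C, hC⟩ := MixModel.exists_sample_size B
    refine ⟨C, fun n k ζ p ε hk hn hζ hζ1 hp0 hε hε1 Q ν A hp hν hA hsep c N hN => ?_⟩
    -- Failure is contained in the event that some moment is inaccurate; the rest is deterministic.
    refine le_trans (measure_mono fun x hx => ?_) (hC n k ζ p ε _ hk (by omega) hζ hζ1 hp0 hε rfl Q ν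
      hp hν ⟨A ⟨0, by omega⟩, hsep _⟩ c N hN)
    refine fun hM : Q.IsApprox _ _ => hx ?_
    obtain ⟨-, tup, htup, hout⟩ := hP n k ζ p ε A (empiricalMoment x) hk hn
    obtain ⟨h1, h2⟩ := hM.exists_model_and_passes hk hζ hζ1 hp0 hε hε1 hp rfl tup
    obtain ⟨Q', hw, hm, hd⟩ := h1 (h2 (MixModel.ne_of_injective hA htup)
      fun t ht => (hsep ⟨t, ht⟩).meanOrOne (htup ⟨t, ht⟩))
    exact ⟨Q', MixModel.outputs_of_lowOut hout hw hm, hd⟩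
  · obtain ⟨P, K, hP⟩ := exists_program_unknown
    refine ⟨P, K, fun n k ζ p ε M hk hn => (hP n k ζ p ε M hk hn).1, fun B => ?_⟩
    obtain ⟨C, hC⟩ := MixModel.exists_sample_size B
    refine ⟨C, fun n k ζ p ε hk hn hζ hζ1 hp0 hε hε1 Q ν hp hν ⟨A, hA, hsep⟩ c N hN => ?_⟩
    refine le_trans (measure_mono fun x hx => ?_) (hC n k ζ p ε _ hk (by omega) hζ hζ1 hp0 hε rfl Q ν
      hp hν ⟨A ⟨0, by omega⟩, hsep _⟩ c N hN)
    refine fun hM : Q.IsApprox _ _ => hx ?_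
    -- The accepted tuple need not be separated, but passing suffices. That all tuples fail is
    -- impossible, since the separated tuple `A` passes.
    obtain ⟨-, tup, hout, hpass | hfail⟩ := hP n k ζ p ε (empiricalMoment x) hk hn
    · obtain ⟨Q', hw, hm, hd⟩ := (hM.exists_model_and_passes hk hζ hζ1 hp0 hε hε1 hp rfl tup).1 hpass.1
      exact ⟨Q', MixModel.outputs_of_lowOut hout hw hm, hd⟩
    · obtain ⟨tup', htup, hnot⟩ := hfail A
      exact absurd ((hM.exists_model_and_passes hk hζ hζ1 hp0 hε hε1 hp rfl tup').2
        (MixModel.ne_of_injective hA htup)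
        fun t ht => (hsep ⟨t, ht⟩).meanOrOne (htup ⟨t, ht⟩)) hnot
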